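/- **Notions.** Strings are finite words over a finite alphabet containing $0$, $1$ and a separator symbol; $\mathcal B$ is the set of all string functions. An oracle machine is a multi-tape Turing machine with a query tape and an answer tape; a call of the oracle $\varphi\in\mathcal B$ takes one time step, in which the content of the answer tape is replaced by the value of $\varphi$ on the content of the query tape. $M^\varphi$ denotes the string function computed by $M$ with oracle $\varphi$. Second-order polynomials are the smallest class of functions $\mathbb N^{\mathbb N}\times\mathbb N\to\mathbb N$ that contains $(l,n)\mapsto p(n)$ for $p\in\mathbb N[X]$ and is closed under $P\mapsto\big((l,n)\mapsto l(P(l,n))\big)$ and pointwise sums and products. A preparametrised space $(X,\xi,\mu)$ is a set $X$ with a surjective partial function $\xi:\subseteq\mathcal B\to X$ (a $\varphi$ with $\xi(\varphi)=x$ is a name of $x$) and a map $\mu$ from $\operatorname{dom}(\xi)$ to the non-decreasing functions $\mathbb N\to\mathbb N$. A function $f:X\to Y$ between such spaces is *polytime computable* if there are an oracle machine $M$ and second-order polynomials $P,Q$ such that for every name $\varphi$ of any $x\in X$: $M^\varphi$ is total and a name of $f(x)$; $M$ with oracle $\varphi$ halts on every input $\mathbf a$ within $P(\mu_X(\varphi),|\mathbf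 a|)$ steps; and $\mu_Y(M^\varphi)(n)\le Q(\mu_X(\varphi),n)$ for all $n$. In the product $X\times Y$, the names of $(x,y)$ are the pairs $\langle\psi,\chi\rangle$ of names, where $\langle\psi,\chi\rangle(0\mathbf b)=\psi(\mathbf b)$, $\langle\psi,\chi\rangle(1\mathbf b)=\chi(\mathbf b)$ and all other strings go to the empty string; the parameter is $\max\{\mu_X(\psi)(n),\mu_Y(\chi)(n)\}$. Let $\mathrm{I}\mathbb D$ be the set of intervals $[r\pm\varepsilon]=[r-\varepsilon,r+\varepsilon]$ with $r,\varepsilon$ dyadic rationals and $\varepsilon>0$, together with the infinite interval; $\operatorname{diam}[r\pm\varepsilon]=2\varepsilon$, and $\operatorname{diam}$ of the infinite interval is $\infty$. Finite intervals are coded by pairs of finite binary expansions of $r$ and $\varepsilon$, in a pairing that interleaves the digits of the two strings. A sequence in $\mathrm{I}\mathbb D$ is a name of $x\in\mathbb R$ if it is nested with intersection $\{x\}$. The space $C(I)_i$ is the set $C([0,1])$ of continuous functions $[0,1]\to\mathbb R$ with the following representation and parameter. A name of $f$ is a function $\psi:\mathrm{I}\mathbb D\to\mathrm{I}\mathbb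 D$ (given on codes) such that for every $x\in[0,1]$ and every name $(J_k)_k$ of $x$, $(\psi(J_k))_k$ is a name of $f(x)$. Its parameter is $$\mu(\psi)(n)=\lceil\log_2(\|f\|_\infty+1)\rceil+\min\{N\in\mathbb N\mid \forall J\in\mathrm{I}\mathbb D:\ J\cap[0,1]\ne\emptyset\wedge\operatorname{diam}(J)\le2^{-N}\Rightarrow\operatorname{diam}(\psi(J))\le2^{-n}\}.$$ The set $C([0,1],[0,1])$ of continuous maps from $[0,1]$ to $[0,1]$ is equipped with the restrictions of this representation and parameter. **Theorem (Operations).** The pointwise arithmetic operations $$C([0,1])\times C([0,1])\to C([0,1]),\quad (f,g)\mapsto f+g,\quad (f,g)\mapsto f-g,\quad (f,g)\mapsto f\cdot g,$$ and the composition operator $$C([0,1])\times C([0,1],[0,1])\to C([0,1]),\quad (f,g)\mapsto f\circ g,$$ are polytime computable, where $C([0,1])$ is the space $C(I)_i$, $C([0,1],[0,1])$ is its subspace, and products are products of preparametrised spaces. -/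

import Mathlib

namespace IntervalComplexity

noncomputable section

/-! ### Strings, string functions, second-order polynomials -/

/-- The alphabet: the two binary digits and the separator symbol used in codes of dyadic numbers. -/
inductive Letter
  | zero
  | one
  | point

/-- Finite strings over the alphabet. -/
abbrev Str := List Letter

/-- Baire space: all string functions. -/
abbrev Baire := Str → Str

/-- The class of second-order polynomials. -/
inductive IsSecondOrderPoly : ((ℕ → ℕ) → ℕ → ℕ) → Prop
  | poly (p : Polynomial ℕ) : IsSecondOrderPoly (fun _ n => p.eval n)
  | app {P : (ℕ → ℕ) → ℕ → ℕ} (hP : IsSecondOrderPoly P) :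
      IsSecondOrderPoly (fun l n => l (P l n))
  | add {P Q : (ℕ → ℕ) → ℕ → ℕ} (hP : IsSecondOrderPoly P) (hQ : IsSecondOrderPoly Q) :
      IsSecondOrderPoly (fun l n => P l n + Q l n)
  | mul {P Q : (ℕ → ℕ) → ℕ → ℕ} (hP : IsSecondOrderPoly P) (hQ : IsSecondOrderPoly Q) :
      IsSecondOrderPoly (fun l n => P l n * Q l n)

/-! ### Oracle Turing machines -/

/-- The tapes of an oracle machine: four designated tapes and the work tapes. -/
inductive TapeName (W : Type)
  | input
  | output
  | query
  | answer
  | work (w : W)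

/-- Head movements. -/
inductive Move
  | left
  | stay
  | right

/-- The displacement of a head movement. -/
def Move.shift : Move → ℤ
  | .left => -1
  | .stay => 0
  | .right => 1

/-- The content of a tape cell: blank, a letter, or an auxiliary symbol of the machine. -/
abbrev Cell (A : Type) := Option (Letter ⊕ A)

/-- The letter in a cell, if there is one. -/
def cellLetter {A : Type} : Cell A → Option Letter
  | some (Sum.inl x) => some x
  | _ => none

/-- The tape that carries the string `s` from cell `0` on and is blank elsewhere. -/
def tapeOfStr {A : Type} (s : Str) : ℤ → Cell A :=
  fun i => if i < 0 then none else (s[i.toNat]?).map Sum.inl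

/-- The string written on a tape: it starts in cell `0` and ends before the first cell that does
not hold a letter. -/
def strOfTape {A : Type} (t : ℤ → Cell A) : Str :=
  (List.range (sInf {n : ℕ | cellLetter (t n) = none})).filterMap fun i : ℕ => cellLetter (t i)

/-- A deterministic multi-tape oracle Turing machine. Each tape is infinite in both directions and
has one head. -/
structure OracleMachine where
  /-- the control states -/
  State : Type
  /-- the names of the work tapes -/
  WorkTape : Type
  /-- the auxiliary tape symbols -/
  Aux : Type
  finite_state : Finite State
  finite_workTape : Finite WorkTape
  finite_aux : Finite Aux
  /-- the initial state -/
  start : State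
  /-- the halting state -/
  halt : State
  /-- the oracle state -/
  query : State
  /-- the state in which the computation continues after an oracle call -/
  resume : State
  /-- the transition function: from the state and the scanned symbols it determines the next
  state, the symbols to be written and the head movements -/
  trans : State → (TapeName WorkTape → Cell Aux) →
    State × (TapeName WorkTape → Cell Aux × Move)

namespace OracleMachine

/-- Configurations of an oracle machine. -/
structure Config (M : OracleMachine) where
  state : M.State
  cells : TapeName M.WorkTape → ℤ → Cell M.Aux
  head : TapeName M.WorkTape → ℤ

/-- The initial configuration: the input is on the input tape, all other tapes are blank. -/
def init (M : OracleMachine) (a : Str) : M.Config where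
  state := M.start
  cells := fun t =>
    match t with
    | .input => tapeOfStr a
    | _ => fun _ => none
  head := fun _ => 0

/-- An oracle call: the content of the answer tape is replaced by the value of the oracle on the
content of the query tape; no head moves. -/
def oracleStep (M : OracleMachine) (φ : Baire) (c : M.Config) : M.Config where
  state := M.resume
  cells := fun t =>
    match t with
    | .answer => tapeOfStr (φ (strOfTape (c.cells .query)))
    | t => c.cells t
  head := c.head

/-- An ordinary step. -/
def transStep (M : OracleMachine) (c : M.Config) : M.Config where
  state := (M.trans c.state fun t => c.cells t (c.head t)).1
  cells := fun t i =>
    if i = c.head t then ((M.trans c.state fun t => c.cells t (c.head t)).2 t).1 else c.cells t i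
  head := fun t =>
    c.head t + ((M.trans c.state fun t => c.cells t (c.head t)).2 t).2.shift

open Classical in
/-- One time step with oracle `φ`. Nothing happens after the machine has halted. -/
def step (M : OracleMachine) (φ : Baire) (c : M.Config) : M.Config :=
  if c.state = M.halt then c
  else if c.state = M.query then M.oracleStep φ c
  else M.transStep c

/-- The configuration after `t` steps on input `a` with oracle `φ`. -/
def configAt (M : OracleMachine) (φ : Baire) (a : Str) (t : ℕ) : M.Config :=
  (M.step φ)^[t] (M.init a)

/-- After `t` steps the machine has halted. -/
def HaltedAt (M : OracleMachine) (φ : Baire) (a : Str) (t : ℕ) : Prop :=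
  (M.configAt φ a t).state = M.halt

/-- The number of steps on input `a` with oracle `φ` (infinite if the machine does not halt). -/
def time (M : OracleMachine) (φ : Baire) (a : Str) : ℕ∞ :=
  ⨅ (t : ℕ) (_ : M.HaltedAt φ a t), (t : ℕ∞)

open Classical in
/-- The partial operator on Baire space computed by the machine. Its domain consists of the oracles
with which the machine halts on every input. -/
def operator (M : OracleMachine) : Baire →. Baire := fun φ =>
  { Dom := ∀ a, ∃ t, M.HaltedAt φ a t
    get := fun h a => strOfTape ((M.configAt φ a (Nat.find (h a))).cells .output) }

end OracleMachine

/-! ### Preparametrised spaces and polytime computability -/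

/-- A preparametrised space: a set `X` with a representation (a surjective partial function on
Baire space) and a parameter that assigns a non-decreasing function to each name. -/
structure PreparametrisedSpace (X : Type) where
  /-- the representation -/
  rep : Baire →. X
  rep_surjective : ∀ x, ∃ φ, x ∈ rep φ
  /-- the parameter, defined on the domain of the representation -/
  param : (φ : Baire) → (rep φ).Dom → ℕ → ℕ
  param_monotone : ∀ φ h, Monotone (param φ h)

variable {X Y : Type}

/-- The machine `M` computes a realiser of `f`: it maps names of `x` to names of `f x`. -/
def OracleMachine.Realises (M : OracleMachine) (𝕏 : PreparametrisedSpace X)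
    (𝕐 : PreparametrisedSpace Y) (f : X → Y) : Prop :=
  ∀ φ, ∀ x ∈ 𝕏.rep φ, ∃ ψ ∈ M.operator φ, f x ∈ 𝕐.rep ψ

/-- Computability in polynomial time: some machine computes a realiser of `f`, with running time
bounded by a second-order polynomial `P` in the parameter of the oracle and the length of the input,
and with parameter blowup bounded by a second-order polynomial `Q`. -/
def PolytimeComputable (𝕏 : PreparametrisedSpace X) (𝕐 : PreparametrisedSpace Y)
    (f : X → Y) : Prop :=
  ∃ (M : OracleMachine) (P Q : (ℕ → ℕ) → ℕ → ℕ),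
    M.Realises 𝕏 𝕐 f ∧ IsSecondOrderPoly P ∧ IsSecondOrderPoly Q ∧
    (∀ (φ : Baire) (h : (𝕏.rep φ).Dom) (a : Str),
      M.time φ a ≤ (P (𝕏.param φ h) a.length : ℕ∞)) ∧
    (∀ (φ : Baire) (h : (𝕏.rep φ).Dom), ∀ ψ ∈ M.operator φ, ∀ (h' : (𝕐.rep ψ).Dom) (n : ℕ),
      𝕐.param ψ h' n ≤ Q (𝕏.param φ h) n)

/-- The pairing of string functions. -/
def pairFun (φ ψ : Baire) : Baire
  | .zero :: b => φ b
  | .one :: b => ψ b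
  | _ => []

/-- The first component of a pair of string functions. -/
def leftFun (φ : Baire) : Baire := fun b => φ (.zero :: b)

/-- The second component of a pair of string functions. -/
def rightFun (φ : Baire) : Baire := fun b => φ (.one :: b)

/-- The product of two preparametrised spaces: a name of a pair is a pair of names, and the
parameter is the pointwise maximum. -/
def PreparametrisedSpace.prod (𝕏 : PreparametrisedSpace X) (𝕐 : PreparametrisedSpace Y) :
    PreparametrisedSpace (X × Y) where
  rep := fun φ =>
    { Dom := φ = pairFun (leftFun φ) (rightFun φ) ∧
        (𝕏.rep (leftFun φ)).Dom ∧ (𝕐.rep (rightFun φ)).Dom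
      get := fun h => ((𝕏.rep (leftFun φ)).get h.2.1, (𝕐.rep (rightFun φ)).get h.2.2) }
  rep_surjective := by
    rintro ⟨x, y⟩
    obtain ⟨φ, h, hx⟩ := 𝕏.rep_surjective x
    obtain ⟨ψ, k, hy⟩ := 𝕐.rep_surjective y
    exact ⟨pairFun φ ψ, ⟨rfl, h, k⟩, Prod.ext hx hy⟩
  param := fun φ h n => max (𝕏.param (leftFun φ) h.2.1 n) (𝕐.param (rightFun φ) h.2.2 n)
  param_monotone := fun _ _ _ _ hmn =>
    max_le_max (𝕏.param_monotone _ _ hmn) (𝕐.param_monotone _ _ hmn)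

theorem PreparametrisedSpace.mem_prod_rep (𝕏 : PreparametrisedSpace X)
    (𝕐 : PreparametrisedSpace Y) (φ : Baire) (x : X) (y : Y) :
    (x, y) ∈ (𝕏.prod 𝕐).rep φ ↔
      ∃ ψ χ, φ = pairFun ψ χ ∧ x ∈ 𝕏.rep ψ ∧ y ∈ 𝕐.rep χ := by
  constructor
  · rintro ⟨h, hxy⟩
    exact ⟨_, _, h.1, ⟨h.2.1, congrArg Prod.fst hxy⟩, ⟨h.2.2, congrArg Prod.snd hxy⟩⟩
  · rintro ⟨ψ, χ, rfl, ⟨h, hx⟩, ⟨k, hy⟩⟩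
    exact ⟨⟨rfl, h, k⟩, Prod.ext hx hy⟩

open Classical in
/-- A subspace, given by an injection `i : Y → X`: the range restriction of the representation and
the restriction of the parameter. -/
def PreparametrisedSpace.subspace (𝕏 : PreparametrisedSpace X) (i : Y → X)
    (hi : Function.Injective i) : PreparametrisedSpace Y where
  rep := fun φ =>
    { Dom := ∃ h : (𝕏.rep φ).Dom, ∃ y, i y = (𝕏.rep φ).get h
      get := fun h => h.choose_spec.choose }
  rep_surjective := by
    intro y
    obtain ⟨φ, h, hy⟩ := 𝕏.rep_surjective (i y)
    have hd : ∃ h : (𝕏.rep φ).Dom, ∃ y, i y = (𝕏.rep φ).get h := ⟨h, y, hy.symm⟩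
    exact ⟨φ, hd, hi (hd.choose_spec.choose_spec.trans hy)⟩
  param := fun φ h => 𝕏.param φ h.choose
  param_monotone := fun _ _ => 𝕏.param_monotone _ _

theorem PreparametrisedSpace.mem_subspace_rep (𝕏 : PreparametrisedSpace X) (i : Y → X)
    (hi : Function.Injective i) (φ : Baire) (y : Y) :
    y ∈ (𝕏.subspace i hi).rep φ ↔ i y ∈ 𝕏.rep φ := by
  constructor
  · rintro ⟨h, rfl⟩
    exact ⟨h.choose, h.choose_spec.choose_spec.symm⟩
  · rintro ⟨h, hy⟩
    have hd : ∃ h : (𝕏.rep φ).Dom, ∃ y, i y = (𝕏.rep φ).get h := ⟨h, y, hy.symm⟩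
    exact ⟨hd, hi (hd.choose_spec.choose_spec.trans hy)⟩

/-! ### Dyadic intervals and their codes -/

/-- Dyadic rational numbers. -/
def IsDyadic (q : ℚ) : Prop := ∃ (r : ℤ) (n : ℕ), q = r / 2 ^ n

/-- Dyadic intervals: the finite intervals `[r - ε, r + ε]` with dyadic `r` and dyadic `ε > 0`, and
the infinite interval. -/
inductive DyadicInterval
  | finite (r ε : ℚ) (hr : IsDyadic r) (hε : IsDyadic ε) (pos : 0 < ε)
  | whole

/-- The set of real numbers in a dyadic interval. -/
def DyadicInterval.toSet : DyadicInterval → Set ℝ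
  | .finite r ε _ _ _ => Set.Icc ((r - ε : ℚ) : ℝ) ((r + ε : ℚ) : ℝ)
  | .whole => Set.univ

/-- The length of a dyadic interval. -/
def DyadicInterval.diam : DyadicInterval → WithTop ℚ
  | .finite _ ε _ _ _ => ((2 * ε : ℚ) : WithTop ℚ)
  | .whole => ⊤

/-- The string consists of binary digits. -/
def IsBits (s : Str) : Prop := Letter.point ∉ s

/-- The value of a binary digit. -/
def Letter.bit : Letter → ℕ
  | .one => 1
  | _ => 0

/-- The number with binary expansion `s`, most significant digit first. -/
def bitsVal (s : Str) : ℕ := s.foldl (fun v x => 2 * v + x.bit) 0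

/-- The sign of a code of an integer: negative if the first digit is `1`. -/
def codeSign : Str → ℤ
  | .one :: _ => -1
  | _ => 1

/-- Codes of integers: a sign digit followed by the binary expansion of the absolute value, which
starts in the digit `1`; strings of less than two digits are codes of zero. -/
def IsIntCode (s : Str) : Prop :=
  IsBits s ∧ (s.length ≤ 1 ∨ ∃ σ t, s = σ :: Letter.one :: t)

/-- `s` is a code of the dyadic number `q`: a finite binary expansion of `q` that consists of a code
of an integer, the separator symbol and the digits after the binary point. -/
def CodesDyadic (s : Str) (q : ℚ) : Prop :=
  ∃ i f, s = i ++ Letter.point :: f ∧ IsIntCode i ∧ IsBits f ∧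
    q = codeSign i * (bitsVal i.tail + bitsVal f / 2 ^ f.length)

/-- The control string of a pair: as many `1`s as the shorter of the strings is long, then a `0`,
then a digit that indicates which of the strings is longer. -/
def pairCtrl (a b : Str) : Str :=
  List.replicate (min a.length b.length) Letter.one ++
    [Letter.zero, if a.length ≤ b.length then Letter.zero else Letter.one]

/-- The pairing of strings: the control string, `a` and `b` are padded by `0`s to the same length,
and the digits of these three strings alternate. -/
def pairStr (a b : Str) : Str :=
  (List.range (max (max a.length b.length) (pairCtrl a b).length)).flatMap fun i =>
    [(pairCtrl a b).getD i Letter.zero, a.getD i Letter.zero, b.getD i Letter.zero]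

/-- `s` is a code of the dyadic interval `J`: the pair of codes of the midpoint and the radius; the
infinite interval is coded by the separator symbol. -/
def CodesInterval (s : Str) : DyadicInterval → Prop
  | .finite r ε _ _ _ => ∃ a b, s = pairStr a b ∧ CodesDyadic a r ∧ CodesDyadic b ε
  | .whole => s = [Letter.point]

/-! ### The interval function representation -/

/-- The sequence `φ` of dyadic intervals is a name of the real number `x` in the interval
representation: it is nested with intersection `{x}`. -/
def IsRealName (φ : ℕ → DyadicInterval) (x : ℝ) : Prop :=
  (∀ n, (φ (n + 1)).toSet ⊆ (φ n).toSet) ∧ ⋂ n, (φ n).toSet = {x}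

/-- The interval function `Ψ` computes `f` on names of real numbers in the unit interval. -/
def IsIntervalExtension (Ψ : DyadicInterval → DyadicInterval) (f : C(unitInterval, ℝ)) : Prop :=
  ∀ (φ : ℕ → DyadicInterval) (x : unitInterval), IsRealName φ x → IsRealName (Ψ ∘ φ) (f x)

/-- The string function `ψ` is the interval function `Ψ` in terms of codes. -/
def CodesIntervalFun (ψ : Baire) (Ψ : DyadicInterval → DyadicInterval) : Prop :=
  ∀ J s, CodesInterval s J → CodesInterval (ψ s) (Ψ J)

/-- `ψ` is a name of the continuous function `f` in the interval function representation. -/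
def IsFunName (ψ : Baire) (f : C(unitInterval, ℝ)) : Prop :=
  ∃ Ψ, CodesIntervalFun ψ Ψ ∧ IsIntervalExtension Ψ f

/-- All `N` such that `ψ` maps each interval that meets `[0, 1]` and has length at most `2 ^ (-N)` to
an interval of length at most `2 ^ (-n)`. -/
def moduli (ψ : Baire) (n : ℕ) : Set ℕ :=
  {N | ∀ J s K, (J.toSet ∩ Set.Icc 0 1).Nonempty → CodesInterval s J → CodesInterval (ψ s) K →
    J.diam ≤ (((1 / 2) ^ N : ℚ) : WithTop ℚ) → K.diam ≤ (((1 / 2) ^ n : ℚ) : WithTop ℚ)}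

/-! ### Codes determine intervals, and every interval has a code -/

theorem foldl_bit_append (s t : Str) (v : ℕ) :
    (s ++ t).foldl (fun v x => 2 * v + x.bit) v
      = t.foldl (fun v x => 2 * v + x.bit) (s.foldl (fun v x => 2 * v + x.bit) v) :=
  List.foldl_append

theorem bitsVal_append_zeros (s : Str) (k : ℕ) :
    bitsVal (s ++ List.replicate k Letter.zero) = bitsVal s * 2 ^ k := by
  induction k with
  | zero => simp
  | succ k ih =>
    rw [List.replicate_succ', ← List.append_assoc, bitsVal, foldl_bit_append, ← bitsVal, ih]
    simp [Letter.bit]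
    ring

theorem split_point {i j f g : Str} (hi : IsBits i) (hj : IsBits j)
    (h : i ++ Letter.point :: f = j ++ Letter.point :: g) : i = j ∧ f = g := by
  induction i generalizing j with
  | nil =>
    cases j with
    | nil => simpa using h
    | cons y j =>
      simp only [List.nil_append, List.cons_append, List.cons.injEq] at h
      exact absurd (by simp [← h.1]) hj
  | cons x i ih =>
    cases j with
    | nil =>
      simp only [List.nil_append, List.cons_append, List.cons.injEq] at h
      exact absurd (by simp [h.1]) hi
    | cons y j =>
      simp only [List.cons_append, List.cons.injEq] at h
      obtain ⟨rfl, rfl⟩ := ih (j := j) (fun hh => hi (List.mem_cons_of_mem _ hh))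
        (fun hh => hj (List.mem_cons_of_mem _ hh)) h.2
      simp [h.1]

theorem codesDyadic_unique_aux {a b : Str} {q r : ℚ} (hab : a.length ≤ b.length)
    (h : ∀ n, a.getD n Letter.zero = b.getD n Letter.zero)
    (ha : CodesDyadic a q) (hb : CodesDyadic b r) : q = r := by
  have hpad : b = a ++ List.replicate (b.length - a.length) Letter.zero := by
    apply List.ext_getElem
    · simp; omega
    · intro n h1 h2
      have := h n
      rw [List.getD_eq_getElem _ _ h1] at this
      rw [← this, List.getElem_append]
      split
      · rw [List.getD_eq_getElem]
      · rw [List.getD_eq_default _ _ (by omega)]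
        simp
  set k := b.length - a.length
  obtain ⟨i, f, rfl, hi, hf, rfl⟩ := ha
  obtain ⟨j, g, hb, hj, hg, rfl⟩ := hb
  rw [hpad] at hb
  obtain ⟨rfl, rfl⟩ := split_point (f := f ++ List.replicate k Letter.zero) hi.1 hj.1
    (by simpa using hb)
  rw [bitsVal_append_zeros]
  congr 2
  simp only [List.length_append, List.length_replicate, pow_add]
  push_cast
  field_simp

theorem codesDyadic_unique {a b : Str} {q r : ℚ}
    (h : ∀ n, a.getD n Letter.zero = b.getD n Letter.zero)
    (ha : CodesDyadic a q) (hb : CodesDyadic b r) : q = r := by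
  rcases le_total a.length b.length with hab | hab
  · exact codesDyadic_unique_aux hab h ha hb
  · exact (codesDyadic_unique_aux hab (fun n => (h n).symm) hb ha).symm

theorem flatMap_three_getD (u v w : ℕ → Letter) (L n : ℕ) (hn : n < L) :
    ((List.range L).flatMap fun i => [u i, v i, w i]).getD (3 * n + 1) Letter.zero = v n ∧
    ((List.range L).flatMap fun i => [u i, v i, w i]).getD (3 * n + 2) Letter.zero = w n := by
  have hlen : ∀ L, ((List.range L).flatMap fun i => [u i, v i, w i]).length = 3 * L := by
    intro L
    simp [mul_comm]
  induction L with
  | zero => omega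
  | succ L ih =>
    rw [List.range_succ, List.flatMap_append]
    rcases Nat.lt_succ_iff_lt_or_eq.1 hn with hn | rfl
    · rw [List.getD_append _ _ _ _ (by rw [hlen]; omega),
        List.getD_append _ _ _ _ (by rw [hlen]; omega)]
      exact ih hn
    · rw [List.getD_append_right _ _ _ _ (by rw [hlen]; omega),
        List.getD_append_right _ _ _ _ (by rw [hlen]; omega), hlen]
      simp

theorem pairStr_length (a b : Str) :
    (pairStr a b).length = 3 * max (max a.length b.length) (pairCtrl a b).length := by
  simp [pairStr, mul_comm]

theorem pairStr_getD (a b : Str) (n : ℕ) :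
    a.getD n Letter.zero = (pairStr a b).getD (3 * n + 1) Letter.zero ∧
    b.getD n Letter.zero = (pairStr a b).getD (3 * n + 2) Letter.zero := by
  by_cases hn : n < max (max a.length b.length) (pairCtrl a b).length
  · have := flatMap_three_getD (fun i => (pairCtrl a b).getD i Letter.zero)
      (fun i => a.getD i Letter.zero) (fun i => b.getD i Letter.zero) _ n hn
    exact ⟨this.1.symm, this.2.symm⟩
  · have := pairStr_length a b
    have h1 : max a.length b.length ≤ n := by omega
    have h2 : a.length ≤ n := by omega
    have h3 : b.length ≤ n := by omega
    rw [List.getD_eq_default _ _ h2, List.getD_eq_default _ _ h3,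
      List.getD_eq_default _ _ (by omega), List.getD_eq_default _ _ (by omega)]
    simp

theorem codesInterval_unique {s : Str} {J K : DyadicInterval} (hJ : CodesInterval s J)
    (hK : CodesInterval s K) : J = K := by
  have key : ∀ a b, pairStr a b ≠ [Letter.point] := by
    intro a b h
    have := congrArg List.length h
    rw [pairStr_length] at this
    simp at this
  cases J with
  | whole =>
    cases K with
    | whole => rfl
    | finite r ε hr hε pos =>
      obtain ⟨a, b, hab, -, -⟩ := hK
      exact absurd (hab.symm.trans hJ) (key a b)
  | finite r ε hr hε pos =>
    obtain ⟨a, b, rfl, har, hbε⟩ := hJ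
    cases K with
    | whole => exact absurd hK (key a b)
    | finite r' ε' hr' hε' pos' =>
      obtain ⟨a', b', hab, har', hbε'⟩ := hK
      have h1 := codesDyadic_unique (fun n => by
        rw [(pairStr_getD a b n).1, (pairStr_getD a' b' n).1, hab]) har har'
      have h2 := codesDyadic_unique (fun n => by
        rw [(pairStr_getD a b n).2, (pairStr_getD a' b' n).2, hab]) hbε hbε'
      subst h1 h2
      rfl

theorem isBits_append {s t : Str} (hs : IsBits s) (ht : IsBits t) : IsBits (s ++ t) := by
  unfold IsBits at *
  simp [hs, ht]

theorem exists_bits_len (n m : ℕ) (h : m < 2 ^ n) :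
    ∃ f, IsBits f ∧ f.length = n ∧ bitsVal f = m := by
  induction n generalizing m with
  | zero => exact ⟨[], by simp [IsBits], rfl, by simp [bitsVal]; omega⟩
  | succ n ih =>
    obtain ⟨f, hf, hl, hv⟩ := ih (m / 2) (by rw [pow_succ] at h; omega)
    rcases Nat.mod_two_eq_zero_or_one m with h0 | h1
    · refine ⟨f ++ [Letter.zero], isBits_append hf (by simp [IsBits]), by simp [hl], ?_⟩
      rw [bitsVal, foldl_bit_append, ← bitsVal, hv]
      simp [Letter.bit]; omega
    · refine ⟨f ++ [Letter.one], isBits_append hf (by simp [IsBits]), by simp [hl], ?_⟩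
      rw [bitsVal, foldl_bit_append, ← bitsVal, hv]
      simp [Letter.bit]; omega

theorem exists_bits_nat (m : ℕ) :
    ∃ f, IsBits f ∧ bitsVal f = m ∧ (f = [] ∨ ∃ t, f = Letter.one :: t) := by
  induction m using Nat.strong_induction_on with
  | _ m ih =>
    rcases Nat.eq_zero_or_pos m with rfl | hm
    · exact ⟨[], by simp [IsBits], rfl, Or.inl rfl⟩
    obtain ⟨f, hf, hv, hs⟩ := ih (m / 2) (by omega)
    by_cases hm1 : m = 1
    · subst hm1
      exact ⟨[Letter.one], by simp [IsBits], rfl, Or.inr ⟨[], rfl⟩⟩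
    have hs' : ∃ t, f = Letter.one :: t := by
      rcases hs with rfl | hs
      · simp [bitsVal] at hv; omega
      · exact hs
    obtain ⟨t, rfl⟩ := hs'
    rcases Nat.mod_two_eq_zero_or_one m with h0 | h1
    · refine ⟨Letter.one :: t ++ [Letter.zero], isBits_append hf (by simp [IsBits]), ?_,
        Or.inr ⟨t ++ [Letter.zero], rfl⟩⟩
      rw [bitsVal, foldl_bit_append, ← bitsVal, hv]
      simp [Letter.bit]; omega
    · refine ⟨Letter.one :: t ++ [Letter.one], isBits_append hf (by simp [IsBits]), ?_,
        Or.inr ⟨t ++ [Letter.one], rfl⟩⟩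
      rw [bitsVal, foldl_bit_append, ← bitsVal, hv]
      simp [Letter.bit]; omega

theorem exists_codesDyadic {q : ℚ} (hq : IsDyadic q) : ∃ s, CodesDyadic s q := by
  obtain ⟨r, n, rfl⟩ := hq
  obtain ⟨f, hf, hfl, hfv⟩ := exists_bits_len n (r.natAbs % 2 ^ n) (Nat.mod_lt _ (by positivity))
  obtain ⟨g, hg, hgv, hgs⟩ := exists_bits_nat (r.natAbs / 2 ^ n)
  have hval : ((r.natAbs / 2 ^ n : ℕ) : ℚ) + ((r.natAbs % 2 ^ n : ℕ) : ℚ) / 2 ^ n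
      = (r.natAbs : ℚ) / 2 ^ n := by
    have := Nat.div_add_mod r.natAbs (2 ^ n)
    have h2 : ((2 ^ n : ℕ) : ℚ) * ((r.natAbs / 2 ^ n : ℕ) : ℚ) + ((r.natAbs % 2 ^ n : ℕ) : ℚ)
        = (r.natAbs : ℚ) := by exact_mod_cast this
    rw [← h2]
    push_cast
    field_simp
  have hint : ∀ σ, σ ≠ Letter.point → IsIntCode (σ :: g) := by
    intro σ hσ
    refine ⟨?_, ?_⟩
    · unfold IsBits at *
      simp [hg, hσ.symm]
    · rcases hgs with rfl | ⟨t, rfl⟩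
      · left; simp
      · right; exact ⟨σ, t, rfl⟩
  rcases le_total 0 r with hr | hr
  · refine ⟨_, Letter.zero :: g, f, rfl, hint _ (by simp), hf, ?_⟩
    rw [List.tail_cons, hgv, hfv, hfl, hval]
    have : ((r.natAbs : ℤ) : ℚ) = (r : ℚ) := by rw [Int.natAbs_of_nonneg hr]
    have h3 : (r : ℚ) = (r.natAbs : ℚ) := by rw [← Int.cast_natCast, this]
    simp only [codeSign]
    rw [h3]
    push_cast
    ring
  · refine ⟨_, Letter.one :: g, f, rfl, hint _ (by simp), hf, ?_⟩
    rw [List.tail_cons, hgv, hfv, hfl, hval]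
    have : ((r.natAbs : ℤ) : ℚ) = -(r : ℚ) := by rw [Int.ofNat_natAbs_of_nonpos hr]; simp
    have h3 : (r : ℚ) = -(r.natAbs : ℚ) := by rw [← Int.cast_natCast, this]; ring
    simp only [codeSign]
    rw [h3]
    push_cast
    ring

theorem exists_codesInterval (J : DyadicInterval) : ∃ s, CodesInterval s J := by
  cases J with
  | whole => exact ⟨_, rfl⟩
  | finite r ε hr hε pos =>
    obtain ⟨a, ha⟩ := exists_codesDyadic hr
    obtain ⟨b, hb⟩ := exists_codesDyadic hε
    exact ⟨_, a, b, rfl, ha, hb⟩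

theorem exists_codesIntervalFun (Ψ : DyadicInterval → DyadicInterval) :
    ∃ ψ, CodesIntervalFun ψ Ψ := by
  classical
  refine ⟨fun s => if h : ∃ J, CodesInterval s J then
    (exists_codesInterval (Ψ h.choose)).choose else [], fun J s hs => ?_⟩
  have h : ∃ J, CodesInterval s J := ⟨J, hs⟩
  have hJ : h.choose = J := codesInterval_unique h.choose_spec hs
  simp only [dif_pos h]
  rw [← hJ]
  exact (exists_codesInterval (Ψ h.choose)).choose_spec

theorem codesIntervalFun_unique {ψ : Baire} {Ψ Φ : DyadicInterval → DyadicInterval}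
    (h : CodesIntervalFun ψ Ψ) (h' : CodesIntervalFun ψ Φ) : Ψ = Φ := by
  funext J
  obtain ⟨s, hs⟩ := exists_codesInterval J
  exact codesInterval_unique (h J s hs) (h' J s hs)

/-! ### Interval functions determine the represented function and have moduli -/

theorem isDyadic_div (r : ℤ) (n : ℕ) : IsDyadic (r / 2 ^ n) := ⟨r, n, rfl⟩

theorem IsDyadic.add {p q : ℚ} (hp : IsDyadic p) (hq : IsDyadic q) : IsDyadic (p + q) := by
  obtain ⟨r, n, rfl⟩ := hp
  obtain ⟨s, m, rfl⟩ := hq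
  refine ⟨r * 2 ^ m + s * 2 ^ n, n + m, ?_⟩
  push_cast
  rw [pow_add]
  field_simp

theorem IsDyadic.neg {p : ℚ} (hp : IsDyadic p) : IsDyadic (-p) := by
  obtain ⟨r, n, rfl⟩ := hp
  exact ⟨-r, n, by push_cast; ring⟩

theorem IsDyadic.half {p : ℚ} (hp : IsDyadic p) : IsDyadic (p / 2) := by
  obtain ⟨r, n, rfl⟩ := hp
  exact ⟨r, n + 1, by rw [pow_succ, div_div]⟩

theorem IsDyadic.sub {p q : ℚ} (hp : IsDyadic p) (hq : IsDyadic q) : IsDyadic (p - q) := by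
  rw [sub_eq_add_neg]
  exact hp.add hq.neg

/-- The dyadic interval with endpoints `l < u`. -/
def DyadicInterval.ofEnds (l u : ℚ) (hl : IsDyadic l) (hu : IsDyadic u) (h : l < u) :
    DyadicInterval :=
  .finite ((l + u) / 2) ((u - l) / 2) (hl.add hu).half (hu.sub hl).half (by linarith)

theorem DyadicInterval.toSet_ofEnds (l u : ℚ) (hl : IsDyadic l) (hu : IsDyadic u) (h : l < u) :
    (DyadicInterval.ofEnds l u hl hu h).toSet = Set.Icc (l : ℝ) (u : ℝ) := by
  simp only [DyadicInterval.ofEnds, DyadicInterval.toSet]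
  congr 2 <;> ring

theorem diam_mono {J K : DyadicInterval} (h : J.toSet ⊆ K.toSet) : J.diam ≤ K.diam := by
  cases K with
  | whole => exact le_top
  | finite s δ hs hδ posδ =>
    cases J with
    | whole =>
      exfalso
      have := (h (Set.mem_univ (((s + δ : ℚ) : ℝ) + 1))).2
      linarith
    | finite r ε hr hε posε =>
      have hle : ((r - ε : ℚ) : ℝ) ≤ ((r + ε : ℚ) : ℝ) := by
        exact_mod_cast (by linarith : r - ε ≤ r + ε)
      have h1 := (h (Set.left_mem_Icc.2 hle)).1
      have h2 := (h (Set.right_mem_Icc.2 hle)).2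
      have h1' : s - δ ≤ r - ε := by exact_mod_cast h1
      have h2' : r + ε ≤ s + δ := by exact_mod_cast h2
      exact WithTop.coe_le_coe.2 (by linarith)

/-- The standard name of a real number. -/
def stdName (x : ℝ) (n : ℕ) : DyadicInterval :=
  .ofEnds ((⌊2 ^ n * x⌋ - 1 : ℤ) / 2 ^ n) ((⌊2 ^ n * x⌋ + 2 : ℤ) / 2 ^ n)
    (isDyadic_div _ n) (isDyadic_div _ n)
    (by
      apply div_lt_div_of_pos_right _ (by positivity)
      push_cast
      linarith)

theorem toSet_stdName (x : ℝ) (n : ℕ) : (stdName x n).toSet =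
    Set.Icc ((⌊2 ^ n * x⌋ - 1 : ℝ) / 2 ^ n) ((⌊2 ^ n * x⌋ + 2 : ℝ) / 2 ^ n) := by
  rw [stdName, DyadicInterval.toSet_ofEnds]
  push_cast
  rfl

theorem floor_scale (x : ℝ) (n : ℕ) :
    2 * (⌊2 ^ n * x⌋ : ℝ) ≤ ⌊2 ^ (n + 1) * x⌋ ∧
    (⌊2 ^ (n + 1) * x⌋ : ℝ) ≤ 2 * (⌊2 ^ n * x⌋ : ℝ) + 1 := by
  have h1 := Int.floor_le (2 ^ n * x)
  have h2 := Int.lt_floor_add_one (2 ^ n * x)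
  constructor
  · have : 2 * ⌊2 ^ n * x⌋ ≤ ⌊2 ^ (n + 1) * x⌋ := by
      rw [Int.le_floor]
      push_cast
      rw [pow_succ]
      linarith
    exact_mod_cast this
  · have : ⌊2 ^ (n + 1) * x⌋ < 2 * ⌊2 ^ n * x⌋ + 2 := by
      rw [Int.floor_lt]
      push_cast
      rw [pow_succ]
      linarith
    exact_mod_cast (by omega : ⌊2 ^ (n + 1) * x⌋ ≤ 2 * ⌊2 ^ n * x⌋ + 1)

theorem stdName_bounds (x : ℝ) (n : ℕ) :
    x - 2 / 2 ^ n ≤ (⌊2 ^ n * x⌋ - 1 : ℝ) / 2 ^ n ∧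
    (⌊2 ^ n * x⌋ - 1 : ℝ) / 2 ^ n + 1 / 2 ^ n ≤ x ∧
    x + 1 / 2 ^ n ≤ (⌊2 ^ n * x⌋ + 2 : ℝ) / 2 ^ n ∧
    (⌊2 ^ n * x⌋ + 2 : ℝ) / 2 ^ n ≤ x + 2 / 2 ^ n := by
  have h1 := Int.floor_le (2 ^ n * x)
  have h2 := Int.lt_floor_add_one (2 ^ n * x)
  have hp : (0 : ℝ) < 2 ^ n := by positivity
  refine ⟨?_, ?_, ?_, ?_⟩
  · rw [le_div_iff₀ hp, sub_mul, div_mul_cancel₀ _ hp.ne']; linarith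
  · rw [← add_div, div_le_iff₀ hp]; linarith
  · rw [le_div_iff₀ hp, add_mul, div_mul_cancel₀ _ hp.ne']; linarith
  · rw [div_le_iff₀ hp, add_mul, div_mul_cancel₀ _ hp.ne']; linarith

theorem stdName_nested (x : ℝ) (n : ℕ) :
    (⌊2 ^ n * x⌋ - 1 : ℝ) / 2 ^ n ≤ (⌊2 ^ (n + 1) * x⌋ - 1 : ℝ) / 2 ^ (n + 1) ∧
    (⌊2 ^ (n + 1) * x⌋ + 2 : ℝ) / 2 ^ (n + 1) ≤ (⌊2 ^ n * x⌋ + 2 : ℝ) / 2 ^ n := by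
  have h := floor_scale x n
  have hp : (0 : ℝ) < 2 ^ n := by positivity
  generalize (⌊2 ^ (n + 1) * x⌋ : ℝ) = A at *
  generalize (⌊2 ^ n * x⌋ : ℝ) = B at *
  constructor
  · rw [div_le_div_iff₀ hp (by positivity), pow_succ]
    nlinarith
  · rw [div_le_div_iff₀ (by positivity) hp, pow_succ]
    nlinarith

theorem two_div_pow_tendsto :
    Filter.Tendsto (fun n : ℕ => (2 : ℝ) / 2 ^ n) Filter.atTop (nhds 0) := by
  have := (tendsto_pow_atTop_nhds_zero_of_lt_one (r := (1 / 2 : ℝ)) (by norm_num)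
    (by norm_num)).const_mul 2
  simpa [div_eq_mul_inv] using this

theorem eq_of_two_div_pow {x y : ℝ} (h : ∀ n : ℕ, |y - x| ≤ 2 / 2 ^ n) : y = x := by
  have := ge_of_tendsto' two_div_pow_tendsto h
  exact sub_eq_zero.1 (abs_eq_zero.1 (le_antisymm this (abs_nonneg _)))

theorem isRealName_of_subset {φ : ℕ → DyadicInterval} {x : ℝ}
    (hn : ∀ n, (φ (n + 1)).toSet ⊆ (φ n).toSet) (hx : ∀ n, x ∈ (φ n).toSet)
    (hs : ∀ n, ∃ m, (φ m).toSet ⊆ (stdName x n).toSet) : IsRealName φ x := by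
  refine ⟨hn, Set.Subset.antisymm ?_ ?_⟩
  · intro y hy
    refine eq_of_two_div_pow fun n => ?_
    obtain ⟨m, hm⟩ := hs n
    have h1 := hm (Set.mem_iInter.1 hy m)
    rw [toSet_stdName] at h1
    have h2 := stdName_bounds x n
    rw [abs_le]
    constructor <;> linarith [h1.1, h1.2, h2.1, h2.2.2.2]
  · rintro _ rfl
    exact Set.mem_iInter.2 hx

theorem mem_stdName (x : ℝ) (n : ℕ) : x ∈ (stdName x n).toSet := by
  rw [toSet_stdName]
  have h2 := stdName_bounds x n
  have : (0 : ℝ) < 1 / 2 ^ n := by positivity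
  constructor <;> linarith [h2.2.1, h2.2.2.1]

theorem stdName_isRealName (x : ℝ) : IsRealName (stdName x) x := by
  refine isRealName_of_subset (fun n => ?_) (mem_stdName x) (fun n => ⟨n, subset_rfl⟩)
  rw [toSet_stdName, toSet_stdName]
  exact Set.Icc_subset_Icc (stdName_nested x n).1 (stdName_nested x n).2

/-- A dyadic interval together with a point in it can be shrunk to this point. -/
theorem exists_name_within (K : DyadicInterval) {x : ℝ} (hx : x ∈ K.toSet) :
    ∃ φ, IsRealName φ x ∧ ∀ n, (φ n).toSet ⊆ K.toSet := by
  cases K with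
  | whole => exact ⟨stdName x, stdName_isRealName x, fun n => Set.subset_univ _⟩
  | finite r ε hr hε pos =>
    have key : ∀ n, ∃ J : DyadicInterval, J.toSet
        = (DyadicInterval.finite r ε hr hε pos).toSet ∩ (stdName x n).toSet := by
      intro n
      have hb := stdName_bounds x n
      have hpos : (0 : ℝ) < 1 / 2 ^ n := by positivity
      set l : ℚ := (⌊2 ^ n * x⌋ - 1 : ℤ) / 2 ^ n with hl
      set u : ℚ := (⌊2 ^ n * x⌋ + 2 : ℤ) / 2 ^ n with hu
      have hlR : (l : ℝ) = (⌊2 ^ n * x⌋ - 1 : ℝ) / 2 ^ n := by rw [hl]; push_cast; rfl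
      have huR : (u : ℝ) = (⌊2 ^ n * x⌋ + 2 : ℝ) / 2 ^ n := by rw [hu]; push_cast; rfl
      have hdl : IsDyadic (max (r - ε) l) := by
        rcases max_choice (r - ε) l with h | h <;> rw [h]
        · exact hr.sub hε
        · exact ⟨_, _, hl⟩
      have hdu : IsDyadic (min (r + ε) u) := by
        rcases min_choice (r + ε) u with h | h <;> rw [h]
        · exact hr.add hε
        · exact ⟨_, _, hu⟩
      have hlt : max (r - ε) l < min (r + ε) u := by
        have h1 : l < u := by
          have : (l : ℝ) < u := by rw [hlR, huR]; linarith
          exact_mod_cast this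
        have h2 : r - ε < u := by
          have : ((r - ε : ℚ) : ℝ) < u := by rw [huR]; linarith [hx.1]
          exact_mod_cast this
        have h3 : l < r + ε := by
          have : (l : ℝ) < ((r + ε : ℚ) : ℝ) := by rw [hlR]; linarith [hx.2]
          exact_mod_cast this
        exact max_lt (lt_min (by linarith) h2) (lt_min h3 h1)
      refine ⟨.ofEnds _ _ hdl hdu hlt, ?_⟩
      rw [DyadicInterval.toSet_ofEnds, toSet_stdName, ← hlR, ← huR, DyadicInterval.toSet,
        Set.Icc_inter_Icc]
      push_cast
      rfl
    choose φ hφ using key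
    refine ⟨φ, isRealName_of_subset (fun n => ?_) (fun n => ?_) (fun n => ⟨n, ?_⟩), fun n => ?_⟩
    · rw [hφ, hφ]
      exact Set.inter_subset_inter_right _ ((stdName_isRealName x).1 n)
    · rw [hφ]
      exact ⟨hx, mem_stdName x n⟩
    · rw [hφ]
      exact Set.inter_subset_right
    · rw [hφ]
      exact Set.inter_subset_left

/-- An interval extension of a continuous function is monotone on intervals that meet `[0, 1]`. -/
theorem IsIntervalExtension.mono {Ψ : DyadicInterval → DyadicInterval} {f : C(unitInterval, ℝ)}
    (h : IsIntervalExtension Ψ f) {J K : DyadicInterval} (hKJ : K.toSet ⊆ J.toSet)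
    (hK : (K.toSet ∩ Set.Icc 0 1).Nonempty) : (Ψ K).toSet ⊆ (Ψ J).toSet := by
  obtain ⟨x, hxK, hx⟩ := hK
  obtain ⟨φ, hφ, hsub⟩ := exists_name_within K hxK
  let χ : ℕ → DyadicInterval
    | 0 => J
    | 1 => K
    | n + 2 => φ n
  have hχ : IsRealName χ x := by
    refine ⟨?_, ?_⟩
    · rintro (_ | _ | n)
      · exact hKJ
      · exact hsub 0
      · exact hφ.1 n
    · apply Set.Subset.antisymm
      · intro y hy
        rw [← hφ.2]
        exact Set.mem_iInter.2 fun n => Set.mem_iInter.1 hy (n + 2)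
      · intro y hy
        obtain rfl : y = x := hy
        have hall : ∀ n, y ∈ (φ n).toSet := by
          have : y ∈ ⋂ n, (φ n).toSet := by rw [hφ.2]; rfl
          exact Set.mem_iInter.1 this
        refine Set.mem_iInter.2 ?_
        rintro (_ | _ | n)
        · exact hKJ hxK
        · exact hxK
        · exact hall n
  exact (h χ ⟨x, hx⟩ hχ).1 0

theorem IsRealName.antitone {φ : ℕ → DyadicInterval} {x : ℝ} (h : IsRealName φ x) :
    Antitone fun n => (φ n).toSet := antitone_nat_of_succ_le h.1

/-- The intervals of a name of a real number become arbitrarily short. -/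
theorem IsRealName.exists_diam_le {φ : ℕ → DyadicInterval} {x : ℝ} (h : IsRealName φ x) (k : ℕ) :
    ∃ n, (φ n).diam ≤ (((1 / 2) ^ k : ℚ) : WithTop ℚ) := by
  by_contra hcon
  push Not at hcon
  set d : ℝ := (1 / 2) ^ k with hd
  have hdpos : 0 < d := by positivity
  have hx : ∀ n, x ∈ (φ n).toSet := by
    have : x ∈ ⋂ n, (φ n).toSet := by rw [h.2]; rfl
    exact Set.mem_iInter.1 this
  have key : ∀ n, x - d / 2 ∈ (φ n).toSet ∨ x + d / 2 ∈ (φ n).toSet := by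
    intro n
    have h1 := hcon n
    have h2 := hx n
    cases hφ : φ n with
    | whole => left; trivial
    | finite r ε hr hε pos =>
      rw [hφ] at h1 h2
      have h3 : (1 / 2) ^ k < 2 * ε := WithTop.coe_lt_coe.1 h1
      have h4 : d < 2 * (ε : ℝ) := by
        have := (Rat.cast_lt (K := ℝ)).2 h3
        push_cast at this
        exact this
      have h5 := h2.1
      have h6 := h2.2
      push_cast at h5 h6
      simp only [DyadicInterval.toSet, Set.mem_Icc]
      push_cast
      by_cases hc : (r : ℝ) ≤ x
      · left; constructor <;> linarith
      · right; push Not at hc; constructor <;> linarith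
  have hor : (∀ n, x - d / 2 ∈ (φ n).toSet) ∨ (∀ n, x + d / 2 ∈ (φ n).toSet) := by
    by_contra hc
    push Not at hc
    obtain ⟨⟨n, hn⟩, m, hm⟩ := hc
    rcases key (max n m) with h1 | h1
    · exact hn (h.antitone (le_max_left n m) h1)
    · exact hm (h.antitone (le_max_right n m) h1)
  rcases hor with h1 | h1
  · have : x - d / 2 ∈ ⋂ n, (φ n).toSet := Set.mem_iInter.2 h1
    rw [h.2] at this
    have := Set.mem_singleton_iff.1 this
    linarith
  · have : x + d / 2 ∈ ⋂ n, (φ n).toSet := Set.mem_iInter.2 h1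
    rw [h.2] at this
    have := Set.mem_singleton_iff.1 this
    linarith

theorem isFunName_unique {ψ : Baire} {f g : C(unitInterval, ℝ)} (hf : IsFunName ψ f)
    (hg : IsFunName ψ g) : f = g := by
  obtain ⟨Ψ, h1, h2⟩ := hf
  obtain ⟨Φ, h3, h4⟩ := hg
  obtain rfl := codesIntervalFun_unique h1 h3
  ext x
  have h5 := h2 _ x (stdName_isRealName x)
  have h6 := h4 _ x (stdName_isRealName x)
  have : ({f x} : Set ℝ) = {g x} := h5.2.symm.trans h6.2
  simpa using this

/-- Every name of a continuous function has a modulus. -/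
theorem moduli_nonempty {ψ : Baire} {f : C(unitInterval, ℝ)} (h : IsFunName ψ f) (n : ℕ) :
    (moduli ψ n).Nonempty := by
  obtain ⟨Ψ, hψ, hΨ⟩ := h
  by_contra hempty
  rw [Set.not_nonempty_iff_eq_empty] at hempty
  have hbad : ∀ N : ℕ, ∃ J : DyadicInterval, (J.toSet ∩ Set.Icc 0 1).Nonempty ∧
      J.diam ≤ (((1 / 2) ^ N : ℚ) : WithTop ℚ) ∧
      ¬ (Ψ J).diam ≤ (((1 / 2) ^ n : ℚ) : WithTop ℚ) := by
    intro N
    have : N ∉ moduli ψ n := by rw [hempty]; simp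
    simp only [moduli, Set.mem_ofPred_eq, not_forall] at this
    obtain ⟨J, s, K, hJ, hs, hK, hd, hn⟩ := this
    obtain rfl := codesInterval_unique (hψ J s hs) hK
    exact ⟨J, hJ, hd, hn⟩
  choose J hJ hJd hJn using hbad
  choose y hyJ hyI using hJ
  obtain ⟨x, hx, σ, hσ, hlim⟩ := (isCompact_Icc (a := (0 : ℝ)) (b := 1)).tendsto_subseq hyI
  have hname := stdName_isRealName x
  obtain ⟨m, hm⟩ := (hΨ _ ⟨x, hx⟩ hname).exists_diam_le n
  have hpos : (0 : ℝ) < 1 / 2 ^ m / 2 := by positivity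
  have h1 : ∀ᶠ i in Filter.atTop, |y (σ i) - x| < 1 / 2 ^ m / 2 := by
    have := Metric.tendsto_nhds.1 hlim _ hpos
    simpa [Real.dist_eq] using this
  have h2 : ∀ᶠ i in Filter.atTop, ((1 / 2 : ℝ)) ^ (σ i) < 1 / 2 ^ m / 2 :=
    ((tendsto_pow_atTop_nhds_zero_of_lt_one (r := (1 / 2 : ℝ)) (by norm_num)
      (by norm_num)).comp hσ.tendsto_atTop).eventually (gt_mem_nhds hpos)
  obtain ⟨i, hi1, hi2⟩ := (h1.and h2).exists
  have hsub : (J (σ i)).toSet ⊆ (stdName x m).toSet := by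
    have hy := hyJ (σ i)
    have hd := hJd (σ i)
    cases hJi : J (σ i) with
    | whole => rw [hJi] at hd; exact absurd hd (by simp [DyadicInterval.diam])
    | finite r ε hr hε pos =>
      rw [hJi] at hd hy
      have hd' : 2 * ε ≤ (1 / 2) ^ (σ i) := WithTop.coe_le_coe.1 hd
      have hdR : 2 * (ε : ℝ) ≤ (1 / 2) ^ (σ i) := by
        have := (Rat.cast_le (K := ℝ)).2 hd'
        push_cast at this
        exact this
      have h5 := hy.1
      have h6 := hy.2
      rw [abs_lt] at hi1
      have hb := stdName_bounds x m
      rw [toSet_stdName]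
      intro z hz
      have h7 := hz.1
      have h8 := hz.2
      push_cast at h5 h6 h7 h8
      constructor <;> linarith [hb.2.1, hb.2.2.1, hi1.1, hi1.2]
  exact hJn (σ i) ((diam_mono (hΨ.mono hsub ⟨_, hyJ _, hyI _⟩)).trans hm)

/-! ### Every continuous function has a name -/

/-- The values of `f` on the points of the unit interval that lie in `J`. -/
def valuesOn (f : C(unitInterval, ℝ)) (J : DyadicInterval) : Set ℝ :=
  f '' {x | (x : ℝ) ∈ J.toSet}

theorem valuesOn_bdd (f : C(unitInterval, ℝ)) (J : DyadicInterval) :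
    BddBelow (valuesOn f J) ∧ BddAbove (valuesOn f J) := by
  have h := isCompact_range f.continuous
  exact ⟨h.bddBelow.mono (Set.image_subset_range _ _), h.bddAbove.mono (Set.image_subset_range _ _)⟩

theorem stdName_lower_mono {x y : ℝ} {m n : ℕ} (hxy : x ≤ y) (hmn : m ≤ n) :
    (⌊2 ^ m * x⌋ - 1 : ℝ) / 2 ^ m ≤ (⌊2 ^ n * y⌋ - 1 : ℝ) / 2 ^ n := by
  refine le_trans ?_ (monotone_nat_of_le_succ (f := fun n => (⌊2 ^ n * y⌋ - 1 : ℝ) / 2 ^ n)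
    (fun n => (stdName_nested y n).1) hmn)
  have : ⌊2 ^ m * x⌋ ≤ ⌊2 ^ m * y⌋ := Int.floor_le_floor (by gcongr)
  have h2 : (⌊2 ^ m * x⌋ : ℝ) ≤ ⌊2 ^ m * y⌋ := by exact_mod_cast this
  show (⌊2 ^ m * x⌋ - 1 : ℝ) / 2 ^ m ≤ (⌊2 ^ m * y⌋ - 1 : ℝ) / 2 ^ m
  gcongr

theorem stdName_upper_anti {x y : ℝ} {m n : ℕ} (hxy : y ≤ x) (hmn : m ≤ n) :
    (⌊2 ^ n * y⌋ + 2 : ℝ) / 2 ^ n ≤ (⌊2 ^ m * x⌋ + 2 : ℝ) / 2 ^ m := by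
  refine le_trans (antitone_nat_of_succ_le (f := fun n => (⌊2 ^ n * y⌋ + 2 : ℝ) / 2 ^ n)
    (fun n => (stdName_nested y n).2) hmn) ?_
  have : ⌊2 ^ m * y⌋ ≤ ⌊2 ^ m * x⌋ := Int.floor_le_floor (by gcongr)
  have h2 : (⌊2 ^ m * y⌋ : ℝ) ≤ ⌊2 ^ m * x⌋ := by exact_mod_cast this
  show (⌊2 ^ m * y⌋ + 2 : ℝ) / 2 ^ m ≤ (⌊2 ^ m * x⌋ + 2 : ℝ) / 2 ^ m
  gcongr

theorem exists_enclosure {a b : ℝ} (hab : a ≤ b) (n : ℕ) : ∃ J : DyadicInterval,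
    J.toSet = Set.Icc ((⌊2 ^ n * a⌋ - 1 : ℝ) / 2 ^ n) ((⌊2 ^ n * b⌋ + 2 : ℝ) / 2 ^ n) := by
  have hlt : (((⌊2 ^ n * a⌋ - 1 : ℤ) : ℚ) / 2 ^ n) < ((⌊2 ^ n * b⌋ + 2 : ℤ) : ℚ) / 2 ^ n := by
    have : ⌊2 ^ n * a⌋ ≤ ⌊2 ^ n * b⌋ := Int.floor_le_floor (by gcongr)
    apply div_lt_div_of_pos_right _ (by positivity)
    exact_mod_cast (by omega : ⌊2 ^ n * a⌋ - 1 < ⌊2 ^ n * b⌋ + 2)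
  refine ⟨.ofEnds _ _ (isDyadic_div _ n) (isDyadic_div _ n) hlt, ?_⟩
  rw [DyadicInterval.toSet_ofEnds]
  push_cast
  rfl

theorem exists_intervalExtension (f : C(unitInterval, ℝ)) :
    ∃ Ψ, IsIntervalExtension Ψ f := by
  have hex : ∀ J : DyadicInterval, ∃ K : DyadicInterval,
      match J with
      | .whole => K.toSet = Set.univ
      | .finite r ε hr hε pos =>
        K.toSet = Set.Icc
          ((⌊2 ^ ⌊1 / ε⌋₊ * sInf (valuesOn f (.finite r ε hr hε pos))⌋ - 1 : ℝ) / 2 ^ ⌊1 / ε⌋₊)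
          ((⌊2 ^ ⌊1 / ε⌋₊ * sSup (valuesOn f (.finite r ε hr hε pos))⌋ + 2 : ℝ)
            / 2 ^ ⌊1 / ε⌋₊) := by
    intro J
    cases J with
    | whole => exact ⟨.whole, rfl⟩
    | finite r ε hr hε pos =>
      have hb := valuesOn_bdd f (.finite r ε hr hε pos)
      exact exists_enclosure (Real.sInf_le_sSup _ hb.1 hb.2) _
  choose Ψ hΨ using hex
  have hF : ∀ r ε hr hε pos, (Ψ (.finite r ε hr hε pos)).toSet = Set.Icc
      ((⌊2 ^ ⌊1 / ε⌋₊ * sInf (valuesOn f (.finite r ε hr hε pos))⌋ - 1 : ℝ) / 2 ^ ⌊1 / ε⌋₊)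
      ((⌊2 ^ ⌊1 / ε⌋₊ * sSup (valuesOn f (.finite r ε hr hε pos))⌋ + 2 : ℝ) / 2 ^ ⌊1 / ε⌋₊) :=
    fun r ε hr hε pos => hΨ (.finite r ε hr hε pos)
  refine ⟨Ψ, fun φ x hφ => ?_⟩
  have hmem : ∀ n, (x : ℝ) ∈ (φ n).toSet := by
    have : (x : ℝ) ∈ ⋂ n, (φ n).toSet := by rw [hφ.2]; rfl
    exact Set.mem_iInter.1 this
  have hval : ∀ n, f x ∈ valuesOn f (φ n) := fun n => ⟨x, hmem n, rfl⟩
  refine ⟨fun n => ?_, Set.Subset.antisymm ?_ ?_⟩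
  · have hsub := hφ.1 n
    have hm := hval (n + 1)
    simp only [Function.comp_apply]
    cases h0 : φ n with
    | whole => rw [show (Ψ .whole).toSet = Set.univ from hΨ .whole]; exact Set.subset_univ _
    | finite r ε hr hε pos =>
      cases h1 : φ (n + 1) with
      | whole =>
        rw [h0, h1] at hsub
        exact absurd (diam_mono hsub) (not_le.2 (WithTop.coe_lt_top _))
      | finite r' ε' hr' hε' pos' =>
        rw [h0, h1] at hsub
        rw [h1] at hm
        have hε'ε : 2 * ε' ≤ 2 * ε := WithTop.coe_le_coe.1 (diam_mono hsub)
        have hk : ⌊1 / ε⌋₊ ≤ ⌊1 / ε'⌋₊ :=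
          Nat.floor_le_floor (one_div_le_one_div_of_le pos' (by linarith))
        have hvs : valuesOn f (.finite r' ε' hr' hε' pos')
            ⊆ valuesOn f (.finite r ε hr hε pos) := Set.image_mono fun z hz => hsub hz
        have hb := valuesOn_bdd f (.finite r ε hr hε pos)
        rw [hF, hF]
        exact Set.Icc_subset_Icc (stdName_lower_mono (csInf_le_csInf hb.1 ⟨_, hm⟩ hvs) hk)
          (stdName_upper_anti (csSup_le_csSup hb.2 ⟨_, hm⟩ hvs) hk)
  · intro y hy
    have hclose : ∀ δ > 0, |y - f x| ≤ 0 + 2 * δ := by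
      intro δ hδ
      obtain ⟨η, hη, hcont⟩ := Metric.continuous_iff.1 f.continuous x δ hδ
      have hev1 : ∀ᶠ j : ℕ in Filter.atTop, (2 : ℝ) / 2 ^ j < δ :=
        two_div_pow_tendsto.eventually (gt_mem_nhds hδ)
      have hev2 : ∀ᶠ j : ℕ in Filter.atTop, (2 : ℝ) / 2 ^ j < η :=
        two_div_pow_tendsto.eventually (gt_mem_nhds hη)
      obtain ⟨j, hj1, hj2⟩ := (hev1.and hev2).exists
      obtain ⟨n, hn⟩ := hφ.exists_diam_le j
      have hyn := Set.mem_iInter.1 hy n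
      have hm := hval n
      have hxn := hmem n
      simp only [Function.comp_apply] at hyn
      cases h0 : φ n with
      | whole => rw [h0] at hn; exact absurd hn (by simp [DyadicInterval.diam])
      | finite r ε hr hε pos =>
        rw [h0] at hn hyn hm hxn
        rw [hF] at hyn
        have hd : 2 * ε ≤ (1 / 2) ^ j := WithTop.coe_le_coe.1 hn
        have hdR : 2 * (ε : ℝ) ≤ (1 / 2) ^ j := by
          have := (Rat.cast_le (K := ℝ)).2 hd
          push_cast at this
          exact this
        have hk : j ≤ ⌊1 / ε⌋₊ := by
          apply Nat.le_floor
          rw [le_div_iff₀ pos]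
          have h1 : (j : ℚ) ≤ 2 ^ j := by exact_mod_cast (Nat.lt_two_pow_self (n := j)).le
          have h2 : (2 : ℚ) ^ j * (1 / 2) ^ j = 1 := by rw [← mul_pow]; norm_num
          have h3 : (j : ℚ) * ε ≤ 2 ^ j * (1 / 2) ^ j := by
            apply mul_le_mul h1 (by linarith) pos.le (by positivity)
          linarith
        have hpow : (2 : ℝ) / 2 ^ ⌊1 / ε⌋₊ ≤ 2 / 2 ^ j := by
          gcongr
          norm_num
        have hnear : ∀ v ∈ valuesOn f (.finite r ε hr hε pos), |v - f x| < δ := by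
          rintro _ ⟨z, hz, rfl⟩
          refine hcont z ?_
          rw [Subtype.dist_eq, Real.dist_eq, abs_lt]
          have h1 := hz.1
          have h2 := hz.2
          have h3 := hxn.1
          have h4 := hxn.2
          push_cast at h1 h2 h3 h4
          have h5 : (1 / 2 : ℝ) ^ j = 1 / 2 ^ j := by rw [one_div_pow]
          have h6 : (2 : ℝ) / 2 ^ j = 2 * (1 / 2 ^ j) := by ring
          have h7 : (0 : ℝ) < 1 / 2 ^ j := by positivity
          constructor <;> linarith
        have hlow : f x - δ ≤ sInf (valuesOn f (.finite r ε hr hε pos)) :=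
          le_csInf ⟨_, hm⟩ fun v hv => by linarith [(abs_lt.1 (hnear v hv)).1]
        have hupp : sSup (valuesOn f (.finite r ε hr hε pos)) ≤ f x + δ :=
          csSup_le ⟨_, hm⟩ fun v hv => by linarith [(abs_lt.1 (hnear v hv)).2]
        have hb1 := (stdName_bounds (sInf (valuesOn f (.finite r ε hr hε pos))) ⌊1 / ε⌋₊).1
        have hb2 := (stdName_bounds (sSup (valuesOn f (.finite r ε hr hε pos))) ⌊1 / ε⌋₊).2.2.2
        have h8 := hyn.1
        have h9 := hyn.2
        rw [abs_le]
        constructor <;> linarith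
    have h0 : |y - f x| ≤ 0 := by
      refine le_of_forall_pos_le_add fun δ hδ => ?_
      have := hclose (δ / 2) (by linarith)
      linarith
    exact sub_eq_zero.1 (abs_eq_zero.1 (le_antisymm h0 (abs_nonneg _)))
  · intro y hy
    obtain rfl : y = f x := hy
    refine Set.mem_iInter.2 fun n => ?_
    have hm := hval n
    simp only [Function.comp_apply]
    cases h0 : φ n with
    | whole => rw [show (Ψ .whole).toSet = Set.univ from hΨ .whole]; trivial
    | finite r ε hr hε pos =>
      rw [h0] at hm
      have hb := valuesOn_bdd f (.finite r ε hr hε pos)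
      rw [hF]
      have hb1 := stdName_bounds (sInf (valuesOn f (.finite r ε hr hε pos))) ⌊1 / ε⌋₊
      have hb2 := stdName_bounds (sSup (valuesOn f (.finite r ε hr hε pos))) ⌊1 / ε⌋₊
      have h1 := csInf_le hb.1 hm
      have h2 := le_csSup hb.2 hm
      have h7 : (0 : ℝ) < 1 / 2 ^ ⌊1 / ε⌋₊ := by positivity
      constructor <;> linarith [hb1.2.1, hb2.2.2.1]

theorem exists_funName (f : C(unitInterval, ℝ)) : ∃ ψ, IsFunName ψ f := by
  obtain ⟨Ψ, hΨ⟩ := exists_intervalExtension f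
  obtain ⟨ψ, hψ⟩ := exists_codesIntervalFun Ψ
  exact ⟨ψ, Ψ, hψ, hΨ⟩

theorem moduli_anti (ψ : Baire) {m n : ℕ} (hmn : m ≤ n) : moduli ψ n ⊆ moduli ψ m := by
  intro N hN J s K hJ hs hK hd
  refine (hN J s K hJ hs hK hd).trans (WithTop.coe_le_coe.2 ?_)
  exact pow_le_pow_of_le_one (by norm_num) (by norm_num) hmn

/-! ### The space of interval functions -/

open Classical in
/-- The parametrised space of interval functions: `C([0, 1])` with the interval function
representation and the parameter `n ↦ ⌈lb (‖f‖ + 1)⌉ + min (moduli ψ n)`. -/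
def intervalFunctions : PreparametrisedSpace C(unitInterval, ℝ) where
  rep := fun ψ =>
    { Dom := ∃ f, IsFunName ψ f
      get := fun h => h.choose }
  rep_surjective := by
    intro f
    obtain ⟨ψ, hψ⟩ := exists_funName f
    have h : ∃ f, IsFunName ψ f := ⟨f, hψ⟩
    exact ⟨ψ, h, isFunName_unique h.choose_spec hψ⟩
  param := fun ψ h n => ⌈Real.logb 2 (‖h.choose‖ + 1)⌉₊ + sInf (moduli ψ n)
  param_monotone := fun ψ h m n hmn =>
    Nat.add_le_add_left
      (Nat.sInf_le (moduli_anti ψ hmn (Nat.sInf_mem (moduli_nonempty h.choose_spec n)))) _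

theorem mem_intervalFunctions_rep (ψ : Baire) (f : C(unitInterval, ℝ)) :
    f ∈ intervalFunctions.rep ψ ↔ IsFunName ψ f := by
  constructor
  · rintro ⟨h, rfl⟩
    exact h.choose_spec
  · intro hψ
    have h : ∃ f, IsFunName ψ f := ⟨f, hψ⟩
    exact ⟨h, isFunName_unique h.choose_spec hψ⟩

/-- A continuous self-map of the unit interval as a real-valued function. -/
def toRealFun (g : C(unitInterval, unitInterval)) : C(unitInterval, ℝ) :=
  ⟨fun x => (g x : ℝ), continuous_subtype_val.comp g.continuous⟩

theorem toRealFun_injective : Function.Injective toRealFun := by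
  intro g h hgh
  ext x
  exact DFunLike.congr_fun hgh x

/-- The space `C([0, 1], [0, 1])` as a subspace of the space of interval functions. -/
def intervalSelfMaps : PreparametrisedSpace C(unitInterval, unitInterval) :=
  intervalFunctions.subspace toRealFun toRealFun_injective

end

end IntervalComplexity

open IntervalComplexity

namespace IntervalComplexity

noncomputable section

/-! ### Programs on tapes used as stacks -/

instance : DecidableEq (TapeName ℕ) := Classical.decEq _

/-- Structured programs for a multi-tape machine. Each tape is used as a stack whose top is the
scanned cell. -/
inductive Prog
  | skip
  | push (t : TapeName ℕ) (x : Letter)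
  | pop (t : TapeName ℕ)
  | left (t : TapeName ℕ)
  | ask
  | seq (p q : Prog)
  | cond (t : TapeName ℕ) (p : Option Letter → Prog)
  | loop (t : TapeName ℕ) (p : Prog)

/-- The state of the tapes: the content of each stack and the position of the cell just after its
last letter. -/
structure Store where
  stk : TapeName ℕ → Str
  fin : TapeName ℕ → ℤ

/-- `Exec φ p m m' n`: with oracle `φ`, the program `p` turns `m` into `m'` in `n` steps. -/
inductive Exec (φ : Baire) : Prog → Store → Store → ℕ → Prop
  | skip (m) : Exec φ .skip m m 1
  | push (m t x) : Exec φ (.push t x) m ⟨Function.update m.stk t (x :: m.stk t), m.fin⟩ 2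
  | pop (m t x s) (h : m.stk t = x :: s) :
      Exec φ (.pop t) m ⟨Function.update m.stk t s, m.fin⟩ 1
  | right (m t) (h : m.stk t = []) :
      Exec φ (.pop t) m ⟨m.stk, Function.update m.fin t (m.fin t + 1)⟩ 1
  | left (m t) (h : m.stk t = []) :
      Exec φ (.left t) m ⟨m.stk, Function.update m.fin t (m.fin t - 1)⟩ 1
  | ask (m) (hq : m.fin .query = (m.stk .query).length)
      (ha : m.fin .answer = (m.stk .answer).length) :
      Exec φ .ask m ⟨Function.update m.stk .answer (φ (m.stk .query)),
        Function.update m.fin .answer (φ (m.stk .query)).length⟩ 3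
  | seq {p q m m' m'' n n'} (h : Exec φ p m m' n) (h' : Exec φ q m' m'' n') :
      Exec φ (.seq p q) m m'' (n + n' + 1)
  | cond {t ps m m' n} (h : Exec φ (ps (m.stk t).head?) m m' n) :
      Exec φ (.cond t ps) m m' (n + 1)
  | loop_nil {t p m} (h : m.stk t = []) : Exec φ (.loop t p) m m 1
  | loop_cons {t p m m' m'' n n'} (h : m.stk t ≠ []) (h' : Exec φ p m m' n)
      (h'' : Exec φ (.loop t p) m' m'' n') : Exec φ (.loop t p) m m'' (n + n' + 1)

/-- The tape is a designated tape or one of the first `N` work tapes. -/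
def TapeName.Below (N : ℕ) : TapeName ℕ → Prop
  | .work i => i < N
  | _ => True

/-- The program uses only the designated tapes and the first `N` work tapes. -/
def Prog.Below (N : ℕ) : Prog → Prop
  | .skip => True
  | .push t _ => t.Below N
  | .pop t => t.Below N
  | .left t => t.Below N
  | .ask => True
  | .seq p q => p.Below N ∧ q.Below N
  | .cond t p => t.Below N ∧ ∀ o, (p o).Below N
  | .loop t p => t.Below N ∧ p.Below N

/-- The continuations that occur in the execution of a program. -/
def Prog.conts : Prog → List Prog → Set (List Prog)
  | .seq p q, k => insert (.seq p q :: k) (p.conts (q :: k) ∪ q.conts k)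
  | .cond t p, k => insert (.cond t p :: k) (⋃ o, (p o).conts k)
  | .loop t p, k => insert (.loop t p :: k) (p.conts (.loop t p :: k))
  | p, k => {p :: k}

instance : DecidableEq Letter := fun a b => by
  cases a <;> cases b <;> first | exact isTrue rfl | exact isFalse (by intro h; cases h)

instance : Fintype Letter := ⟨{.zero, .one, .point}, by intro x; cases x <;> simp⟩

theorem Prog.finite_conts (p : Prog) (k : List Prog) : (p.conts k).Finite := by
  induction p generalizing k with
  | seq p q hp hq => exact ((hp _).union (hq _)).insert _
  | cond t p hp => exact (Set.finite_iUnion fun o => hp o _).insert _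
  | loop t p hp => exact (hp _).insert _
  | _ => exact Set.finite_singleton _

theorem Prog.mem_conts (p : Prog) (k : List Prog) : p :: k ∈ p.conts k := by
  cases p <;> simp [Prog.conts]

/-! ### Compilation -/

/-- The control states of a compiled program. -/
inductive ProgState (C : Set (List Prog))
  | loc (k : C) (b : Bool)
  | query
  | resume

instance (C : Set (List Prog)) [Finite C] : Finite (ProgState C) := by
  refine Finite.of_injective (β := (C × Bool) ⊕ Bool) (fun s => match s with
    | .loc k b => .inl (k, b)
    | .query => .inr true
    | .resume => .inr false) ?_
  rintro (⟨k, b⟩ | _ | _) (⟨k', b'⟩ | _ | _) h <;> simp_all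

open Classical in
/-- The continuation `k`, if it belongs to `C`. -/
def contIn (C : Set (List Prog)) (h0 : [] ∈ C) (k : List Prog) : C :=
  if h : k ∈ C then ⟨k, h⟩ else ⟨[], h0⟩

/-- The tape of the compiled machine that corresponds to a tape of the program. The last work tape
of the machine stores the continuation during oracle calls. -/
def realTape (N : ℕ) : TapeName ℕ → TapeName (Option (Fin N))
  | .input => .input
  | .output => .output
  | .query => .query
  | .answer => .answer
  | .work i => .work (if h : i < N then some ⟨i, h⟩ else none)

open Classical in
/-- The action that writes `a` on tape `t` and moves its head. -/
def tapeAct {W A : Type} (rd : TapeName W → Cell A) (t : TapeName W) (a : Cell A) (v : Move) :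
    TapeName W → Cell A × Move :=
  fun u => if u = t then (a, v) else (rd u, .stay)

theorem tapeAct_self {W A : Type} (rd : TapeName W → Cell A) (t : TapeName W) (a : Cell A)
    (v : Move) : tapeAct rd t a v t = (a, v) := if_pos rfl

theorem tapeAct_of_ne {W A : Type} (rd : TapeName W → Cell A) {t u : TapeName W} (a : Cell A)
    (v : Move) (h : u ≠ t) : tapeAct rd t a v u = (rd u, .stay) := if_neg h

/-- The transition function of a compiled program. -/
def progTrans (C : Set (List Prog)) (h0 : [] ∈ C) (N : ℕ) :
    ProgState C → (TapeName (Option (Fin N)) → Cell C) →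
      ProgState C × (TapeName (Option (Fin N)) → Cell C × Move)
  | .query, rd => (.query, fun u => (rd u, .stay))
  | .resume, rd =>
    (match rd (.work none) with
      | some (.inr k) => .loc k false
      | _ => .query, fun u => (rd u, .stay))
  | .loc k b, rd =>
    match k.1 with
    | [] => (.loc k b, fun u => (rd u, .stay))
    | .skip :: k' => (.loc (contIn C h0 k') false, fun u => (rd u, .stay))
    | .push t x :: k' =>
      if b then (.loc (contIn C h0 k') false, tapeAct rd (realTape N t) (some (.inl x)) .stay)
      else (.loc k true, tapeAct rd (realTape N t) (rd (realTape N t)) .left)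
    | .pop t :: k' =>
      (.loc (contIn C h0 k') false, tapeAct rd (realTape N t) none .right)
    | .left t :: k' =>
      (.loc (contIn C h0 k') false, tapeAct rd (realTape N t) (rd (realTape N t)) .left)
    | .ask :: k' => (.query, tapeAct rd (.work none) (some (.inr (contIn C h0 k'))) .stay)
    | .seq p q :: k' => (.loc (contIn C h0 (p :: q :: k')) false, fun u => (rd u, .stay))
    | .cond t p :: k' =>
      (.loc (contIn C h0 (p (cellLetter (rd (realTape N t))) :: k')) false, fun u => (rd u, .stay))
    | .loop t p :: k' =>
      (.loc (contIn C h0 (if (cellLetter (rd (realTape N t))).isSome then p :: .loop t p :: k'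
        else k')) false, fun u => (rd u, .stay))

/-- The machine that executes the program `p`. -/
abbrev progMachine (C : Set (List Prog)) (h0 : [] ∈ C) (hC : C.Finite) (N : ℕ) (p : Prog) :
    OracleMachine where
  State := ProgState C
  WorkTape := Option (Fin N)
  Aux := C
  finite_state := by have := hC.to_subtype; infer_instance
  finite_workTape := inferInstance
  finite_aux := hC.to_subtype
  start := .loc (contIn C h0 [p]) false
  halt := .loc ⟨[], h0⟩ false
  query := .query
  resume := .resume
  trans := progTrans C h0 N

/-! ### Tapes as stacks -/

theorem tapeOfStr_nil {A : Type} (i : ℤ) : tapeOfStr (A := A) [] i = none := by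
  simp [tapeOfStr]

theorem tapeOfStr_neg {A : Type} (s : Str) {i : ℤ} (hi : i < 0) :
    tapeOfStr (A := A) s i = none := by
  simp [tapeOfStr, hi]

theorem tapeOfStr_cons {A : Type} (x : Letter) (s : Str) (i : ℤ) :
    tapeOfStr (A := A) (x :: s) i = if i = 0 then some (.inl x) else tapeOfStr s (i - 1) := by
  rcases lt_trichotomy i 0 with h | rfl | h
  · rw [tapeOfStr_neg _ h, tapeOfStr_neg _ (by omega), if_neg h.ne]
  · simp [tapeOfStr]
  · obtain ⟨n, rfl⟩ : ∃ n : ℕ, i = n + 1 := ⟨(i - 1).toNat, by omega⟩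
    rw [if_neg h.ne']
    simp only [tapeOfStr, add_sub_cancel_right]
    rw [if_neg (by omega), if_neg (by omega), show ((n : ℤ) + 1).toNat = n + 1 by omega,
      show ((n : ℤ)).toNat = n by omega]
    simp

theorem cellLetter_tapeOfStr {A : Type} (s : Str) (n : ℕ) :
    cellLetter (tapeOfStr (A := A) s n) = s[n]? := by
  simp only [tapeOfStr]
  rw [if_neg (by omega), Int.toNat_natCast]
  cases s[n]? <;> rfl

theorem cellLetter_tapeOfStr_zero {A : Type} (s : Str) :
    cellLetter (tapeOfStr (A := A) s 0) = s.head? := by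
  have := cellLetter_tapeOfStr (A := A) s 0
  rw [Nat.cast_zero] at this
  rw [this, List.head?_eq_getElem?]

theorem strOfTape_tapeOfStr {A : Type} (s : Str) : strOfTape (tapeOfStr (A := A) s) = s := by
  have hlen : sInf {n : ℕ | cellLetter (tapeOfStr (A := A) s n) = none} = s.length := by
    apply le_antisymm
    · apply Nat.sInf_le
      simp [cellLetter_tapeOfStr]
    · apply le_csInf ⟨s.length, by simp [cellLetter_tapeOfStr]⟩
      intro n hn
      simpa [cellLetter_tapeOfStr] using hn
  rw [strOfTape, hlen]
  simp only [cellLetter_tapeOfStr]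
  induction s using List.reverseRecOn with
  | nil => rfl
  | append_singleton s x ih =>
    rw [List.length_append, List.length_singleton, List.range_succ, List.filterMap_append]
    have hs : ((List.range s.length).filterMap fun i => (s ++ [x])[i]?)
        = (List.range s.length).filterMap fun i => s[i]? := by
      apply List.filterMap_congr
      intro i hi
      rw [List.getElem?_append_left (List.mem_range.1 hi)]
    rw [hs, ih ?_]
    · simp
    · apply le_antisymm
      · apply Nat.sInf_le
        simp [cellLetter_tapeOfStr]
      · apply le_csInf ⟨s.length, by simp [cellLetter_tapeOfStr]⟩
        intro n hn
        simpa [cellLetter_tapeOfStr] using hn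

/-- The tape with cells `f` and head position `h` carries the stack `s` that ends before cell
`e`. -/
def IsStack {A : Type} (f : ℤ → Cell A) (h : ℤ) (s : Str) (e : ℤ) : Prop :=
  h = e - s.length ∧ ∀ i, f (h + i) = tapeOfStr s i

theorem IsStack.head {A : Type} {f : ℤ → Cell A} {h : ℤ} {s : Str} {e : ℤ}
    (hs : IsStack f h s e) : cellLetter (f h) = s.head? := by
  have := hs.2 0
  rw [add_zero] at this
  rw [this, cellLetter_tapeOfStr_zero]

theorem IsStack.push {A : Type} {f : ℤ → Cell A} {h : ℤ} {s : Str} {e : ℤ}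
    (hs : IsStack f h s e) (x : Letter) :
    IsStack (fun i => if i = h - 1 then some (.inl x) else f i) (h - 1) (x :: s) e := by
  refine ⟨by rw [hs.1]; simp; ring, fun i => ?_⟩
  rw [tapeOfStr_cons]
  by_cases hi : i = 0
  · simp [hi]
  · rw [if_neg hi]
    simp only
    rw [if_neg (by omega), ← hs.2 (i - 1)]
    congr 1; ring

theorem IsStack.pop {A : Type} {f : ℤ → Cell A} {h : ℤ} {x : Letter} {s : Str} {e : ℤ}
    (hs : IsStack f h (x :: s) e) :
    IsStack (fun i => if i = h then none else f i) (h + 1) s e := by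
  refine ⟨by rw [hs.1]; simp; ring, fun i => ?_⟩
  by_cases hi : i = -1
  · simp [hi, tapeOfStr]
  · simp only
    rw [if_neg (by omega), add_assoc, hs.2 (1 + i), tapeOfStr_cons, if_neg (by omega)]
    congr 1; ring

theorem IsStack.right {A : Type} {f : ℤ → Cell A} {h e : ℤ} (hs : IsStack f h [] e) :
    IsStack (fun i => if i = h then none else f i) (h + 1) [] (e + 1) := by
  refine ⟨by rw [hs.1]; simp, fun i => ?_⟩
  simp only [tapeOfStr_nil]
  split
  · rfl
  · rw [add_assoc, hs.2, tapeOfStr_nil]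

theorem IsStack.left {A : Type} {f : ℤ → Cell A} {h e : ℤ} (hs : IsStack f h [] e) :
    IsStack f (h - 1) [] (e - 1) := by
  refine ⟨by rw [hs.1]; simp, fun i => ?_⟩
  have := hs.2 (i - 1)
  rw [tapeOfStr_nil] at this ⊢
  rw [← this]
  congr 1; ring

/-! ### Correctness of compilation -/

theorem realTape_ne_none {N : ℕ} {t : TapeName ℕ} (ht : t.Below N) :
    realTape N t ≠ .work none := by
  cases t <;> simp_all [realTape, TapeName.Below]

theorem realTape_inj {N : ℕ} {t u : TapeName ℕ} (ht : t.Below N) (hu : u.Below N)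
    (h : realTape N t = realTape N u) : t = u := by
  cases t <;> cases u <;> simp_all [realTape, TapeName.Below]

section Simulation

variable {C : Set (List Prog)} {h0 : [] ∈ C} {hC : C.Finite} {N : ℕ} {p₀ : Prog}

/-- The configuration `c` of the compiled machine represents the store `m`. -/
def Represents (c : (progMachine C h0 hC N p₀).Config) (m : Store) : Prop :=
  ∀ t : TapeName ℕ, t.Below N →
    IsStack (c.cells (realTape N t)) (c.head (realTape N t)) (m.stk t) (m.fin t)

theorem contIn_of_mem {k : List Prog} (hk : k ∈ C) : contIn C h0 k = ⟨k, hk⟩ := by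
  rw [contIn, dif_pos hk]

theorem step_loc (φ : Baire) (c : (progMachine C h0 hC N p₀).Config) (k : C) (b : Bool)
    (hs : c.state = .loc k b) (hk : k.1 ≠ []) :
    (progMachine C h0 hC N p₀).step φ c = (progMachine C h0 hC N p₀).transStep c := by
  rw [OracleMachine.step, if_neg, if_neg]
  · rw [hs]; intro h; cases h
  · rw [hs]; intro h
    have h2 : ProgState.loc k b = .loc ⟨[], h0⟩ false := h
    injection h2 with h3
    exact hk (by rw [h3])

theorem transStep_idle (c : (progMachine C h0 hC N p₀).Config) (s : ProgState C)
    (h : (progMachine C h0 hC N p₀).trans c.state (fun t => c.cells t (c.head t))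
      = (s, fun u => (c.cells u (c.head u), .stay))) :
    (progMachine C h0 hC N p₀).transStep c = ⟨s, c.cells, c.head⟩ := by
  rw [OracleMachine.transStep, h]
  congr 1
  · funext t i
    split
    · rename_i h; rw [h]
    · rfl
  · funext t
    simp [Move.shift]

theorem transStep_act (c : (progMachine C h0 hC N p₀).Config) (s : ProgState C)
    (t : TapeName (Option (Fin N))) (a : Cell C) (v : Move)
    (h : (progMachine C h0 hC N p₀).trans c.state (fun t => c.cells t (c.head t))
      = (s, tapeAct (fun t => c.cells t (c.head t)) t a v)) :
    ((progMachine C h0 hC N p₀).transStep c).state = s ∧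
    (∀ u, u ≠ t → ((progMachine C h0 hC N p₀).transStep c).cells u = c.cells u ∧
      ((progMachine C h0 hC N p₀).transStep c).head u = c.head u) ∧
    ((progMachine C h0 hC N p₀).transStep c).cells t
      = (fun i => if i = c.head t then a else c.cells t i) ∧
    ((progMachine C h0 hC N p₀).transStep c).head t = c.head t + v.shift := by
  rw [OracleMachine.transStep, h]
  refine ⟨rfl, fun u hu => ⟨?_, ?_⟩, ?_, ?_⟩
  · funext i
    simp only [tapeAct_of_ne _ _ _ hu]
    split
    · rename_i h; rw [h]
    · rfl
  · simp [tapeAct_of_ne _ _ _ hu, Move.shift]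
  · funext i
    simp [tapeAct_self]
  · simp [tapeAct_self]

theorem Represents.act {c c' : (progMachine C h0 hC N p₀).Config} {m m' : Store}
    (hm : Represents c m) {t : TapeName ℕ} (ht : t.Below N)
    (hc : ∀ u, u ≠ realTape N t → c'.cells u = c.cells u ∧ c'.head u = c.head u)
    (hm' : ∀ u, u ≠ t → m'.stk u = m.stk u ∧ m'.fin u = m.fin u)
    (h : IsStack (c'.cells (realTape N t)) (c'.head (realTape N t)) (m'.stk t) (m'.fin t)) :
    Represents c' m' := by
  intro u hu
  by_cases hut : u = t
  · rw [hut]; exact h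
  · have h1 := hc (realTape N u) fun he => hut (realTape_inj hu ht he)
    have h2 := hm' u hut
    rw [h1.1, h1.2, h2.1, h2.2]
    exact hm u hu

theorem Represents.head {c : (progMachine C h0 hC N p₀).Config} {m : Store}
    (hm : Represents c m) {t : TapeName ℕ} (ht : t.Below N) :
    cellLetter (c.cells (realTape N t) (c.head (realTape N t))) = (m.stk t).head? :=
  (hm t ht).head

theorem ite_self_cell {A : Type} (f : ℤ → Cell A) (h : ℤ) :
    (fun i => if i = h then f h else f i) = f := by
  funext i
  split
  · rename_i h; rw [h]
  · rfl

theorem simulate (φ : Baire) {p : Prog} {m m' : Store} {n : ℕ} (h : Exec φ p m m' n)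
    (hp : p.Below N) (k : List Prog) (hsub : p.conts k ⊆ C) (hk : k ∈ C)
    (c : (progMachine C h0 hC N p₀).Config) (hs : c.state = .loc (contIn C h0 (p :: k)) false)
    (hm : Represents c m) :
    (((progMachine C h0 hC N p₀).step φ)^[n] c).state = .loc (contIn C h0 k) false ∧
    Represents (((progMachine C h0 hC N p₀).step φ)^[n] c) m' := by
  induction h generalizing k c with
  | skip m =>
    rw [contIn_of_mem (hsub (Prog.mem_conts _ _))] at hs
    rw [Function.iterate_one, step_loc φ c _ _ hs (by simp),
      transStep_idle c (.loc (contIn C h0 k) false) (by rw [hs]; rfl)]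
    exact ⟨rfl, hm⟩
  | push m t x =>
    rw [contIn_of_mem (hsub (Prog.mem_conts _ _))] at hs
    rw [Function.iterate_succ_apply, Function.iterate_one, step_loc φ c _ _ hs (by simp)]
    have h1 := transStep_act c (.loc ⟨.push t x :: k, hsub (Prog.mem_conts _ _)⟩ true)
      (realTape N t) (c.cells (realTape N t) (c.head (realTape N t))) .left (by rw [hs]; rfl)
    generalize (progMachine C h0 hC N p₀).transStep c = c₁ at *
    obtain ⟨hs1, ho1, hc1, hh1⟩ := h1
    rw [step_loc φ c₁ _ _ hs1 (by simp)]
    have h2 := transStep_act c₁ (.loc (contIn C h0 k) false)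
      (realTape N t) (some (.inl x)) .stay (by rw [hs1]; rfl)
    generalize (progMachine C h0 hC N p₀).transStep c₁ = c₂ at *
    obtain ⟨hs2, ho2, hc2, hh2⟩ := h2
    refine ⟨hs2, hm.act (t := t) hp
      (fun u hu => ⟨(ho2 u hu).1.trans (ho1 u hu).1, (ho2 u hu).2.trans (ho1 u hu).2⟩)
      (fun u hu => ⟨by simp [hu], rfl⟩) ?_⟩
    rw [hc2, hh2, hh1, hc1]
    have := (hm t hp).push x
    rw [← ite_self_cell (c.cells (realTape N t)) (c.head (realTape N t))] at this
    simpa only [Move.shift, Function.update_self, add_zero, ← sub_eq_add_neg] using this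
  | pop m t x s h =>
    rw [contIn_of_mem (hsub (Prog.mem_conts _ _))] at hs
    rw [Function.iterate_one, step_loc φ c _ _ hs (by simp)]
    obtain ⟨hs1, ho1, hc1, hh1⟩ := transStep_act c (.loc (contIn C h0 k) false)
      (realTape N t) none .right (by rw [hs]; rfl)
    refine ⟨hs1, hm.act (t := t) hp ho1 (fun u hu => ⟨by simp [hu], rfl⟩) ?_⟩
    rw [hc1, hh1]
    have := hm t hp
    rw [h] at this
    simpa [Move.shift] using this.pop
  | right m t h =>
    rw [contIn_of_mem (hsub (Prog.mem_conts _ _))] at hs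
    rw [Function.iterate_one, step_loc φ c _ _ hs (by simp)]
    obtain ⟨hs1, ho1, hc1, hh1⟩ := transStep_act c (.loc (contIn C h0 k) false)
      (realTape N t) none .right (by rw [hs]; rfl)
    refine ⟨hs1, hm.act (t := t) hp ho1 (fun u hu => ⟨rfl, by simp [hu]⟩) ?_⟩
    rw [hc1, hh1]
    have := hm t hp
    rw [h] at this
    simpa [Move.shift, h] using this.right
  | left m t h =>
    rw [contIn_of_mem (hsub (Prog.mem_conts _ _))] at hs
    rw [Function.iterate_one, step_loc φ c _ _ hs (by simp)]
    obtain ⟨hs1, ho1, hc1, hh1⟩ := transStep_act c (.loc (contIn C h0 k) false)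
      (realTape N t) (c.cells (realTape N t) (c.head (realTape N t))) .left (by rw [hs]; rfl)
    refine ⟨hs1, hm.act (t := t) hp ho1 (fun u hu => ⟨rfl, by simp [hu]⟩) ?_⟩
    rw [hc1, hh1]
    have := hm t hp
    rw [h] at this
    have h2 := this.left
    simpa [Move.shift, h, ite_self_cell, sub_eq_add_neg] using h2
  | ask m hq ha =>
    rw [contIn_of_mem (hsub (Prog.mem_conts _ _))] at hs
    rw [Function.iterate_succ_apply, Function.iterate_succ_apply, Function.iterate_one,
      step_loc φ c _ _ hs (by simp)]
    have h1 := transStep_act c .query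
      (.work none) (some (.inr (contIn C h0 k))) .stay (by rw [hs]; rfl)
    generalize (progMachine C h0 hC N p₀).transStep c = c₁ at *
    obtain ⟨hs1, ho1, hc1, hh1⟩ := h1
    have h2 : (progMachine C h0 hC N p₀).step φ c₁ = (progMachine C h0 hC N p₀).oracleStep φ c₁ := by
      rw [OracleMachine.step, if_neg, if_pos]
      · exact hs1
      · rw [hs1]; intro h; cases h
    rw [h2]
    generalize hc₂ : (progMachine C h0 hC N p₀).oracleStep φ c₁ = c₂
    have hs2 : c₂.state = .resume := by rw [← hc₂]; rfl
    have h3 : (progMachine C h0 hC N p₀).step φ c₂ = (progMachine C h0 hC N p₀).transStep c₂ := by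
      rw [OracleMachine.step, if_neg, if_neg]
      · rw [hs2]; intro h; cases h
      · rw [hs2]; intro h; cases h
    have hret : c₂.cells (.work none) (c₂.head (.work none)) = some (.inr (contIn C h0 k)) := by
      rw [← hc₂]
      show c₁.cells (.work none) (c₁.head (.work none)) = _
      rw [hc1, hh1]
      simp [Move.shift]
    have hst : (progMachine C h0 hC N p₀).trans c₂.state (fun t => c₂.cells t (c₂.head t))
      = (.loc (contIn C h0 k) false, fun u => (c₂.cells u (c₂.head u), .stay)) := by
      rw [hs2]
      simp only [progTrans]
      rw [hret]
    rw [h3, transStep_idle c₂ _ hst]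
    refine ⟨rfl, ?_⟩
    have hm1 : Represents c₁ m := by
      intro t ht
      have := ho1 (realTape N t) (realTape_ne_none ht)
      rw [this.1, this.2]
      exact hm t ht
    have hqs : strOfTape (c₁.cells .query) = m.stk .query := by
      have := hm1 .query trivial
      have h0 : c₁.head (realTape N .query) = 0 := by rw [this.1, hq]; simp
      have h1 : c₁.cells (realTape N .query) = tapeOfStr (m.stk .query) := by
        funext i
        rw [← this.2 i, h0, zero_add]
      show strOfTape (c₁.cells (realTape N .query)) = _
      rw [h1, strOfTape_tapeOfStr]
    refine hm1.act (t := .answer) trivial ?_ (fun u hu => ⟨by simp [hu], by simp [hu]⟩) ?_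
    · intro u hu
      rw [← hc₂]
      refine ⟨?_, rfl⟩
      cases u <;> first | rfl | exact absurd rfl hu
    · rw [← hc₂]
      have := hm1 .answer trivial
      have h1 : ((progMachine C h0 hC N p₀).oracleStep φ c₁).head (realTape N .answer) = 0 := by
        show c₁.head (realTape N .answer) = 0
        rw [this.1, ha]; simp
      simp only [Function.update_self]
      rw [h1]
      refine ⟨by simp, fun i => ?_⟩
      rw [zero_add, ← hqs]
      rfl
  | @seq p q m m' m'' n n' h h' ih ih' =>
    rw [contIn_of_mem (hsub (Prog.mem_conts _ _))] at hs
    rw [show n + n' + 1 = n' + (n + 1) by ring, Function.iterate_add_apply,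
      Function.iterate_succ_apply, step_loc φ c _ _ hs (by simp),
      transStep_idle c (.loc (contIn C h0 (p :: q :: k)) false) (by rw [hs]; rfl)]
    have hq : q.conts k ⊆ C := fun x hx => hsub (Or.inr (Or.inr hx))
    have h1 := ih hp.1 (q :: k) (fun x hx => hsub (Or.inr (Or.inl hx)))
      (hq (Prog.mem_conts _ _)) ⟨.loc (contIn C h0 (p :: q :: k)) false, c.cells, c.head⟩ rfl hm
    exact ih' hp.2 k hq hk _ h1.1 h1.2
  | @cond t ps m m' n h ih =>
    rw [contIn_of_mem (hsub (Prog.mem_conts _ _))] at hs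
    rw [Function.iterate_succ_apply, step_loc φ c _ _ hs (by simp),
      transStep_idle c (.loc (contIn C h0 (ps (m.stk t).head? :: k)) false) (by
        rw [hs, ← hm.head hp.1]; rfl)]
    exact ih (hp.2 _) k (fun x hx => hsub (Or.inr (Set.mem_iUnion.2 ⟨_, hx⟩))) hk _ rfl hm
  | @loop_nil t p m h =>
    rw [contIn_of_mem (hsub (Prog.mem_conts _ _))] at hs
    have h1 := hm.head hp.1
    rw [h] at h1
    rw [Function.iterate_one, step_loc φ c _ _ hs (by simp),
      transStep_idle c (.loc (contIn C h0 k) false) (by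
        rw [hs]
        simp only [progTrans]
        rw [h1]
        rfl)]
    exact ⟨rfl, hm⟩
  | @loop_cons t p m m' m'' n n' h h' h'' ih ih' =>
    have hs' := hs
    rw [contIn_of_mem (hsub (Prog.mem_conts _ _))] at hs
    have h1 := hm.head hp.1
    have h2 : (m.stk t).head?.isSome := by
      cases hh : m.stk t with
      | nil => exact absurd hh h
      | cons x s => rfl
    rw [show n + n' + 1 = n' + (n + 1) by ring, Function.iterate_add_apply,
      Function.iterate_succ_apply, step_loc φ c _ _ hs (by simp),
      transStep_idle c (.loc (contIn C h0 (p :: .loop t p :: k)) false) (by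
        rw [hs]
        simp only [progTrans]
        rw [h1, if_pos h2])]
    have h3 := ih hp.2 (.loop t p :: k) (fun x hx => hsub (Or.inr hx))
      (hsub (Prog.mem_conts _ _)) ⟨.loc (contIn C h0 (p :: .loop t p :: k)) false, c.cells, c.head⟩
      rfl hm
    exact ih' hp k hsub hk _ h3.1 h3.2

end Simulation

theorem OracleMachine.configAt_of_halted (M : OracleMachine) (φ : Baire) (a : Str) {t : ℕ}
    (h : M.HaltedAt φ a t) (u : ℕ) : M.configAt φ a (t + u) = M.configAt φ a t := by
  induction u with
  | zero => rfl
  | succ u ih =>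
    rw [← add_assoc, OracleMachine.configAt, Function.iterate_succ_apply']
    change M.step φ (M.configAt φ a (t + u)) = _
    rw [ih]
    exact if_pos h

/-- A program that writes its result on the output tape is executed by a machine. -/
theorem exists_machine {p : Prog} {F : Baire → Str → Str} {T : ℕ → ℕ}
    (h : ∀ φ a, ∃ m' n, n ≤ T a.length ∧
      Exec φ p ⟨fun t => if t = .input then a else [],
        fun t => if t = .input then a.length else 0⟩ m' n ∧
      m'.stk .output = F φ a ∧ m'.fin .output = (F φ a).length) (N : ℕ) (hp : p.Below N) :
    ∃ M : OracleMachine, (∀ φ a, M.time φ a ≤ (T a.length : ℕ∞)) ∧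
      ∀ φ, F φ ∈ M.operator φ := by
  set C : Set (List Prog) := insert [] (p.conts [])
  have h0 : [] ∈ C := Set.mem_insert _ _
  have hC : C.Finite := (p.finite_conts []).insert _
  set M := progMachine C h0 hC N p with hM
  have key : ∀ φ a, ∃ n ≤ T a.length, M.HaltedAt φ a n ∧
      strOfTape ((M.configAt φ a n).cells .output) = F φ a := by
    intro φ a
    obtain ⟨m', n, hn, hex, ho, hf⟩ := h φ a
    have hinit : Represents (M.init a) ⟨fun t => if t = .input then a else [],
        fun t => if t = .input then a.length else 0⟩ := by
      intro t ht
      cases t with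
      | input =>
        refine ⟨by simp [OracleMachine.init], fun i => ?_⟩
        simp only [if_true]
        show tapeOfStr a (0 + i) = _
        rw [zero_add]
      | _ =>
        refine ⟨by simp [OracleMachine.init], fun i => ?_⟩
        simp only [reduceCtorEq, if_false, tapeOfStr_nil]
        rfl
    have hsim := simulate φ hex hp [] (Set.subset_insert _ _) h0 (M.init a) rfl hinit
    refine ⟨n, hn, ?_, ?_⟩
    · refine hsim.1.trans ?_
      rw [contIn_of_mem h0]
    · have h1 := hsim.2 .output trivial
      rw [ho, hf] at h1
      have h2 : (M.configAt φ a n).cells .output = tapeOfStr (F φ a) := by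
        funext i
        have := h1.2 i
        rw [h1.1, sub_self, zero_add] at this
        exact this
      rw [h2, strOfTape_tapeOfStr]
  refine ⟨M, fun φ a => ?_, fun φ => ?_⟩
  · obtain ⟨n, hn, hh, -⟩ := key φ a
    exact (iInf₂_le n hh).trans (by exact_mod_cast hn)
  · have hd : ∀ a, ∃ t, M.HaltedAt φ a t := fun a => by
      obtain ⟨n, -, hh, -⟩ := key φ a
      exact ⟨n, hh⟩
    refine ⟨hd, ?_⟩
    funext a
    obtain ⟨n, -, hh, hF⟩ := key φ a
    classical
    have hle : Nat.find (hd a) ≤ n := Nat.find_min' _ hh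
    have := M.configAt_of_halted φ a (Nat.find_spec (hd a)) (n - Nat.find (hd a))
    rw [Nat.add_sub_cancel' hle] at this
    show strOfTape ((M.configAt φ a (Nat.find (hd a))).cells .output) = _
    rw [← hF, this]

/-! ### Programs on work tapes -/

/-- The contents of the work tapes. -/
def Store.work (m : Store) : ℕ → Str := fun i => m.stk (.work i)

/-- The query and output tapes are blank, and the heads on the query, answer and output tapes are in
their initial positions. -/
def Store.Ready (m : Store) : Prop :=
  m.stk .query = [] ∧ m.fin .query = 0 ∧ m.stk .output = [] ∧ m.fin .output = 0 ∧
    m.fin .answer = (m.stk .answer).length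

/-- With oracle `φ`, the program `P` turns the contents `s` of the work tapes into `s'` in at most
`T` steps. -/
def Run (φ : Baire) (P : Prog) (s s' : ℕ → Str) (T : ℕ) : Prop :=
  ∀ m : Store, m.Ready → m.work = s →
    ∃ m' n, n ≤ T ∧ Exec φ P m m' n ∧ m'.Ready ∧ m'.work = s'

theorem Store.work_update (m : Store) (e : TapeName ℕ → ℤ) (r : ℕ) (v : Str) :
    Store.work ⟨Function.update m.stk (.work r) v, e⟩ = Function.update m.work r v := by
  funext i
  by_cases h : i = r
  · subst h; simp [Store.work]
  · rw [Function.update_of_ne h]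
    show Function.update m.stk (.work r) v (.work i) = _
    rw [Function.update_of_ne (by simpa using h)]
    rfl

theorem Store.Ready.update {m : Store} (hm : m.Ready) (r : ℕ) (v : Str) :
    Store.Ready ⟨Function.update m.stk (.work r) v, m.fin⟩ := by
  simpa [Store.Ready] using hm

namespace Run

variable {φ : Baire} {P Q : Prog} {s s' s'' : ℕ → Str} {T T' : ℕ}

theorem mono (h : Run φ P s s' T) (hT : T ≤ T') : Run φ P s s' T' := by
  intro m hm hs
  obtain ⟨m', n, hn, h'⟩ := h m hm hs
  exact ⟨m', n, hn.trans hT, h'⟩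

theorem skip (s : ℕ → Str) : Run φ .skip s s 1 := fun m hm hs => ⟨m, 1, le_rfl, .skip m, hm, hs⟩

theorem push (s : ℕ → Str) (r : ℕ) (x : Letter) :
    Run φ (.push (.work r) x) s (Function.update s r (x :: s r)) 2 := by
  rintro m hm rfl
  exact ⟨_, 2, le_rfl, .push m _ x, hm.update _ _, m.work_update _ _ _⟩

theorem pop (s : ℕ → Str) (r : ℕ) :
    Run φ (.pop (.work r)) s (Function.update s r (s r).tail) 1 := by
  rintro m hm rfl
  cases h : m.stk (.work r) with
  | nil =>
    refine ⟨_, 1, le_rfl, .right m _ h, ?_, ?_⟩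
    · simpa [Store.Ready] using hm
    · have h1 : m.work r = [] := h
      have h2 : Function.update m.work r (m.work r).tail = m.work := by
        rw [h1, List.tail_nil, ← h1, Function.update_eq_self]
      rw [h2]
      rfl
  | cons x t =>
    refine ⟨_, 1, le_rfl, .pop m _ x t h, hm.update _ _, ?_⟩
    rw [m.work_update]
    have h1 : m.work r = x :: t := h
    rw [h1, List.tail_cons]

theorem seq (h : Run φ P s s' T) (h' : Run φ Q s' s'' T') :
    Run φ (.seq P Q) s s'' (T + T' + 1) := by
  intro m hm hs
  obtain ⟨m₁, n₁, hn₁, he₁, hm₁, hs₁⟩ := h m hm hs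
  obtain ⟨m₂, n₂, hn₂, he₂, hm₂, hs₂⟩ := h' m₁ hm₁ hs₁
  exact ⟨m₂, _, by omega, .seq he₁ he₂, hm₂, hs₂⟩

theorem cond {ps : Option Letter → Prog} {r : ℕ} (h : Run φ (ps (s r).head?) s s' T) :
    Run φ (.cond (.work r) ps) s s' (T + 1) := by
  rintro m hm rfl
  obtain ⟨m₁, n₁, hn₁, he₁, hm₁, hs₁⟩ := h m hm rfl
  exact ⟨m₁, _, by omega, .cond he₁, hm₁, hs₁⟩

theorem loop_nil {r : ℕ} (h : s r = []) : Run φ (.loop (.work r) P) s s 1 := by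
  rintro m hm rfl
  exact ⟨m, 1, le_rfl, .loop_nil h, hm, rfl⟩

theorem loop_cons {r : ℕ} (h : s r ≠ []) (h' : Run φ P s s' T)
    (h'' : Run φ (.loop (.work r) P) s' s'' T') :
    Run φ (.loop (.work r) P) s s'' (T + T' + 1) := by
  rintro m hm rfl
  obtain ⟨m₁, n₁, hn₁, he₁, hm₁, hs₁⟩ := h' m hm rfl
  obtain ⟨m₂, n₂, hn₂, he₂, hm₂, hs₂⟩ := h'' m₁ hm₁ hs₁
  exact ⟨m₂, _, by omega, .loop_cons h he₁ he₂, hm₂, hs₂⟩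

/-- A loop over the letters of a stack. -/
theorem loop_fold {β : Type} {r : ℕ} (S : Str → β → ℕ → Str) (g : Letter → β → β)
    (I : Str → β → Prop) (c : ℕ) (hS : ∀ l b, S l b r = l)
    (hstep : ∀ x l b, I (x :: l) b → Run φ P (S (x :: l) b) (S l (g x b)) c ∧ I l (g x b))
    (l : Str) (b : β) (hI : I l b) :
    Run φ (.loop (.work r) P) (S l b) (S [] (l.foldl (fun b x => g x b) b))
      ((c + 1) * l.length + 1) := by
  induction l generalizing b with
  | nil => exact (loop_nil (hS _ _)).mono (by simp)
  | cons x l ih =>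
    have h := hstep x l b hI
    refine (loop_cons (by rw [hS]; simp) h.1 (ih _ h.2)).mono ?_
    rw [List.length_cons]
    ring_nf
    omega

end Run

/-- The programs `P 0`, …, `P (n - 1)` one after the other. -/
def Prog.seqN (P : ℕ → Prog) : ℕ → Prog
  | 0 => .skip
  | n + 1 => .seq (Prog.seqN P n) (P n)

theorem Run.seqN {φ : Baire} {P : ℕ → Prog} {S : ℕ → ℕ → Str} {T n : ℕ}
    (h : ∀ i < n, Run φ (P i) (S i) (S (i + 1)) T) :
    Run φ (Prog.seqN P n) (S 0) (S n) (n * (T + 1) + 1) := by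
  induction n with
  | zero => exact (Run.skip _).mono (by omega)
  | succ n ih =>
    refine ((ih fun i hi => h i (by omega)).seq (h n (by omega))).mono ?_
    ring_nf
    omega

theorem TapeName.Below.mono {N N' : ℕ} (hN : N ≤ N') {t : TapeName ℕ} (h : t.Below N) :
    t.Below N' := by
  cases t with
  | work i => exact lt_of_lt_of_le h hN
  | _ => trivial

theorem Prog.Below.mono {N N' : ℕ} (hN : N ≤ N') {P : Prog} (h : P.Below N) : P.Below N' := by
  induction P with
  | seq p q hp hq => exact ⟨hp h.1, hq h.2⟩
  | cond t p hp => exact ⟨h.1.mono hN, fun o => hp o (h.2 o)⟩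
  | loop t p hp => exact ⟨h.1.mono hN, hp h.2⟩
  | skip => trivial
  | ask => trivial
  | push t x => exact TapeName.Below.mono hN h
  | pop t => exact TapeName.Below.mono hN h
  | left t => exact TapeName.Below.mono hN h

theorem Prog.Below.seqN {N n : ℕ} {P : ℕ → Prog} (h : ∀ i < n, (P i).Below N) :
    (Prog.seqN P n).Below N := by
  induction n with
  | zero => trivial
  | succ n ih => exact ⟨ih fun i hi => h i (by omega), h n (by omega)⟩

/-- Erase a stack. -/
def Prog.clear (r : ℕ) : Prog := .loop (.work r) (.pop (.work r))

theorem Run.clear {φ : Baire} (s : ℕ → Str) (r : ℕ) :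
    Run φ (Prog.clear r) s (Function.update s r []) (2 * (s r).length + 1) := by
  have := Run.loop_fold (φ := φ) (P := .pop (.work r)) (r := r)
    (fun l (_ : Unit) => Function.update s r l) (fun _ b => b) (fun _ _ => True) 1
    (fun l b => by simp)
    (fun x l b _ => ⟨by
      have := Run.pop (φ := φ) (Function.update s r (x :: l)) r
      simpa using this, trivial⟩) (s r) () trivial
  simpa [Prog.clear] using this

/-- For each letter of the stack on tape `t`, push it on the tapes in the list. -/
def Prog.spread (t : TapeName ℕ) (us : List (TapeName ℕ)) : Prog :=
  .loop t (.cond t fun o => us.foldr (fun u p => .seq (.push u (o.getD .zero)) p) (.pop t))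

/-- Move the letters of a stack to another stack, in reverse order. -/
def Prog.transfer (r r' : ℕ) : Prog := .spread (.work r) [.work r']

theorem Run.transfer {φ : Baire} (s : ℕ → Str) {r r' : ℕ} (h : r ≠ r') :
    Run φ (Prog.transfer r r') s
      (Function.update (Function.update s r []) r' ((s r).reverse ++ s r'))
      (6 * (s r).length + 1) := by
  have := Run.loop_fold (φ := φ) (r := r)
    (P := .cond (.work r) fun o => [TapeName.work r'].foldr
      (fun u p => .seq (.push u (o.getD .zero)) p) (.pop (.work r)))
    (fun l b => Function.update (Function.update s r l) r' b) (fun x b => x :: b)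
    (fun _ _ => True) 5 (fun l b => by simp [h])
    (fun x l b _ => ⟨by
      apply Run.cond (T := 4)
      have h1 := Run.push (φ := φ) (Function.update (Function.update s r (x :: l)) r' b) r' x
      have h2 := h1.seq (Run.pop _ r)
      refine (cast ?_ h2 : Run _ _ _ _ _)
      congr 1
      · simp [h]
      · funext i
        simp only [Function.update_apply]
        split_ifs <;> simp_all, trivial⟩) (s r) (s r') trivial
  simpa [Prog.transfer, Prog.spread, List.foldl_flip_cons_eq_append'] using this

/-- Copy a stack to two empty stacks, and erase it. -/
def Prog.copy (r r' tmp : ℕ) : Prog :=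
  .seq (.transfer r tmp) (.spread (.work tmp) [.work r, .work r'])

theorem Run.copy {φ : Baire} (s : ℕ → Str) {r r' tmp : ℕ} (h : r ≠ r') (h1 : r ≠ tmp)
    (h2 : r' ≠ tmp) (h3 : s r' = []) (h4 : s tmp = []) :
    Run φ (Prog.copy r r' tmp) s (Function.update s r' (s r)) (15 * (s r).length + 3) := by
  have ht := Run.transfer (φ := φ) s h1
  have := Run.loop_fold (φ := φ) (r := tmp)
    (P := .cond (.work tmp) fun o => [TapeName.work r, .work r'].foldr
      (fun u p => .seq (.push u (o.getD .zero)) p) (.pop (.work tmp)))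
    (fun l b => Function.update (Function.update (Function.update s tmp l) r b) r' b)
    (fun x b => x :: b)
    (fun _ _ => True) 8 (fun l b => by simp [h1.symm, h2.symm])
    (fun x l b _ => ⟨by
      apply Run.cond (T := 7)
      have k1 := Run.push (φ := φ)
        (Function.update (Function.update (Function.update s tmp (x :: l)) r b) r' b) r x
      have k2 := k1.seq ((Run.push _ r' x).seq (Run.pop _ tmp))
      refine (cast ?_ k2 : Run _ _ _ _ _)
      congr 1
      · simp [h1.symm, h2.symm]
      · funext i
        simp only [Function.update_apply]
        split_ifs <;> simp_all, trivial⟩) (s r).reverse [] trivial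
  refine ((ht.seq (s'' := Function.update s r' (s r)) (T' := 9 * (s r).length + 1)
    (cast ?_ this)).mono (by omega))
  rw [List.length_reverse]
  congr 1
  · funext i
    simp only [Function.update_apply]
    split_ifs <;> simp_all
  · funext i
    simp only [Function.update_apply]
    have : List.foldl (fun b x => x :: b) [] (s r).reverse = s r := by simp
    rw [this]
    split_ifs <;> simp_all

/-! ### Oracle calls with bounded reading -/

/-- Execution in at most `T` steps. -/
def ExecLe (φ : Baire) (P : Prog) (m m' : Store) (T : ℕ) : Prop := ∃ n ≤ T, Exec φ P m m' n

namespace ExecLe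

variable {φ : Baire} {P Q : Prog} {m m' m'' : Store} {T T' : ℕ}

theorem seq (h : ExecLe φ P m m' T) (h' : ExecLe φ Q m' m'' T') :
    ExecLe φ (.seq P Q) m m'' (T + T' + 1) := by
  obtain ⟨n, hn, h⟩ := h
  obtain ⟨n', hn', h'⟩ := h'
  exact ⟨_, by omega, .seq h h'⟩

theorem cond {ps : Option Letter → Prog} {t : TapeName ℕ}
    (h : ExecLe φ (ps (m.stk t).head?) m m' T) : ExecLe φ (.cond t ps) m m' (T + 1) := by
  obtain ⟨n, hn, h⟩ := h
  exact ⟨_, by omega, .cond h⟩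

theorem cond' {ps : Option Letter → Prog} {t : TapeName ℕ} {x : Letter} {s : Str}
    (hs : m.stk t = x :: s) (h : ExecLe φ (ps (some x)) m m' T) :
    ExecLe φ (.cond t ps) m m' (T + 1) := by
  apply cond
  rw [hs]
  exact h

theorem skip' (m : Store) (h : m' = m) (hT : 1 ≤ T) : ExecLe φ .skip m m' T :=
  ⟨1, hT, h ▸ .skip m'⟩

theorem push' (m : Store) (t : TapeName ℕ) (x : Letter)
    (h : m' = ⟨Function.update m.stk t (x :: m.stk t), m.fin⟩) :
    ExecLe φ (.push t x) m m' 2 := h ▸ ⟨2, le_rfl, .push m t x⟩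

theorem pop' (m : Store) (t : TapeName ℕ) {x : Letter} {s : Str} (hs : m.stk t = x :: s)
    (h : m' = ⟨Function.update m.stk t s, m.fin⟩) :
    ExecLe φ (.pop t) m m' 1 := h ▸ ⟨1, le_rfl, .pop m t x s hs⟩

theorem right' (m : Store) (t : TapeName ℕ) (hs : m.stk t = [])
    (h : m' = ⟨m.stk, Function.update m.fin t (m.fin t + 1)⟩) :
    ExecLe φ (.pop t) m m' 1 := h ▸ ⟨1, le_rfl, .right m t hs⟩

theorem left' (m : Store) (t : TapeName ℕ) (hs : m.stk t = [])
    (h : m' = ⟨m.stk, Function.update m.fin t (m.fin t - 1)⟩) :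
    ExecLe φ (.left t) m m' 1 := h ▸ ⟨1, le_rfl, .left m t hs⟩

theorem loop_fold {β : Type} {t : TapeName ℕ} (S : Str → β → Store) (g : Letter → β → β)
    (c : ℕ) (hS : ∀ l b, (S l b).stk t = l)
    (hstep : ∀ x l b, ExecLe φ P (S (x :: l) b) (S l (g x b)) c) (l : Str) (b : β) :
    ExecLe φ (.loop t P) (S l b) (S [] (l.foldl (fun b x => g x b) b))
      ((c + 1) * l.length + 1) := by
  induction l generalizing b with
  | nil => exact ⟨1, by simp, .loop_nil (hS _ _)⟩
  | cons x l ih =>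
    obtain ⟨n, hn, h⟩ := hstep x l b
    obtain ⟨n', hn', h'⟩ := ih (g x b)
    refine ⟨_, ?_, .loop_cons (by rw [hS]; simp) h h'⟩
    rw [List.length_cons]
    have : (c + 1) * (l.length + 1) = (c + 1) * l.length + c + 1 := by ring
    omega

end ExecLe

/-- Call the oracle on the string in register `a`, and write as many letters of the answer to
register `d'` as there are letters in register `n`. -/
def Prog.call (a b c n d d' : ℕ) : Prog :=
  .seq (.loop (.work a) (.cond (.work a) fun o =>
    .seq (.push (.work b) (o.getD .zero)) (.seq (.pop (.work a)) (.pop .query)))) <|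
  .seq (.loop (.work b) (.cond (.work b) fun o =>
    .seq (.push .query (o.getD .zero)) (.seq (.push (.work c) (o.getD .zero)) (.pop (.work b))))) <|
  .seq .ask <|
  .seq (.loop .query (.pop .query)) <|
  .seq (.loop (.work c) (.seq (.left .query) (.pop (.work c)))) <|
  .seq (.loop (.work n) (.seq (.pop (.work n)) (.cond .answer fun o => match o with
    | some x => .seq (.push (.work d) x) (.pop .answer)
    | none => .skip))) <|
  .loop (.work d) (.cond (.work d) fun o =>
    .seq (.push .answer (o.getD .zero)) (.seq (.push (.work d') (o.getD .zero)) (.pop (.work d))))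

theorem foldl_cons_eq (l b : Str) : l.foldl (fun b x => x :: b) b = l.reverse ++ b := by
  induction l generalizing b with
  | nil => rfl
  | cons x l ih => simp [ih]

theorem foldl_read (l d a : Str) :
    l.foldl (fun (b : Str × Str) (_ : Letter) => match b with
      | (d, []) => (d, [])
      | (d, x :: a) => (x :: d, a)) (d, a) = ((a.take l.length).reverse ++ d, a.drop l.length) := by
  induction l generalizing d a with
  | nil => simp
  | cons x l ih => cases a with
    | nil => simp only [List.foldl_cons]; rw [ih]; simp
    | cons y a => simp only [List.foldl_cons]; rw [ih]; simp

theorem foldl_shift (l : Str) (b : Str) (n : ℤ) :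
    l.foldl (fun (b : Str × ℤ) x => (x :: b.1, b.2 + 1)) (b, n) = (l.reverse ++ b, n + l.length) := by
  induction l generalizing b n with
  | nil => simp
  | cons x l ih => simp only [List.foldl_cons]; rw [ih]; simp; ring

theorem foldl_unshift (l : Str) (n : ℤ) :
    l.foldl (fun (n : ℤ) _ => n - 1) n = n - l.length := by
  induction l generalizing n with
  | nil => simp
  | cons x l ih => simp only [List.foldl_cons]; rw [ih]; simp; ring

theorem foldl_restore (l a b : Str) :
    l.foldl (fun (b : Str × Str) x => (x :: b.1, x :: b.2)) (a, b)
      = (l.reverse ++ a, l.reverse ++ b) := by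
  induction l generalizing a b with
  | nil => simp
  | cons x l ih => simp only [List.foldl_cons]; rw [ih]; simp

set_option maxHeartbeats 1000000 in
open Function in
theorem Run.call {φ : Baire} {s : ℕ → Str} {a b c n d d' : ℕ}
    (hd : [a, b, c, n, d, d'].Nodup) (hb : s b = []) (hc : s c = []) (hd0 : s d = [])
    (hd' : s d' = []) :
    Run φ (Prog.call a b c n d d') s
      (update (update (update s a []) n []) d' ((φ (s a)).take (s n).length))
      (26 * (s a).length + 19 * (s n).length + 50) := by
  rintro ⟨k, e⟩ ⟨hq, hqf, ho, hof, haf⟩ rfl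
  simp only [List.nodup_cons, List.mem_cons, List.not_mem_nil, or_false, not_or] at hd
  obtain ⟨⟨hab, hac, han, had, had'⟩, ⟨hbc, hbn, hbd, hbd'⟩, ⟨hcn, hcd, hcd'⟩, ⟨hnd, hnd'⟩,
    hdd', -⟩ := hd
  change k (.work b) = [] at hb
  change k (.work c) = [] at hc
  change k (.work d) = [] at hd0
  change k (.work d') = [] at hd'
  change k .query = [] at hq
  change k .output = [] at ho
  change e .query = 0 at hqf
  change e .output = 0 at hof
  change e .answer = (k .answer).length at haf
  change ∃ m' n', n' ≤ 26 * (k (.work a)).length + 19 * (k (.work n)).length + 50 ∧ _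
  set w := k (.work a) with hw
  set l := k (.work n) with hl
  have e1 : (⟨update (update k (.work a) w) (.work b) [], update e .query 0⟩ : Store) = ⟨k, e⟩ := by
    simp only [Store.mk.injEq]
    constructor
    · funext t
      simp only [update_apply]
      split_ifs <;> simp_all
    · rw [← hqf, update_eq_self]
  have e2 : (⟨update (update (update (update k (.work a) []) (.work b) w.reverse) .query [])
      (.work c) [], update e .query w.length⟩ : Store) =
      ⟨update (update k (.work a) []) (.work b) w.reverse, update e .query w.length⟩ := by
    simp only [Store.mk.injEq, and_true]
    funext t
    simp only [update_apply]
    split_ifs <;> simp_all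
  have e4 : (⟨update (update (update (update k (.work a) []) .query []) (.work c) w)
      .answer (φ w), update (update e .query w.length) .answer (φ w).length⟩ : Store) =
      ⟨update (update (update k (.work a) []) (.work c) w)
      .answer (φ w), update (update e .query w.length) .answer (φ w).length⟩ := by
    simp only [Store.mk.injEq, and_true]
    funext t
    simp only [update_apply]
    split_ifs <;> simp_all
  have e5 : (⟨update (update (update k (.work a) []) (.work c) [])
      .answer (φ w), update (update e .query 0) .answer (φ w).length⟩ : Store) =
      ⟨update (update (update (update k (.work a) []) (.work n) l)
      (.work d) []) .answer (φ w), update e .answer (φ w).length⟩ := by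
    simp only [Store.mk.injEq]
    constructor
    · funext t
      simp only [update_apply]
      split_ifs <;> simp_all
    · rw [← hqf, update_eq_self]
  have e6 : (⟨update (update (update (update (update k (.work a) []) (.work n) [])
      (.work d) ((φ w).take l.length).reverse) .answer ((φ w).drop l.length)) (.work d') [],
      update e .answer (φ w).length⟩ : Store) =
      ⟨update (update (update (update k (.work a) []) (.work n) [])
      (.work d) ((φ w).take l.length).reverse) .answer ((φ w).drop l.length),
      update e .answer (φ w).length⟩ := by
    simp only [Store.mk.injEq, and_true]
    funext t
    simp only [update_apply]
    split_ifs <;> simp_all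
  have h1 := ExecLe.loop_fold (φ := φ) (t := .work a)
    (P := .cond (.work a) fun o =>
      .seq (.push (.work b) (o.getD .zero)) (.seq (.pop (.work a)) (.pop .query)))
    (fun u (v : Str × ℤ) => ⟨update (update k (.work a) u) (.work b) v.1, update e .query v.2⟩)
    (fun x v => (x :: v.1, v.2 + 1)) 7 (fun u v => by simp [hab])
    (fun x u v => by
      refine ExecLe.cond' (x := x) (s := u) (T := 6) (by simp [hab]) ?_
      refine (ExecLe.push' _ _ x rfl).seq ((ExecLe.pop' (x := x) (s := u) _ _ ?_ rfl).seq
        (ExecLe.right' _ _ ?_ ?_))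
      · simp [hab]
      · simp [hq]
      · simp only [Store.mk.injEq]
        constructor
        · funext t
          simp only [update_apply]
          split_ifs <;> simp_all
        · simp) w ([], 0)
  have h2 := ExecLe.loop_fold (φ := φ) (t := .work b)
    (P := .cond (.work b) fun o =>
      .seq (.push .query (o.getD .zero)) (.seq (.push (.work c) (o.getD .zero)) (.pop (.work b))))
    (fun u (v : Str) => ⟨update (update (update (update k (.work a) []) (.work b) u) .query v)
      (.work c) v, update e .query w.length⟩)
    (fun x v => x :: v) 8 (fun u v => by simp [hbc])
    (fun x u v => by
      refine ExecLe.cond' (x := x) (s := u) (T := 7) (by simp [hbc]) ?_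
      refine (ExecLe.push' _ _ x rfl).seq ((ExecLe.push' _ _ x rfl).seq
        (ExecLe.pop' (x := x) (s := u) _ _ ?_ ?_))
      · simp [hbc]
      · simp only [Store.mk.injEq]
        constructor
        · funext t
          simp only [update_apply]
          split_ifs <;> simp_all
        · simp) w.reverse []
  have h3 : ExecLe φ .ask ⟨update (update (update (update k (.work a) []) (.work b) []) .query w)
      (.work c) w, update e .query w.length⟩
      ⟨update (update (update (update k (.work a) []) .query w) (.work c) w) .answer (φ w),
      update (update e .query w.length) .answer (φ w).length⟩ 3 := by
    have := Exec.ask (φ := φ) ⟨update (update (update (update k (.work a) []) (.work b) []) .query w)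
      (.work c) w, update e .query w.length⟩ (by simp) (by simp [haf])
    refine ⟨3, le_rfl, (cast ?_ this : Exec _ _ _ _ _)⟩
    congr 2
    · funext t
      simp only [update_apply]
      split_ifs <;> simp_all
    · simp
  have h4 := ExecLe.loop_fold (φ := φ) (t := .query) (P := .pop .query)
    (fun u (v : Unit) => ⟨update (update (update (update k (.work a) []) .query u) (.work c) w)
      .answer (φ w), update (update e .query w.length) .answer (φ w).length⟩)
    (fun x v => v) 1 (fun u v => by simp)
    (fun x u v => ExecLe.pop' (x := x) (s := u) _ _ (by simp) (by
      simp only [Store.mk.injEq]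
      constructor
      · funext t
        simp only [update_apply]
        split_ifs <;> simp_all
      · simp)) w ()
  have h5 := ExecLe.loop_fold (φ := φ) (t := .work c) (P := .seq (.left .query) (.pop (.work c)))
    (fun u (v : ℤ) => ⟨update (update (update k (.work a) []) (.work c) u)
      .answer (φ w), update (update e .query v) .answer (φ w).length⟩)
    (fun x v => v - 1) 3 (fun u v => by simp)
    (fun x u v => (ExecLe.left' _ _ (by simp [hq]) rfl).seq
      (ExecLe.pop' (x := x) (s := u) _ _ (by simp) (by
      simp only [Store.mk.injEq]
      constructor
      · funext t
        simp only [update_apply]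
        split_ifs <;> simp_all
      · funext t
        simp only [update_apply]
        split_ifs <;> simp_all))) w w.length
  have h6 := ExecLe.loop_fold (φ := φ) (t := .work n) (P := .seq (.pop (.work n))
    (.cond .answer fun o => match o with
    | some x => .seq (.push (.work d) x) (.pop .answer)
    | none => .skip))
    (fun u (v : Str × Str) => ⟨update (update (update (update k (.work a) []) (.work n) u)
      (.work d) v.1) .answer v.2, update e .answer (φ w).length⟩)
    (fun x v => match v with
      | (d, []) => (d, [])
      | (d, x :: a) => (x :: d, a)) 7 (fun u v => by simp [hnd])
    (fun x u v => by
      refine ExecLe.seq (T := 1) (T' := 5) (ExecLe.pop' (x := x) (s := u) _ _ (by simp [hnd]) rfl)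
        (ExecLe.cond (T := 4) ?_)
      obtain ⟨v, _ | ⟨y, v'⟩⟩ := v
      · simp only [update_apply, reduceCtorEq, if_false, if_true, List.head?_nil]
        refine ExecLe.skip' _ ?_ (by omega)
        simp only [Store.mk.injEq, and_true]
        funext t
        simp only [update_apply]
        split_ifs <;> simp_all
      · simp only [update_apply, reduceCtorEq, if_false, if_true, List.head?_cons]
        refine (ExecLe.push' _ _ y rfl).seq (ExecLe.pop' (x := y) (s := v') _ _ (by simp) ?_)
        simp only [Store.mk.injEq]
        constructor
        · funext t
          simp only [update_apply]
          split_ifs <;> simp_all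
        · trivial) l ([], φ w)
  have h7 := ExecLe.loop_fold (φ := φ) (t := .work d) (P := .cond (.work d) fun o =>
    .seq (.push .answer (o.getD .zero)) (.seq (.push (.work d') (o.getD .zero)) (.pop (.work d))))
    (fun u (v : Str × Str) => ⟨update (update (update (update (update k (.work a) []) (.work n) [])
      (.work d) u) .answer v.1) (.work d') v.2, update e .answer (φ w).length⟩)
    (fun x v => (x :: v.1, x :: v.2)) 8 (fun u v => by simp [hdd'])
    (fun x u v => by
      refine ExecLe.cond' (x := x) (s := u) (T := 7) (by simp [hdd']) ?_
      refine (ExecLe.push' _ _ x rfl).seq ((ExecLe.push' _ _ x rfl).seq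
        (ExecLe.pop' (x := x) (s := u) _ _ ?_ ?_))
      · simp [hdd']
      · simp only [Store.mk.injEq]
        constructor
        · funext t
          simp only [update_apply]
          split_ifs <;> simp_all
        · simp) ((φ w).take l.length).reverse ((φ w).drop l.length, [])
  rw [foldl_shift, List.append_nil, zero_add] at h1
  rw [foldl_cons_eq, List.reverse_reverse, List.append_nil, List.length_reverse] at h2
  rw [foldl_unshift, sub_self] at h5
  rw [foldl_read, List.append_nil] at h6
  rw [foldl_restore, List.reverse_reverse, List.append_nil, List.take_append_drop] at h7
  have hlen : ((φ w).take l.length).reverse.length ≤ l.length := by simp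
  rw [e1] at h1
  rw [e2] at h2
  rw [e4] at h4
  rw [e5] at h5
  rw [e6] at h7
  obtain ⟨N, hN, hex⟩ := h1.seq (h2.seq (h3.seq (h4.seq (h5.seq (h6.seq h7)))))
  refine ⟨_, N, by omega, hex, ?_, ?_⟩
  all_goals clear hex h1 h2 h3 h4 h5 h6 h7 e1 e2 e4 e5 e6
  · simp [Store.Ready, hq, ho, hof, hqf]
  · funext i
    simp only [Store.work, update_apply, TapeName.work.injEq, reduceCtorEq, if_false]
    split_ifs <;> simp_all

/-! ### Functions computable in polynomial time relative to an oracle -/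

open Polynomial

/-- The programs `P args out base` compute the function `f` of the contents of the registers
`args i`, write the result to the register `out`, and use registers from `base` on as auxiliary
storage. Running time and length of the result are bounded by the polynomial `b` in a bound on the
lengths of the arguments. -/
structure Implements (f : Baire → (ℕ → Str) → Str) (b : ℕ[X]) (w : ℕ)
    (P : (ℕ → ℕ) → ℕ → ℕ → Prog) : Prop where
  below : ∀ args out base, (∀ i, args i < base ∧ args i ≠ out) → out < base →
    (P args out base).Below (base + w)
  run : ∀ args out base, (∀ i, args i < base ∧ args i ≠ out) → out < base →
    ∀ φ s B, s out = [] → (∀ r ≥ base, s r = []) → (∀ i, (s (args i)).length ≤ B) →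
    Run φ (P args out base) s (Function.update s out (f φ fun i => s (args i))) (b.eval B)
  size : ∀ φ ρ B, (∀ i, (ρ i).length ≤ B) → (f φ ρ).length ≤ b.eval B

/-- Functions of string registers that are computable in polynomial time, uniformly in the oracle. -/
def PT (f : Baire → (ℕ → Str) → Str) : Prop := ∃ b w P, Implements f b w P

theorem PT.congr {f g : Baire → (ℕ → Str) → Str} (hf : PT f) (h : ∀ φ ρ, g φ ρ = f φ ρ) :
    PT g := by
  have : g = f := funext fun φ => funext fun ρ => h φ ρ
  exact this ▸ hf

theorem PT.var (i : ℕ) : PT fun _ ρ => ρ i := by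
  refine ⟨15 * X + 3, 1, fun args out base => .copy (args i) out base, ⟨?_, ?_, ?_⟩⟩
  · intro args out base ha ho
    have := (ha i).1
    simp [Prog.copy, Prog.transfer, Prog.spread, Prog.Below, TapeName.Below]
    omega
  · intro args out base ha ho φ s B hs hr hB
    have := (ha i).1
    refine (Run.copy s (ha i).2 (by omega) (by omega) hs (hr _ le_rfl)).mono ?_
    have := hB i
    simp
    omega
  · intro φ ρ B hB
    have := hB i
    simp
    omega

theorem PT.nil : PT fun _ _ => [] := by
  refine ⟨1, 0, fun _ _ _ => .skip, ⟨fun _ _ _ _ _ => trivial, ?_, by simp⟩⟩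
  intro args out base ha ho φ s B hs hr hB
  have h : Function.update s out [] = s := by rw [← hs, Function.update_eq_self]
  rw [h]
  exact (Run.skip s).mono (by simp)

theorem PT.cons {f : Baire → (ℕ → Str) → Str} (x : Letter) (hf : PT f) :
    PT fun φ ρ => x :: f φ ρ := by
  obtain ⟨b, w, P, h⟩ := hf
  refine ⟨b + 3, w, fun args out base => .seq (P args out base) (.push (.work out) x),
    ⟨?_, ?_, ?_⟩⟩
  · intro args out base ha ho
    exact ⟨h.below _ _ _ ha ho, show out < base + w by omega⟩
  · intro args out base ha ho φ s B hs hr hB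
    refine (cast ?_ ((h.run _ _ _ ha ho φ s B hs hr hB).seq (Run.push _ out x)) : Run _ _ _ _ _)
    congr 1
    · simp
    · simp
  · intro φ ρ B hB
    have := h.size φ ρ B hB
    simp
    omega

theorem PT.tail {f : Baire → (ℕ → Str) → Str} (hf : PT f) : PT fun φ ρ => (f φ ρ).tail := by
  obtain ⟨b, w, P, h⟩ := hf
  refine ⟨b + 2, w, fun args out base => .seq (P args out base) (.pop (.work out)),
    ⟨?_, ?_, ?_⟩⟩
  · intro args out base ha ho
    exact ⟨h.below _ _ _ ha ho, show out < base + w by omega⟩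
  · intro args out base ha ho φ s B hs hr hB
    refine (cast ?_ ((h.run _ _ _ ha ho φ s B hs hr hB).seq (Run.pop _ out)) : Run _ _ _ _ _)
    congr 1
    · simp
    · simp
  · intro φ ρ B hB
    have := h.size φ ρ B hB
    simp
    omega

theorem PT.rename {f : Baire → (ℕ → Str) → Str} (hf : PT f) (σ : ℕ → ℕ) :
    PT fun φ ρ => f φ fun i => ρ (σ i) := by
  obtain ⟨b, w, P, h⟩ := hf
  refine ⟨b, w, fun args out base => P (fun i => args (σ i)) out base, ⟨?_, ?_, ?_⟩⟩
  · exact fun args out base ha ho => h.below _ _ _ (fun i => ha _) ho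
  · exact fun args out base ha ho φ s B hs hr hB =>
      h.run _ _ _ (fun i => ha _) ho φ s B hs hr fun i => hB _
  · exact fun φ ρ B hB => h.size φ _ B fun i => hB _

/-- Add a value in front of an environment. -/
def consEnv {α : Type} (x : α) (ρ : ℕ → α) : ℕ → α
  | 0 => x
  | i + 1 => ρ i

theorem PT.subst {f g : Baire → (ℕ → Str) → Str} (hf : PT f) (hg : PT g) :
    PT fun φ ρ => f φ (consEnv (g φ ρ) ρ) := by
  obtain ⟨b, w, P, h⟩ := hf
  obtain ⟨b', w', P', h'⟩ := hg
  refine ⟨b' + b.comp (X + b') + 2 * b' + 3, w + w' + 1, fun args out base =>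
    .seq (P' args base (base + 1)) (.seq (P (consEnv base args) out (base + 1)) (.clear base)),
    ⟨?_, ?_, ?_⟩⟩
  · intro args out base ha ho
    refine ⟨(h'.below _ _ _ (fun i => ⟨by have := (ha i).1; omega, by have := (ha i).1; omega⟩)
      (by omega)).mono (by omega), (h.below _ _ _ ?_ (by omega)).mono (by omega), ?_⟩
    · rintro (_ | i)
      · exact ⟨by simp [consEnv], by simp [consEnv]; omega⟩
      · exact ⟨by have := (ha i).1; simp [consEnv]; omega, (ha i).2⟩
    · simp [Prog.clear, Prog.Below, TapeName.Below]
  · intro args out base ha ho φ s B hs hr hB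
    have hlen := h'.size φ (fun i => s (args i)) B hB
    have h1 := h'.run args base (base + 1)
      (fun i => ⟨by have := (ha i).1; omega, by have := (ha i).1; omega⟩)
      (by omega) φ s B (hr _ le_rfl) (fun r h => hr r (by omega)) hB
    set v := g φ fun i => s (args i) with hv
    have hρ : (fun i => Function.update s base v (consEnv base args i))
        = consEnv v fun i => s (args i) := by
      funext i
      cases i with
      | zero => simp [consEnv]
      | succ i => simp [consEnv, (ha i).1.ne]
    have h2 := h.run (consEnv base args) out (base + 1)
      (by
        rintro (_ | i)
        · exact ⟨by simp [consEnv], by simp [consEnv]; omega⟩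
        · exact ⟨by have := (ha i).1; simp [consEnv]; omega, (ha i).2⟩)
      (by omega) φ (Function.update s base v) (B + b'.eval B)
      (by rw [Function.update_of_ne (by omega), hs])
      (fun r h => by rw [Function.update_of_ne (by omega), hr r (by omega)])
      (fun i => by
        rw [show Function.update s base v (consEnv base args i) = _ from congrFun hρ i]
        cases i with
        | zero => simp only [consEnv]; omega
        | succ i => simp only [consEnv]; have := hB i; omega)
    rw [hρ] at h2
    have h3 := Run.clear (φ := φ) (Function.update (Function.update s base v) out
      (f φ (consEnv v fun i => s (args i)))) base
    have h4 := h1.seq (h2.seq h3)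
    refine (cast ?_ (h4.mono (T' := (b' + b.comp (X + b') + 2 * b' + 3).eval B) ?_) :
      Run _ _ _ _ _)
    · congr 1
      funext i
      have := hr base le_rfl
      simp only [Function.update_apply]
      split_ifs <;> first | rfl | (exfalso; omega) | simp_all
    · rw [Function.update_of_ne (by omega), Function.update_self]
      simp
      omega
  · intro φ ρ B hB
    have hlen := h'.size φ ρ B hB
    have := h.size φ (consEnv (g φ ρ) ρ) (B + b'.eval B) (by
      rintro (_ | i)
      · simp only [consEnv]; omega
      · simp only [consEnv]; have := hB i; omega)
    simp
    omega

/-- Case distinction on the first letter of register `0`. -/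
theorem PT.case {G : Option Letter → Baire → (ℕ → Str) → Str} (hG : ∀ o, PT (G o)) :
    PT fun φ ρ => G (ρ 0).head? φ ρ := by
  choose b w P h using hG
  have hb : ∀ o n, (b o).eval n ≤ (∑ o, b o).eval n := by
    intro o n
    rw [eval_finsetSum]
    exact Finset.single_le_sum (f := fun o => (b o).eval n) (fun _ _ => Nat.zero_le _)
      (Finset.mem_univ o)
  refine ⟨∑ o, b o + 1, ∑ o, w o, fun args out base =>
    .cond (.work (args 0)) fun o => P o args out base, ⟨?_, ?_, ?_⟩⟩
  · intro args out base ha ho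
    refine ⟨by have := (ha 0).1; simp [TapeName.Below]; omega, fun o => ?_⟩
    refine ((h o).below _ _ _ ha ho).mono ?_
    have := Finset.single_le_sum (f := w) (fun _ _ => Nat.zero_le _) (Finset.mem_univ o)
    omega
  · intro args out base ha ho φ s B hs hr hB
    refine (Run.cond ((h _).run _ _ _ ha ho φ s B hs hr hB)).mono ?_
    have := hb (s (args 0)).head? B
    simp only [eval_add, eval_one]
    omega
  · intro φ ρ B hB
    have h1 := (h (ρ 0).head?).size φ ρ B hB
    have := hb (ρ 0).head? B
    simp only [eval_add, eval_one]
    omega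

/-- A call of the oracle on register `0`, of whose result as many letters are read as register `1`
has letters. -/
theorem PT.oracle : PT fun φ ρ => (φ (ρ 0)).take (ρ 1).length := by
  refine ⟨100 * X + 100, 6, fun args out base =>
    .seq (.copy (args 0) base (base + 1)) (.seq (.copy (args 1) (base + 3) (base + 1))
      (.call base (base + 1) (base + 2) (base + 3) (base + 4) out)), ⟨?_, ?_, ?_⟩⟩
  · intro args out base ha ho
    have h0 := (ha 0).1
    have h1 := (ha 1).1
    simp [Prog.copy, Prog.transfer, Prog.spread, Prog.Below, TapeName.Below, Prog.call]
    refine ⟨by omega, by omega, ?_, by omega⟩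
    rintro (_ | _) <;> simp [Prog.Below, TapeName.Below]
  · intro args out base ha ho φ s B hs hr hB
    have h0 := (ha 0).1
    have h1 := (ha 1).1
    have k1 := Run.copy (φ := φ) s (r := args 0) (r' := base) (tmp := base + 1) (by omega)
      (by omega) (by omega) (hr _ (by omega)) (hr _ (by omega))
    have k2 := Run.copy (φ := φ) (Function.update s base (s (args 0))) (r := args 1)
      (r' := base + 3) (tmp := base + 1) (by omega) (by omega) (by omega)
      (by rw [Function.update_of_ne (by omega)]; exact hr _ (by omega))
      (by rw [Function.update_of_ne (by omega)]; exact hr _ (by omega))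
    rw [Function.update_of_ne (show args 1 ≠ base by omega)] at k2
    set s2 := Function.update (Function.update s base (s (args 0))) (base + 3) (s (args 1)) with hs2
    have hs2' : ∀ r, r ≠ base → r ≠ base + 3 → s2 r = s r := by
      intro r h h'
      rw [hs2, Function.update_of_ne h', Function.update_of_ne h]
    have k3 := Run.call (φ := φ) (s := s2) (a := base) (b := base + 1) (c := base + 2)
      (n := base + 3) (d := base + 4) (d' := out)
      (by simp; omega)
      (by rw [hs2' _ (by omega) (by omega)]; exact hr _ (by omega))
      (by rw [hs2' _ (by omega) (by omega)]; exact hr _ (by omega))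
      (by rw [hs2' _ (by omega) (by omega)]; exact hr _ (by omega))
      (by rw [hs2' _ (by omega) (by omega)]; exact hs)
    have e1 : s2 base = s (args 0) := by
      rw [hs2, Function.update_of_ne (by omega), Function.update_self]
    have e2 : s2 (base + 3) = s (args 1) := by
      rw [hs2, Function.update_self]
    rw [e1, e2] at k3
    have := hB 0
    have := hB 1
    refine (cast ?_ ((k1.seq (k2.seq k3)).mono (T' := (100 * X + 100 : ℕ[X]).eval B) ?_) :
      Run _ _ _ _ _)
    · congr 1
      funext i
      have := hr base le_rfl
      have := hr (base + 3) (by omega)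
      simp only [Function.update_apply, hs2]
      split_ifs <;> first | rfl | simp_all
    · simp
      omega
  · intro φ ρ B hB
    have := hB 1
    simp
    omega

/-! ### Bounded iteration -/

/-- One step of an iteration: the first `k` registers are simultaneously replaced by the values of
the functions `F i`. -/
def stepEnv (k : ℕ) (F : ℕ → Baire → (ℕ → Str) → Str) (φ : Baire) (E : ℕ → Str) : ℕ → Str :=
  fun i => if i < k then F i φ E else E i

/-- The environment `ρ` with the values of the functions `I i`, `i < k`, in front. -/
def initEnv (k : ℕ) (I : ℕ → Baire → (ℕ → Str) → Str) (φ : Baire) (ρ : ℕ → Str) : ℕ → Str :=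
  fun i => if i < k then I i φ ρ else ρ (i - k)

theorem iterate_stepEnv_of_le (k : ℕ) (F : ℕ → Baire → (ℕ → Str) → Str) (φ : Baire)
    (E : ℕ → Str) (n : ℕ) {i : ℕ} (hi : k ≤ i) : (stepEnv k F φ)^[n] E i = E i := by
  induction n generalizing E with
  | zero => rfl
  | succ n ih =>
    rw [Function.iterate_succ_apply, ih, stepEnv, if_neg (by omega)]

/-- The layout of the registers during an iteration: the accumulators `E i`, the temporary values
`V i` and the counter `c`. -/
def iterStore (s : ℕ → Str) (base k : ℕ) (E V : ℕ → Str) (c : Str) : ℕ → Str := fun r =>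
  if r < base then s r
  else if r < base + k then E (r - base)
  else if r < base + 2 * k then V (r - (base + k))
  else if r = base + 2 * k then c
  else []

section iterStore

variable {s : ℕ → Str} {base k : ℕ} {E V : ℕ → Str} {c : Str}

theorem iterStore_lt {r : ℕ} (h : r < base) : iterStore s base k E V c r = s r := if_pos h

theorem iterStore_acc {i : ℕ} (h : i < k) : iterStore s base k E V c (base + i) = E i := by
  rw [iterStore, if_neg (by omega), if_pos (by omega), Nat.add_sub_cancel_left]

theorem iterStore_tmp {i : ℕ} (h : i < k) : iterStore s base k E V c (base + k + i) = V i := by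
  rw [iterStore, if_neg (by omega), if_neg (by omega), if_pos (by omega), Nat.add_sub_cancel_left]

theorem iterStore_counter : iterStore s base k E V c (base + 2 * k) = c := by
  rw [iterStore, if_neg (by omega), if_neg (by omega), if_neg (by omega), if_pos rfl]

theorem iterStore_gt {r : ℕ} (h : base + 2 * k < r) : iterStore s base k E V c r = [] := by
  rw [iterStore, if_neg (by omega), if_neg (by omega), if_neg (by omega), if_neg (by omega)]

theorem iterStore_nil (hr : ∀ r ≥ base, s r = []) :
    iterStore s base k (fun _ => []) (fun _ => []) [] = s := by
  funext r
  by_cases h : r < base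
  · exact iterStore_lt h
  · rw [hr r (by omega), iterStore, if_neg h]
    split_ifs <;> rfl

theorem iterStore_congr {E' V' : ℕ → Str} (hE : ∀ i < k, E i = E' i) (hV : ∀ i < k, V i = V' i) :
    iterStore s base k E V c = iterStore s base k E' V' c := by
  funext r
  unfold iterStore
  split_ifs
  · rfl
  · exact hE _ (by omega)
  · exact hV _ (by omega)
  · rfl
  · rfl

theorem update_iterStore_acc {i : ℕ} (h : i < k) (v : Str) :
    Function.update (iterStore s base k E V c) (base + i) v
      = iterStore s base k (Function.update E i v) V c := by
  funext r
  by_cases hr : r = base + i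
  · subst hr
    rw [Function.update_self, iterStore_acc h, Function.update_self]
  · rw [Function.update_of_ne hr]
    unfold iterStore
    split_ifs
    · rfl
    · rw [Function.update_of_ne (by omega)]
    · rfl
    · rfl
    · rfl

theorem update_iterStore_tmp {i : ℕ} (h : i < k) (v : Str) :
    Function.update (iterStore s base k E V c) (base + k + i) v
      = iterStore s base k E (Function.update V i v) c := by
  funext r
  by_cases hr : r = base + k + i
  · subst hr
    rw [Function.update_self, iterStore_tmp h, Function.update_self]
  · rw [Function.update_of_ne hr]
    unfold iterStore
    split_ifs
    · rfl
    · rfl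
    · rw [Function.update_of_ne (by omega)]
    · rfl
    · rfl

theorem update_iterStore_counter (v : Str) :
    Function.update (iterStore s base k E V c) (base + 2 * k) v = iterStore s base k E V v := by
  funext r
  by_cases hr : r = base + 2 * k
  · subst hr
    rw [Function.update_self, iterStore_counter]
  · rw [Function.update_of_ne hr]
    unfold iterStore
    split_ifs <;> rfl

theorem update_iterStore_lt {r : ℕ} (h : r < base) (v : Str) :
    Function.update (iterStore s base k E V c) r v
      = iterStore (Function.update s r v) base k E V c := by
  funext i
  by_cases hi : i = r
  · subst hi
    rw [Function.update_self, iterStore_lt h, Function.update_self]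
  · rw [Function.update_of_ne hi]
    unfold iterStore
    split_ifs
    · rw [Function.update_of_ne hi]
    all_goals rfl

end iterStore

/-- Move a stack to another register, whose content is erased. -/
def Prog.move (r r' tmp : ℕ) : Prog :=
  .seq (.clear r') (.seq (.transfer r tmp) (.transfer tmp r'))

theorem Run.move {φ : Baire} (s : ℕ → Str) {r r' tmp : ℕ} (h : r ≠ r') (h1 : r ≠ tmp)
    (h2 : r' ≠ tmp) (h4 : s tmp = []) :
    Run φ (Prog.move r r' tmp) s (Function.update (Function.update s r' (s r)) r [])
      (12 * (s r).length + 2 * (s r').length + 5) := by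
  have k1 := Run.clear (φ := φ) s r'
  have k2 := Run.transfer (φ := φ) (Function.update s r' []) h1
  have k3 := Run.transfer (φ := φ) (Function.update (Function.update (Function.update s r' []) r [])
    tmp (((Function.update s r' []) r).reverse ++ (Function.update s r' []) tmp)) h2.symm
  refine (cast ?_ ((k1.seq (k2.seq k3)).mono
    (T' := 12 * (s r).length + 2 * (s r').length + 5) ?_) : Run _ _ _ _ _)
  · congr 1
    funext i
    simp only [Function.update_apply]
    split_ifs <;> simp_all
  · simp [h, h2.symm, h4]
    omega

/-- Bounded iteration with `k` accumulators whose lengths are polynomially bounded. -/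
theorem PT.iter (k : ℕ) (hk : 0 < k) {F I : ℕ → Baire → (ℕ → Str) → Str}
    {l : Baire → (ℕ → Str) → Str} (hF : ∀ i, PT (F i)) (hI : ∀ i, PT (I i)) (hl : PT l)
    (q : ℕ[X]) (hq : ∀ φ ρ B, (∀ i, (ρ i).length ≤ B) → ∀ n ≤ (l φ ρ).length, ∀ i < k,
      ((stepEnv k F φ)^[n] (initEnv k I φ ρ) i).length ≤ q.eval B) :
    PT fun φ ρ => (stepEnv k F φ)^[(l φ ρ).length] (initEnv k I φ ρ) 0 := by
  choose bF wF PF hF using hF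
  choose bI wI PI hI using hI
  obtain ⟨bl, wl, Pl, hl⟩ := hl
  have hsum : ∀ (b : ℕ → ℕ[X]) i n, i < k → (b i).eval n ≤ (∑ i ∈ Finset.range k, b i).eval n := by
    intro b i n hi
    rw [eval_finsetSum]
    exact Finset.single_le_sum (f := fun o => (b o).eval n) (fun _ _ => Nat.zero_le _)
      (Finset.mem_range.2 hi)
  have hwsum : ∀ (b : ℕ → ℕ) i, i < k → b i ≤ ∑ i ∈ Finset.range k, b i := fun b i hi =>
    Finset.single_le_sum (f := b) (fun _ _ => Nat.zero_le _) (Finset.mem_range.2 hi)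
  set sF := ∑ i ∈ Finset.range k, bF i with hsF
  set sI := ∑ i ∈ Finset.range k, bI i with hsI
  set tF := sF.comp (X + q) with htF
  let argsF : (ℕ → ℕ) → ℕ → ℕ → ℕ := fun args base i => if i < k then base + i else args (i - k)
  let body : (ℕ → ℕ) → ℕ → Prog := fun args base =>
    .seq (.pop (.work (base + 2 * k)))
      (.seq (.seqN (fun i => PF i (argsF args base) (base + k + i) (base + 2 * k + 1)) k)
        (.seqN (fun i => .move (base + k + i) (base + i) (base + 2 * k + 1)) k))
  let c : ℕ[X] := 1 + ((k : ℕ[X]) * (tF + 1) + 1 + ((k : ℕ[X]) * (14 * q + 5 + 1) + 1) + 1) + 1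
  refine ⟨bl + ((k : ℕ[X]) * (sI + 1) + 1) + ((c + 1) * bl + 1) + (15 * q + 3)
      + ((k : ℕ[X]) * (2 * q + 1 + 1) + 1) + 4 + q,
    wl + ∑ i ∈ Finset.range k, wI i + ∑ i ∈ Finset.range k, wF i + 2 * k + 2,
    fun args out base =>
    .seq (Pl args (base + 2 * k) (base + 2 * k + 1)) <|
    .seq (.seqN (fun i => PI i args (base + i) (base + 2 * k + 1)) k) <|
    .seq (.loop (.work (base + 2 * k)) (body args base)) <|
    .seq (.copy base out (base + 2 * k + 1)) (.seqN (fun i => .clear (base + i)) k), ?_, ?_, ?_⟩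
  · intro args out base ha ho
    have hargs : ∀ i, args i < base := fun i => (ha i).1
    have hargsF : ∀ j i, argsF args base i < base + 2 * k + 1 ∧
        argsF args base i ≠ base + k + j := by
      intro j i
      have := hargs (i - k)
      simp only [argsF]
      split_ifs <;> constructor <;> omega
    refine ⟨(hl.below _ _ _ (fun i => ⟨?_, ?_⟩) (by omega)).mono (by omega),
      Prog.Below.seqN fun j hj => ((hI j).below _ _ _ (fun i => ⟨?_, ?_⟩) (by omega)).mono ?_,
      ⟨?_, ?_, Prog.Below.seqN fun j hj => ((hF j).below _ _ _ (hargsF j) (by omega)).mono ?_,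
        Prog.Below.seqN fun j hj => ?_⟩, ?_, Prog.Below.seqN fun j hj => ?_⟩
    · have := hargs i; omega
    · have := hargs i; omega
    · have := hargs i; omega
    · have := hargs i; omega
    · have := hwsum wI j hj; omega
    · show _ < _; omega
    · show _ < _; omega
    · have := hwsum wF j hj; omega
    · simp [Prog.move, Prog.clear, Prog.transfer, Prog.spread, Prog.Below, TapeName.Below]
      omega
    · simp [Prog.copy, Prog.transfer, Prog.spread, Prog.Below, TapeName.Below]
      omega
    · simp [Prog.clear, Prog.Below, TapeName.Below]
      omega
  · intro args out base ha ho φ s B hs hr hB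
    have hargs : ∀ i, args i < base := fun i => (ha i).1
    set ρ : ℕ → Str := fun i => s (args i) with hρ
    have hqB := hq φ ρ B hB
    have hlB := hl.size φ ρ B hB
    set L := l φ ρ with hL
    set E₀ := initEnv k I φ ρ with hE₀
    have hE₀k : ∀ i, k ≤ i → E₀ i = ρ (i - k) := fun i hi => by
      rw [hE₀, initEnv, if_neg (by omega)]
    -- the counter
    have r1 := hl.run args (base + 2 * k) (base + 2 * k + 1)
      (fun i => ⟨by have := hargs i; omega, by have := hargs i; omega⟩) (by omega) φ s B
      (hr _ (by omega)) (fun r h => hr r (by omega)) hB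
    have e1 : Function.update s (base + 2 * k) L
        = iterStore s base k (fun i => if i < 0 then E₀ i else []) (fun _ => []) L := by
      have h1 : Function.update (iterStore s base k (fun _ => []) (fun _ => []) []) (base + 2 * k) L
        = _ := update_iterStore_counter L
      rw [iterStore_nil hr] at h1
      rw [h1]
      exact iterStore_congr (fun i _ => by simp) (fun _ _ => rfl)
    -- the initial values
    have r2 := Run.seqN (φ := φ) (n := k) (T := sI.eval B)
      (P := fun i => PI i args (base + i) (base + 2 * k + 1))
      (S := fun j => iterStore s base k (fun i => if i < j then E₀ i else []) (fun _ => []) L)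
      (by
        intro j hj
        have h := (hI j).run args (base + j) (base + 2 * k + 1)
          (fun i => ⟨by have := hargs i; omega, by have := hargs i; omega⟩) (by omega) φ
          (iterStore s base k (fun i => if i < j then E₀ i else []) (fun _ => []) L) B
          (by rw [iterStore_acc hj]; simp)
          (fun r h => iterStore_gt (by omega))
          (fun i => by rw [iterStore_lt (hargs i)]; exact hB i)
        rw [update_iterStore_acc hj] at h
        refine (cast ?_ (h.mono (hsum bI j B hj)) : Run _ _ _ _ _)
        congr 1
        refine iterStore_congr (fun i hi => ?_) (fun _ _ => rfl)
        by_cases hij : i = j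
        · subst hij
          rw [Function.update_self, if_pos (by omega), hE₀, initEnv, if_pos hi]
          congr 1
          funext i
          exact iterStore_lt (hargs i)
        · rw [Function.update_of_ne hij]
          by_cases h2 : i < j
          · rw [if_pos h2, if_pos (by omega)]
          · rw [if_neg h2, if_neg (by omega)])
    have e2 : iterStore s base k (fun i => if i < k then E₀ i else []) (fun _ => []) L
        = iterStore s base k E₀ (fun _ => []) L :=
      iterStore_congr (fun i hi => if_pos hi) (fun _ _ => rfl)
    -- one step
    have hbody : ∀ (x : Letter) (u : Str) (n : ℕ), n + (u.length + 1) = L.length →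
        Run φ (body args base)
          (iterStore s base k ((stepEnv k F φ)^[n] E₀) (fun _ => []) (x :: u))
          (iterStore s base k ((stepEnv k F φ)^[n + 1] E₀) (fun _ => []) u) (c.eval B) := by
      intro x u n hn
      set E := (stepEnv k F φ)^[n] E₀ with hE
      have hEk : ∀ i, k ≤ i → E i = ρ (i - k) := fun i hi => by
        rw [hE, iterate_stepEnv_of_le k F φ _ _ hi, hE₀k i hi]
      have hEB : ∀ i < k, (E i).length ≤ q.eval B := fun i hi => hqB n (by omega) i hi
      have hE'B : ∀ i < k, (stepEnv k F φ E i).length ≤ q.eval B := fun i hi => by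
        have := hqB (n + 1) (by omega) i hi
        rwa [Function.iterate_succ_apply'] at this
      have b1 := Run.pop (φ := φ) (iterStore s base k E (fun _ => []) (x :: u)) (base + 2 * k)
      rw [iterStore_counter, update_iterStore_counter, List.tail_cons] at b1
      have b2 := Run.seqN (φ := φ) (n := k) (T := tF.eval B)
        (P := fun i => PF i (argsF args base) (base + k + i) (base + 2 * k + 1))
        (S := fun j => iterStore s base k E (fun i => if i < j then stepEnv k F φ E i else []) u)
        (by
          intro j hj
          have henv : (fun i => iterStore s base k E
              (fun i => if i < j then stepEnv k F φ E i else []) u (argsF args base i)) = E := by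
            funext i
            simp only [argsF]
            by_cases hi : i < k
            · rw [if_pos hi, iterStore_acc hi]
            · rw [if_neg hi, iterStore_lt (hargs _), hEk i (by omega)]
          have h := (hF j).run (argsF args base) (base + k + j) (base + 2 * k + 1)
            (by
              intro i
              have := hargs (i - k)
              simp only [argsF]
              split_ifs <;> constructor <;> omega) (by omega) φ
            (iterStore s base k E (fun i => if i < j then stepEnv k F φ E i else []) u)
            (B + q.eval B)
            (by rw [iterStore_tmp hj]; simp)
            (fun r h => iterStore_gt (by omega))
            (fun i => by
              rw [congrFun henv i]
              by_cases hi : i < k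
              · have := hEB i hi; omega
              · rw [hEk i (by omega)]
                have := hB (i - k)
                simp only [hρ]
                omega)
          rw [update_iterStore_tmp hj, henv] at h
          refine (cast ?_ (h.mono (T' := tF.eval B) ?_) : Run _ _ _ _ _)
          · congr 1
            refine iterStore_congr (fun _ _ => rfl) (fun i hi => ?_)
            by_cases hij : i = j
            · subst hij
              rw [Function.update_self, if_pos (by omega), stepEnv, if_pos hi]
            · rw [Function.update_of_ne hij]
              by_cases h2 : i < j
              · rw [if_pos h2, if_pos (by omega)]
              · rw [if_neg h2, if_neg (by omega)]
          · have := hsum bF j (B + q.eval B) hj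
            rw [htF]
            simpa using this)
      have b3 := Run.seqN (φ := φ) (n := k) (T := (14 * q + 5).eval B)
        (P := fun i => .move (base + k + i) (base + i) (base + 2 * k + 1))
        (S := fun j => iterStore s base k (fun i => if i < j then stepEnv k F φ E i else E i)
          (fun i => if i < j then [] else stepEnv k F φ E i) u)
        (by
          intro j hj
          have h := Run.move (φ := φ) (iterStore s base k
            (fun i => if i < j then stepEnv k F φ E i else E i)
            (fun i => if i < j then [] else stepEnv k F φ E i) u)
            (r := base + k + j) (r' := base + j) (tmp := base + 2 * k + 1) (by omega) (by omega)
            (by omega) (iterStore_gt (by omega))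
          rw [iterStore_tmp hj, iterStore_acc hj, update_iterStore_acc hj,
            update_iterStore_tmp hj, if_neg (lt_irrefl j), if_neg (lt_irrefl j)] at h
          refine (cast ?_ (h.mono (T' := (14 * q + 5).eval B) ?_) : Run _ _ _ _ _)
          · congr 1
            refine iterStore_congr (fun i hi => ?_) (fun i hi => ?_)
            · by_cases hij : i = j
              · subst hij
                rw [Function.update_self, if_pos (by omega)]
              · rw [Function.update_of_ne hij]
                by_cases h2 : i < j
                · rw [if_pos h2, if_pos (by omega)]
                · rw [if_neg h2, if_neg (by omega)]
            · by_cases hij : i = j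
              · subst hij
                rw [Function.update_self, if_pos (by omega)]
              · rw [Function.update_of_ne hij]
                by_cases h2 : i < j
                · rw [if_pos h2, if_pos (by omega)]
                · rw [if_neg h2, if_neg (by omega)]
          · have := hEB j hj
            have := hE'B j hj
            simp
            omega)
      have e2 : iterStore s base k E (fun _ => []) u
          = iterStore s base k E (fun i => if i < 0 then stepEnv k F φ E i else []) u :=
        iterStore_congr (fun _ _ => rfl) (fun i _ => by simp)
      have e3 : iterStore s base k E (fun i => if i < k then stepEnv k F φ E i else []) u
          = iterStore s base k (fun i => if i < 0 then stepEnv k F φ E i else E i)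
            (fun i => if i < 0 then [] else stepEnv k F φ E i) u :=
        iterStore_congr (fun i _ => by simp) (fun i hi => by simp [hi])
      have e4 : iterStore s base k (fun i => if i < k then stepEnv k F φ E i else E i)
          (fun i => if i < k then [] else stepEnv k F φ E i) u
          = iterStore s base k ((stepEnv k F φ)^[n + 1] E₀) (fun _ => []) u := by
        refine iterStore_congr (fun i hi => ?_) (fun i hi => if_pos hi)
        rw [if_pos hi, Function.iterate_succ_apply']
      beta_reduce at b2 b3
      rw [← e2, e3] at b2
      rw [e4] at b3
      refine (b1.seq (b2.seq b3)).mono ?_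
      simp [c]
    -- the loop
    have r3 := Run.loop_fold (φ := φ) (r := base + 2 * k) (P := body args base)
      (fun u E => iterStore s base k E (fun _ => []) u) (fun _ E => stepEnv k F φ E)
      (fun u E => ∃ n, n + u.length = L.length ∧ E = (stepEnv k F φ)^[n] E₀) (c.eval B)
      (fun u E => iterStore_counter)
      (by
        rintro x u _ ⟨n, hn, rfl⟩
        rw [List.length_cons] at hn
        refine ⟨?_, n + 1, by omega, ?_⟩
        · have := hbody x u n hn
          rwa [Function.iterate_succ_apply'] at this
        · rw [Function.iterate_succ_apply'])
      L E₀ ⟨0, by simp, rfl⟩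
    rw [List.foldl_const] at r3
    set E := (stepEnv k F φ)^[L.length] E₀ with hE
    have hEB : ∀ i < k, (E i).length ≤ q.eval B := fun i hi => hqB _ le_rfl i hi
    -- the result
    have r4 := Run.copy (φ := φ) (iterStore s base k E (fun _ => []) []) (r := base) (r' := out)
      (tmp := base + 2 * k + 1) (by omega) (by omega) (by omega)
      (by rw [iterStore_lt ho]; exact hs) (iterStore_gt (by omega))
    have hb0 : iterStore s base k E (fun _ => []) [] base = E 0 := by
      have := iterStore_acc (s := s) (base := base) (E := E) (V := fun _ => []) (c := []) hk
      rwa [add_zero] at this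
    rw [hb0, update_iterStore_lt ho] at r4
    have r5 := Run.seqN (φ := φ) (n := k) (T := (2 * q + 1).eval B)
      (P := fun i => .clear (base + i))
      (S := fun j => iterStore (Function.update s out (E 0)) base k
        (fun i => if i < j then [] else E i) (fun _ => []) [])
      (by
        intro j hj
        have h := Run.clear (φ := φ) (iterStore (Function.update s out (E 0)) base k
          (fun i => if i < j then [] else E i) (fun _ => []) []) (base + j)
        rw [iterStore_acc hj, update_iterStore_acc hj, if_neg (lt_irrefl j)] at h
        refine (cast ?_ (h.mono (T' := (2 * q + 1).eval B) ?_) : Run _ _ _ _ _)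
        · congr 1
          refine iterStore_congr (fun i hi => ?_) (fun _ _ => rfl)
          by_cases hij : i = j
          · subst hij
            rw [Function.update_self, if_pos (by omega)]
          · rw [Function.update_of_ne hij]
            by_cases h2 : i < j
            · rw [if_pos h2, if_pos (by omega)]
            · rw [if_neg h2, if_neg (by omega)]
        · have := hEB j hj
          simp
          omega)
    have e5 : iterStore (Function.update s out (E 0)) base k E (fun _ => []) []
        = iterStore (Function.update s out (E 0)) base k
          (fun i => if i < 0 then [] else E i) (fun _ => []) [] :=
      iterStore_congr (fun i _ => by simp) (fun _ _ => rfl)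
    have e6 : iterStore (Function.update s out (E 0)) base k
        (fun i => if i < k then [] else E i) (fun _ => []) [] = Function.update s out (E 0) := by
      rw [iterStore_congr (E' := fun _ => []) (fun i hi => if_pos hi) (fun _ _ => rfl)]
      exact iterStore_nil fun r h => by rw [Function.update_of_ne (by omega), hr r h]
    beta_reduce at r2 r3 r5
    rw [e1] at r1
    rw [e2] at r2
    rw [e5] at r4
    rw [e6] at r5
    refine (r1.seq (r2.seq (r3.seq (r4.seq r5)))).mono ?_
    have h0 := hEB 0 hk
    have hcL : (c.eval B + 1) * L.length ≤ (c.eval B + 1) * bl.eval B := Nat.mul_le_mul_left _ hlB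
    simp only [eval_add, eval_mul, eval_natCast, eval_one, eval_ofNat, Nat.cast_id]
    omega
  · intro φ ρ B hB
    have := hq φ ρ B hB _ le_rfl 0 hk
    simp only [eval_add]
    omega

set_option maxHeartbeats 400000 in
open Function in
/-- Functions in `PT` are computed by oracle machines in polynomial time. -/
theorem PT.exists_machine {F : Baire → Str → Str} (h : PT fun φ ρ => F φ (ρ 0)) :
    ∃ (M : OracleMachine) (p : ℕ[X]), (∀ φ a, M.time φ a ≤ ((p.eval a.length : ℕ) : ℕ∞)) ∧
      ∀ φ, F φ ∈ M.operator φ := by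
  obtain ⟨b, w, P, hP⟩ := h
  let args : ℕ → ℕ := fun i => if i = 0 then 0 else 1
  have hargs : ∀ i, args i < 3 ∧ args i ≠ 2 := by
    intro i
    simp only [args]
    split_ifs <;> omega
  let prog : Prog := .seq (.spread .input [.work 3]) <| .seq (.transfer 3 0) <|
    .seq (P args 2 3) <|
    .seq (.loop (.work 2) (.cond (.work 2) fun o =>
      .seq (.push (.work 3) (o.getD .zero)) (.seq (.pop (.work 2)) (.pop .output))))
    (.loop (.work 3) (.cond (.work 3) fun o =>
      .seq (.push .output (o.getD .zero)) (.pop (.work 3))))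
  let p : ℕ[X] := 12 * X + 15 * b + 20
  suffices h : ∃ M : OracleMachine, (∀ φ a, M.time φ a ≤ ((p.eval a.length : ℕ) : ℕ∞)) ∧
      ∀ φ, F φ ∈ M.operator φ by
    obtain ⟨M, hM⟩ := h
    exact ⟨M, p, hM⟩
  refine IntervalComplexity.exists_machine (p := prog) (T := fun n => p.eval n) ?_ (4 + w) ?_
  · intro φ a
    have h1 := ExecLe.loop_fold (φ := φ) (t := .input)
      (P := .cond .input fun o => .seq (.push (.work 3) (o.getD .zero)) (.pop .input))
      (fun u (v : Str) => ⟨update (update (fun _ => []) .input u) (.work 3) v,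
        fun t => if t = .input then a.length else 0⟩)
      (fun x v => x :: v) 5 (fun u v => by simp)
      (fun x u v => by
        refine ExecLe.cond' (x := x) (s := u) (T := 4) (by simp) ?_
        refine (ExecLe.push' _ _ x rfl).seq (ExecLe.pop' (x := x) (s := u) _ _ (by simp) ?_)
        simp only [Store.mk.injEq, and_true]
        funext t
        simp only [update_apply]
        split_ifs <;> simp_all) a []
    rw [foldl_cons_eq, List.append_nil] at h1
    have e1 : (⟨update (update (fun _ => []) .input a) (.work 3) [],
        fun t => if t = .input then a.length else 0⟩ : Store) =
        ⟨fun t => if t = .input then a else [], fun t => if t = .input then a.length else 0⟩ := by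
      simp only [Store.mk.injEq, and_true]
      funext t
      simp only [update_apply]
      split_ifs <;> simp_all
    rw [e1] at h1
    set m₁ : Store := ⟨update (update (fun _ => []) .input []) (.work 3) a.reverse,
        fun t => if t = .input then a.length else 0⟩ with hm₁
    have hr1 : m₁.Ready := by simp [m₁, Store.Ready]
    have hw1 : m₁.work = update (fun _ => []) 3 a.reverse := by
      funext i
      simp [m₁, Store.work, update_apply]
    have h2 := Run.transfer (φ := φ) (update (fun _ => []) 3 a.reverse) (r := 3) (r' := 0)
      (by omega)
    simp only [update_self, List.reverse_reverse, update_idem, List.length_reverse] at h2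
    rw [update_of_ne (by omega), List.append_nil] at h2
    have h3 := hP.run args 2 3 hargs (by omega) φ
      (update (update (fun _ => []) 3 []) 0 a) a.length (by simp)
      (fun r hr => by simp [update_apply]; omega)
      (fun i => by
        simp only [args]
        split_ifs <;> simp)
    have hF := hP.size φ (fun i => update (update (fun _ => []) 3 []) 0 a (args i)) a.length
      (fun i => by
        simp only [args]
        split_ifs <;> simp)
    have hzero : update (update (fun _ => ([] : Str)) 3 []) 0 a (args 0) = a := by simp [args]
    beta_reduce at h3 hF
    rw [hzero] at h3 hF
    set v := F φ a with hv
    obtain ⟨⟨k, e⟩, n₂, hn₂, hex₂, ⟨hq, hqf, ho, hof, haf⟩, hw₂⟩ := (h2.seq h3) m₁ hr1 hw1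
    have k2 : k (.work 2) = v := by
      have := congrFun hw₂ 2
      rwa [update_self] at this
    have k3 : k (.work 3) = [] := by
      have : k (.work 3) = _ := congrFun hw₂ 3
      rw [this]
      simp
    change k .output = [] at ho
    change e .output = 0 at hof
    have h4 := ExecLe.loop_fold (φ := φ) (t := .work 2)
      (P := .cond (.work 2) fun o =>
        .seq (.push (.work 3) (o.getD .zero)) (.seq (.pop (.work 2)) (.pop .output)))
      (fun u (v : Str × ℤ) => ⟨update (update k (.work 2) u) (.work 3) v.1, update e .output v.2⟩)
      (fun x v => (x :: v.1, v.2 + 1)) 7 (fun u v => by simp)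
      (fun x u v => by
        refine ExecLe.cond' (x := x) (s := u) (T := 6) (by simp) ?_
        refine (ExecLe.push' _ _ x rfl).seq ((ExecLe.pop' (x := x) (s := u) _ _ ?_ rfl).seq
          (ExecLe.right' _ _ ?_ ?_))
        · simp
        · simp [ho]
        · simp only [Store.mk.injEq]
          constructor
          · funext t
            simp only [update_apply]
            split_ifs <;> simp_all
          · simp) v ([], 0)
    have h5 := ExecLe.loop_fold (φ := φ) (t := .work 3)
      (P := .cond (.work 3) fun o => .seq (.push .output (o.getD .zero)) (.pop (.work 3)))
      (fun u (o : Str) => ⟨update (update (update k (.work 2) []) (.work 3) u) .output o,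
        update e .output v.length⟩)
      (fun x o => x :: o) 5 (fun u v => by simp)
      (fun x u o => by
        refine ExecLe.cond' (x := x) (s := u) (T := 4) (by simp) ?_
        refine (ExecLe.push' _ _ x rfl).seq (ExecLe.pop' (x := x) (s := u) _ _ (by simp) ?_)
        simp only [Store.mk.injEq, and_true]
        funext t
        simp only [update_apply]
        split_ifs <;> simp_all) v.reverse []
    rw [foldl_shift, List.append_nil, zero_add] at h4
    rw [foldl_cons_eq, List.reverse_reverse, List.append_nil, List.length_reverse] at h5
    have e4 : (⟨update (update k (.work 2) v) (.work 3) [], update e .output 0⟩ : Store)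
        = ⟨k, e⟩ := by
      rw [← hof, update_eq_self, ← k2, update_eq_self, ← k3, update_eq_self]
    have e5 : (⟨update (update (update k (.work 2) []) (.work 3) v.reverse) .output [],
        update e .output v.length⟩ : Store) =
        ⟨update (update k (.work 2) []) (.work 3) v.reverse, update e .output v.length⟩ := by
      simp only [Store.mk.injEq, and_true]
      rw [← ho]
      funext t
      simp only [update_apply]
      split_ifs <;> simp_all
    rw [e4] at h4
    rw [e5] at h5
    have h6 := h4.seq h5
    cases hex₂ with
    | seq hx hy =>
      obtain ⟨N, hN, hex⟩ := h1.seq (ExecLe.seq ⟨_, le_rfl, hx⟩ (ExecLe.seq ⟨_, le_rfl, hy⟩ h6))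
      refine ⟨_, N, ?_, hex, by simp, by simp⟩
      simp only [p, eval_add, eval_mul, eval_ofNat, eval_X]
      omega
  · refine ⟨?_, ?_, (hP.below args 2 3 hargs (by omega)).mono (by omega), ?_, ?_⟩
    · simp [Prog.spread, Prog.Below, TapeName.Below]
      omega
    · simp [Prog.transfer, Prog.spread, Prog.Below, TapeName.Below]
      omega
    · simp [Prog.Below, TapeName.Below]
      omega
    · simp [Prog.Below, TapeName.Below]
      omega

/-! ### Composition and iteration of functions computable in polynomial time -/

theorem PT.app1 {h : Baire → Str → Str} {f : Baire → (ℕ → Str) → Str}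
    (hh : PT fun φ ρ => h φ (ρ 0)) (hf : PT f) : PT fun φ ρ => h φ (f φ ρ) :=
  hh.subst hf

theorem PT.app2 {h : Baire → Str → Str → Str} {f g : Baire → (ℕ → Str) → Str}
    (hh : PT fun φ ρ => h φ (ρ 0) (ρ 1)) (hf : PT f) (hg : PT g) :
    PT fun φ ρ => h φ (f φ ρ) (g φ ρ) :=
  (hh.subst (hf.rename Nat.succ)).subst hg

theorem PT.app3 {h : Baire → Str → Str → Str → Str} {f g k : Baire → (ℕ → Str) → Str}
    (hh : PT fun φ ρ => h φ (ρ 0) (ρ 1) (ρ 2)) (hf : PT f) (hg : PT g) (hk : PT k) :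
    PT fun φ ρ => h φ (f φ ρ) (g φ ρ) (k φ ρ) :=
  ((hh.subst (hf.rename fun i => i + 2)).subst (hg.rename Nat.succ)).subst hk

theorem PT.caseOf {G : Option Letter → Baire → (ℕ → Str) → Str} {f : Baire → (ℕ → Str) → Str}
    (hf : PT f) (hG : ∀ o, PT (G o)) : PT fun φ ρ => G (f φ ρ).head? φ ρ :=
  (PT.case (G := fun o φ ρ => G o φ fun i => ρ (i + 1)) fun o => (hG o).rename Nat.succ).subst hf

theorem PT.ite {p : Option Letter → Prop} [DecidablePred p] {f g h : Baire → (ℕ → Str) → Str}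
    (hf : PT f) (hg : PT g) (hh : PT h) :
    PT fun φ ρ => if p (f φ ρ).head? then g φ ρ else h φ ρ :=
  PT.caseOf (G := fun o φ ρ => if p o then g φ ρ else h φ ρ) hf fun o => by
    by_cases hp : p o
    · simpa only [if_pos hp] using hg
    · simpa only [if_neg hp] using hh

theorem PT.const (s : Str) : PT fun _ _ => s := by
  induction s with
  | nil => exact PT.nil
  | cons x s ih => exact ih.cons x

/-- Four strings. -/
abbrev Quad := Str × Str × Str × Str

/-- The largest of the lengths of four strings. -/
def Quad.size (x : Quad) : ℕ :=
  max (max x.1.length x.2.1.length) (max x.2.2.1.length x.2.2.2.length)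

/-- The first four registers. -/
def quadOf (ρ : ℕ → Str) : Quad := (ρ 0, ρ 1, ρ 2, ρ 3)

/-- Iteration of a function of four strings whose lengths grow by at most a constant. -/
theorem PT.iterQuad {S : Quad → Quad} (h1 : PT fun _ ρ => (S (quadOf ρ)).1)
    (h2 : PT fun _ ρ => (S (quadOf ρ)).2.1) (h3 : PT fun _ ρ => (S (quadOf ρ)).2.2.1)
    (h4 : PT fun _ ρ => (S (quadOf ρ)).2.2.2) (c : ℕ) (hS : ∀ x, (S x).size ≤ x.size + c)
    {i1 i2 i3 i4 l : Baire → (ℕ → Str) → Str} (hi1 : PT i1) (hi2 : PT i2) (hi3 : PT i3)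
    (hi4 : PT i4) (hl : PT l) :
    PT fun φ ρ => (S^[(l φ ρ).length] (i1 φ ρ, i2 φ ρ, i3 φ ρ, i4 φ ρ)).1 := by
  let F : ℕ → Baire → (ℕ → Str) → Str := fun i => match i with
    | 0 => fun _ ρ => (S (quadOf ρ)).1
    | 1 => fun _ ρ => (S (quadOf ρ)).2.1
    | 2 => fun _ ρ => (S (quadOf ρ)).2.2.1
    | _ => fun _ ρ => (S (quadOf ρ)).2.2.2
  let I : ℕ → Baire → (ℕ → Str) → Str := fun i => match i with
    | 0 => i1
    | 1 => i2
    | 2 => i3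
    | _ => i4
  have hF : ∀ i, PT (F i) := by
    rintro (_ | _ | _ | i)
    · exact h1
    · exact h2
    · exact h3
    · exact h4
  have hI : ∀ i, PT (I i) := by
    rintro (_ | _ | _ | i)
    · exact hi1
    · exact hi2
    · exact hi3
    · exact hi4
  have hstep : ∀ φ (E : ℕ → Str), quadOf (stepEnv 4 F φ E) = S (quadOf E) := fun φ E => rfl
  have hiter : ∀ φ (E : ℕ → Str) n, quadOf ((stepEnv 4 F φ)^[n] E) = S^[n] (quadOf E) := by
    intro φ E n
    induction n generalizing E with
    | zero => rfl
    | succ n ih => rw [Function.iterate_succ_apply, ih, hstep, Function.iterate_succ_apply]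
  have hinit : ∀ φ ρ, quadOf (initEnv 4 I φ ρ) = (i1 φ ρ, i2 φ ρ, i3 φ ρ, i4 φ ρ) := fun φ ρ => rfl
  have hsize : ∀ x n, (S^[n] x).size ≤ x.size + n * c := by
    intro x n
    induction n with
    | zero => simp
    | succ n ih =>
      rw [Function.iterate_succ_apply']
      have := hS (S^[n] x)
      rw [Nat.succ_mul]
      omega
  have hle : ∀ (E : ℕ → Str) i, i < 4 → (E i).length ≤ (quadOf E).size := by
    intro E i hi
    simp only [quadOf, Quad.size]
    interval_cases i <;> simp
  obtain ⟨b1, w1, P1, k1⟩ := hi1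
  obtain ⟨b2, w2, P2, k2⟩ := hi2
  obtain ⟨b3, w3, P3, k3⟩ := hi3
  obtain ⟨b4, w4, P4, k4⟩ := hi4
  obtain ⟨bl, wl, Pl, kl⟩ := id hl
  refine (PT.iter 4 (by norm_num) hF hI hl (b1 + b2 + b3 + b4 + bl * (c : ℕ[X])) ?_).congr ?_
  · intro φ ρ B hB n hn i hi
    refine (hle _ i hi).trans ?_
    rw [hiter, hinit]
    refine (hsize _ _).trans ?_
    have := k1.size φ ρ B hB
    have := k2.size φ ρ B hB
    have := k3.size φ ρ B hB
    have := k4.size φ ρ B hB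
    have h5 : n * c ≤ bl.eval B * c := Nat.mul_le_mul_right _ (hn.trans (kl.size φ ρ B hB))
    simp only [eval_add, eval_mul, eval_natCast, Quad.size, Nat.cast_id]
    omega
  · intro φ ρ
    have := congrArg Prod.fst (hiter φ (initEnv 4 I φ ρ) (l φ ρ).length)
    rw [hinit] at this
    exact this.symm

/-! ### Lists -/

theorem PT.revAppend {f g : Baire → (ℕ → Str) → Str} (hf : PT f) (hg : PT g) :
    PT fun φ ρ => (f φ ρ).reverse ++ g φ ρ := by
  refine PT.app2 (h := fun _ a b => a.reverse ++ b) ?_ hf hg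
  refine (PT.iterQuad (S := fun x => (match x.2.1.head? with
    | some y => y :: x.1
    | none => x.1, x.2.1.tail, [], [])) (PT.caseOf (G := fun o _ ρ => match o with
    | some y => y :: ρ 0
    | none => ρ 0) (PT.var 1) fun o => ?_) (PT.var 1).tail PT.nil
    PT.nil 1 ?_ (PT.var 1) (PT.var 0) PT.nil PT.nil (PT.var 0)).congr ?_
  · cases o with
    | none => exact PT.var 0
    | some y => exact (PT.var 0).cons y
  · rintro ⟨a, _ | ⟨y, b⟩, c, d⟩ <;> simp [Quad.size] <;> omega
  · intro φ ρ
    have key : ∀ a b : Str, ((fun x : Quad => ((match x.2.1.head? with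
        | some y => y :: x.1
        | none => x.1, x.2.1.tail, [], []) : Quad))^[a.length] (b, a, [], [])).1
        = a.reverse ++ b := by
      intro a
      induction a with
      | nil => intro b; rfl
      | cons y a ih => intro b; simp [ih]
    exact (key _ _).symm

theorem PT.reverse {f : Baire → (ℕ → Str) → Str} (hf : PT f) : PT fun φ ρ => (f φ ρ).reverse :=
  (hf.revAppend PT.nil).congr fun _ _ => by simp

theorem PT.append {f g : Baire → (ℕ → Str) → Str} (hf : PT f) (hg : PT g) :
    PT fun φ ρ => f φ ρ ++ g φ ρ :=
  (hf.reverse.revAppend hg).congr fun _ _ => by simp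

theorem PT.drop {f g : Baire → (ℕ → Str) → Str} (hf : PT f) (hg : PT g) :
    PT fun φ ρ => (g φ ρ).drop (f φ ρ).length := by
  refine PT.app2 (h := fun _ a b => b.drop a.length) ?_ hf hg
  refine (PT.iterQuad (S := fun x => (x.1.tail, [], [], [])) (PT.var 0).tail PT.nil PT.nil
    PT.nil 0 ?_ (PT.var 1) PT.nil PT.nil PT.nil (PT.var 0)).congr ?_
  · rintro ⟨a, b, c, d⟩
    simp [Quad.size]
  · intro φ ρ
    have key : ∀ n (b : Str), ((fun x : Quad => ((x.1.tail, [], [], []) : Quad))^[n]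
        (b, [], [], [])).1 = b.drop n := by
      intro n
      induction n with
      | zero => intro b; rfl
      | succ n ih => intro b; rw [Function.iterate_succ_apply, ih]; simp
    exact (key _ _).symm

/-- The first `n` letters of a string, padded by zeros. -/
def padTake (n : ℕ) (s : Str) : Str := (List.range n).map fun i => s.getD i .zero

theorem padTake_zero (s : Str) : padTake 0 s = [] := rfl

theorem padTake_succ (n : ℕ) (s : Str) : padTake (n + 1) s = s.head?.getD .zero :: padTake n s.tail := by
  rw [padTake, List.range_succ_eq_map, List.map_cons, List.map_map]
  congr 1
  · cases s <;> rfl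
  · rw [padTake]
    apply List.map_congr_left
    intro i _
    cases s <;> simp

theorem length_padTake (n : ℕ) (s : Str) : (padTake n s).length = n := by simp [padTake]

theorem PT.padTake {f g : Baire → (ℕ → Str) → Str} (hf : PT f) (hg : PT g) :
    PT fun φ ρ => padTake (f φ ρ).length (g φ ρ) := by
  refine PT.app2 (h := fun _ a b => IntervalComplexity.padTake a.length b) ?_ hf hg
  refine (PT.iterQuad (S := fun x => (x.2.1.head?.getD .zero :: x.1, x.2.1.tail, [], []))
    (PT.caseOf (G := fun o _ ρ => o.getD .zero :: ρ 0) (PT.var 1) fun o => (PT.var 0).cons _)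
    (PT.var 1).tail PT.nil PT.nil 1 ?_
    PT.nil (PT.var 1) PT.nil PT.nil (PT.var 0)).reverse.congr ?_
  · rintro ⟨a, b, c, d⟩
    simp [Quad.size]
    omega
  · intro φ ρ
    have key : ∀ n (b o : Str), ((fun x : Quad =>
        ((x.2.1.head?.getD .zero :: x.1, x.2.1.tail, [], []) : Quad))^[n]
        (o, b, [], [])).1 = (IntervalComplexity.padTake n b).reverse ++ o := by
      intro n
      induction n with
      | zero => intro b o; rfl
      | succ n ih => intro b o; rw [Function.iterate_succ_apply, ih, padTake_succ]; simp
    rw [key]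
    simp

theorem PT.takeWhile (p : Letter → Bool) {f : Baire → (ℕ → Str) → Str} (hf : PT f) :
    PT fun φ ρ => (f φ ρ).takeWhile p := by
  refine PT.app1 (h := fun _ a => a.takeWhile p) ?_ hf
  refine (PT.iterQuad (S := fun x => (match x.2.1.head? with
    | some y => if p y then y :: x.1 else x.1
    | none => x.1, match x.2.1.head? with
    | some y => if p y then x.2.1.tail else []
    | none => [], [], []))
    (PT.caseOf (G := fun o _ ρ => match o with
    | some y => if p y then y :: ρ 0 else ρ 0
    | none => ρ 0) (PT.var 1) fun o => ?_)
    (PT.caseOf (G := fun o _ ρ => match o with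
    | some y => if p y then (ρ 1).tail else []
    | none => []) (PT.var 1) fun o => ?_)
    PT.nil PT.nil 1 ?_ PT.nil (PT.var 0) PT.nil PT.nil (PT.var 0)).reverse.congr ?_
  · cases o with
    | none => exact PT.var 0
    | some y =>
      by_cases h : p y
      · simpa only [if_pos h] using (PT.var 0).cons y
      · simpa only [if_neg h] using PT.var 0
  · cases o with
    | none => exact PT.nil
    | some y =>
      by_cases h : p y
      · simpa only [if_pos h] using (PT.var 1).tail
      · simpa only [if_neg h] using PT.nil
  · rintro ⟨a, _ | ⟨y, b⟩, c, d⟩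
    · simp [Quad.size]
      try omega
    · by_cases h : p y <;> simp [Quad.size, h] <;> omega
  · intro φ ρ
    have hfinished : ∀ n (o : Str), ((fun x : Quad => ((match x.2.1.head? with
        | some y => if p y then y :: x.1 else x.1
        | none => x.1, match x.2.1.head? with
        | some y => if p y then x.2.1.tail else []
        | none => [], [], []) : Quad))^[n] (o, [], [], [])).1 = o := by
      intro n
      induction n with
      | zero => intro o; rfl
      | succ n ih => intro o; rw [Function.iterate_succ_apply]; exact ih o
    have key : ∀ a o : Str, ((fun x : Quad => ((match x.2.1.head? with
        | some y => if p y then y :: x.1 else x.1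
        | none => x.1, match x.2.1.head? with
        | some y => if p y then x.2.1.tail else []
        | none => [], [], []) : Quad))^[a.length] (o, a, [], [])).1
        = (a.takeWhile p).reverse ++ o := by
      intro a
      induction a with
      | nil => intro o; rfl
      | cons y a ih =>
        intro o
        rw [List.length_cons, Function.iterate_succ_apply]
        by_cases h : p y
        · simp only [List.head?_cons, if_pos h, List.tail_cons]
          rw [ih]
          simp [h]
        · simp only [List.head?_cons, if_neg h]
          rw [hfinished]
          simp [h]
    rw [key]
    simp

theorem PT.dropWhile (p : Letter → Bool) {f : Baire → (ℕ → Str) → Str} (hf : PT f) :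
    PT fun φ ρ => (f φ ρ).dropWhile p := by
  refine (PT.drop (hf.takeWhile p) hf).congr fun φ ρ => ?_
  generalize f φ ρ = a
  induction a with
  | nil => rfl
  | cons y a ih =>
    by_cases h : p y
    · simp [h, ih]
    · simp [h]

/-! ### Interleaving -/

/-- One step of the extraction of a column. -/
def colStep (i : ℕ) (x : Quad) : Quad :=
  (match x.2.1.head? with
    | some _ => (x.2.1.drop i).head?.getD .zero :: x.1
    | none => x.1, x.2.1.drop 3, [], [])

/-- The letters of a string in the positions `i`, `i + 3`, `i + 6`, …. -/
def col (i : ℕ) (s : Str) : Str := ((colStep i)^[s.length] ([], s, [], [])).1.reverse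

theorem PT.col (i : ℕ) {f : Baire → (ℕ → Str) → Str} (hf : PT f) :
    PT fun φ ρ => col i (f φ ρ) := by
  refine PT.app1 (h := fun _ a => IntervalComplexity.col i a) ?_ hf
  have hdrop : ∀ n, PT fun _ ρ => (ρ 1).drop n := fun n =>
    ((PT.const (List.replicate n .zero)).drop (PT.var 1)).congr fun φ ρ => by simp
  refine (PT.iterQuad (S := colStep i) (PT.caseOf (G := fun o _ ρ => match o with
    | some _ => ((ρ 1).drop i).head?.getD .zero :: ρ 0
    | none => ρ 0) (PT.var 1) fun o => ?_) (hdrop 3)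
    PT.nil PT.nil 1 ?_ PT.nil (PT.var 0) PT.nil PT.nil (PT.var 0)).reverse
  · cases o with
    | none => exact PT.var 0
    | some y =>
      exact PT.caseOf (G := fun o _ ρ => o.getD .zero :: ρ 0) (hdrop i) fun o => (PT.var 0).cons _
  · rintro ⟨a, _ | ⟨y, b⟩, c, d⟩ <;> simp only [Quad.size, colStep, List.head?_nil,
      List.head?_cons, List.length_cons, List.length_drop, List.length_nil] <;> omega

theorem iterate_colStep (i : ℕ) (u : ℕ → Str) (hu : ∀ n, (u n).length = 3) (hi : i < 3)
    (l : List ℕ) (n : ℕ) (hn : l.length ≤ n) (o : Str) :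
    ((colStep i)^[n] (o, l.flatMap u, [], [])).1
      = (l.map fun j => (u j).getD i .zero).reverse ++ o := by
  induction l generalizing n o with
  | nil =>
    induction n with
    | zero => rfl
    | succ n ih => rw [Function.iterate_succ_apply]; exact ih (by simp)
  | cons j l ih =>
    obtain ⟨n, rfl⟩ : ∃ m, n = m + 1 := ⟨n - 1, by simp at hn; omega⟩
    rw [Function.iterate_succ_apply]
    have h3 := hu j
    have hs : colStep i (o, (j :: l).flatMap u, [], [])
        = ((u j).getD i .zero :: o, l.flatMap u, [], []) := by
      obtain ⟨x, y, z, hxyz⟩ := List.length_eq_three.1 h3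
      simp only [colStep, List.flatMap_cons, hxyz]
      interval_cases i <;> simp
    rw [hs, ih n (by simpa using hn)]
    simp

/-- The columns of an interleaved string. -/
theorem col_flatMap (i : ℕ) (u : ℕ → Str) (hu : ∀ n, (u n).length = 3) (hi : i < 3)
    (l : List ℕ) : col i (l.flatMap u) = l.map fun j => (u j).getD i .zero := by
  rw [col, iterate_colStep i u hu hi]
  · simp
  · simp [List.length_flatMap, hu]
    omega

/-- The pairing of two strings of the same length. -/
def interleave (a b : Str) : Str :=
  ((fun x : Quad => ((x.2.2.1.head?.getD .zero :: x.2.1.head?.getD .zero :: .one :: x.1,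
    x.2.1.tail, x.2.2.1.tail, []) : Quad))^[a.length] ([], a, b, [])).1.reverse
    ++ List.replicate 6 .zero

theorem PT.interleave {f g : Baire → (ℕ → Str) → Str} (hf : PT f) (hg : PT g) :
    PT fun φ ρ => interleave (f φ ρ) (g φ ρ) := by
  refine PT.app2 (h := fun _ a b => IntervalComplexity.interleave a b) ?_ hf hg
  refine (PT.iterQuad (S := fun x : Quad =>
    (x.2.2.1.head?.getD .zero :: x.2.1.head?.getD .zero :: .one :: x.1,
    x.2.1.tail, x.2.2.1.tail, [])) ?_ (PT.var 1).tail (PT.var 2).tail PT.nil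
    3 ?_ PT.nil (PT.var 0) (PT.var 1) PT.nil (PT.var 0)).reverse.append (PT.const _)
  · exact PT.caseOf (G := fun o _ ρ => o.getD .zero :: (ρ 1).head?.getD .zero :: .one :: ρ 0)
      (PT.var 2) fun o => (PT.caseOf (G := fun o _ ρ => o.getD .zero :: .one :: ρ 0)
      (PT.var 1) fun o => ((PT.var 0).cons _).cons _).cons _
  · rintro ⟨a, b, c, d⟩
    simp [Quad.size]
    omega

theorem interleave_eq_pairStr {a b : Str} (h : a.length = b.length) :
    interleave a b = pairStr a b := by
  have key : ∀ n (a b o : Str), ((fun x : Quad =>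
      ((x.2.2.1.head?.getD .zero :: x.2.1.head?.getD .zero :: .one :: x.1,
      x.2.1.tail, x.2.2.1.tail, []) : Quad))^[n] (o, a, b, [])).1
      = ((List.range n).flatMap fun i => [.one, a.getD i .zero, b.getD i .zero]).reverse ++ o := by
    intro n
    induction n with
    | zero => intro a b o; rfl
    | succ n ih =>
      intro a b o
      rw [Function.iterate_succ_apply, ih, List.range_succ_eq_map, List.flatMap_cons,
        List.flatMap_map]
      simp only [List.reverse_append, List.append_assoc]
      congr 1
      · congr 2
        funext i
        cases a <;> cases b <;> simp
      · cases a <;> cases b <;> simp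
  have hc : pairCtrl a b = List.replicate a.length .one ++ [.zero, .zero] := by
    simp [pairCtrl, h]
  rw [interleave, key, pairStr, List.append_nil, List.reverse_reverse]
  have hl : max (max a.length b.length) (pairCtrl a b).length = a.length + 2 := by
    rw [hc]; simp [h]
  rw [hl, List.range_succ, List.range_succ, List.flatMap_append, List.flatMap_append,
    List.append_assoc]
  congr 1
  · rw [hc]
    apply List.flatMap_congr
    intro i hi
    rw [List.getD_append _ _ _ _ (by simpa using hi)]
    simp [List.mem_range.1 hi]
  · rw [hc]
    simp [h]

/-! ### Binary numbers -/

theorem bitsVal_nil : bitsVal [] = 0 := rfl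

theorem bitsVal_append (s t : Str) : bitsVal (s ++ t) = bitsVal s * 2 ^ t.length + bitsVal t := by
  induction t using List.reverseRecOn with
  | nil => simp [bitsVal_nil]
  | append_singleton t x ih =>
    have key : ∀ u : Str, bitsVal (u ++ [x]) = 2 * bitsVal u + x.bit := fun u => by
      rw [bitsVal, foldl_bit_append, ← bitsVal]; rfl
    rw [← List.append_assoc, key, ih, key, List.length_append, List.length_singleton, pow_succ]
    ring

theorem bitsVal_singleton (x : Letter) : bitsVal [x] = x.bit := by simp [bitsVal]

theorem bitsVal_cons (x : Letter) (s : Str) :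
    bitsVal (x :: s) = x.bit * 2 ^ s.length + bitsVal s := by
  rw [← List.singleton_append, bitsVal_append, bitsVal_singleton]

theorem Letter.bit_le (x : Letter) : x.bit ≤ 1 := by cases x <;> simp [Letter.bit]

theorem bitsVal_lt (s : Str) : bitsVal s < 2 ^ s.length := by
  induction s with
  | nil => simp [bitsVal_nil]
  | cons x s ih =>
    rw [bitsVal_cons, List.length_cons, pow_succ]
    have := Nat.mul_le_mul_right (2 ^ s.length) x.bit_le
    omega

/-- The first digit of a string, `0` if there is none. -/
def headBit (s : Str) : ℕ := (s.head?.getD .zero).bit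

theorem bitsVal_reverse (s : Str) :
    bitsVal s.reverse = headBit s + 2 * bitsVal s.tail.reverse := by
  cases s with
  | nil => rfl
  | cons x s =>
    rw [List.reverse_cons, bitsVal_append, bitsVal_singleton]
    simp [headBit]
    ring

/-- The digit `0` or `1`. -/
def digit : ℕ → Letter
  | 0 => .zero
  | _ => .one

theorem bit_digit {n : ℕ} (h : n < 2) : (digit n).bit = n := by
  interval_cases n <;> rfl

theorem isBits_nil : IsBits [] := by simp [IsBits]

theorem isBits_cons {x : Letter} {s : Str} : IsBits (x :: s) ↔ x ≠ .point ∧ IsBits s := by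
  simp [IsBits, eq_comm]

theorem digit_ne_point (n : ℕ) : digit n ≠ .point := by
  cases n <;> simp [digit]

/-- One step of a serial computation on two strings of digits: the two current digits and the carry
determine the next digit of the result and the new carry. -/
def serialStep (δ : ℕ → ℕ → ℕ → ℕ × ℕ) (x : Quad) : Quad :=
  (digit (δ (headBit x.2.1) (headBit x.2.2.1) (headBit x.2.2.2)).1 :: x.1, x.2.1.tail, x.2.2.1.tail,
    [digit (δ (headBit x.2.1) (headBit x.2.2.1) (headBit x.2.2.2)).2])

/-- A serial computation on two binary numbers. -/
def serial (δ : ℕ → ℕ → ℕ → ℕ × ℕ) (a b : Str) : Str :=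
  ((serialStep δ)^[max a.length b.length + 1] ([], a.reverse, b.reverse, [])).1

theorem PT.serial (δ : ℕ → ℕ → ℕ → ℕ × ℕ) {f g : Baire → (ℕ → Str) → Str} (hf : PT f)
    (hg : PT g) : PT fun φ ρ => serial δ (f φ ρ) (g φ ρ) := by
  refine PT.app2 (h := fun _ a b => IntervalComplexity.serial δ a b) ?_ hf hg
  have hcase : ∀ (H : ℕ → ℕ → ℕ → Baire → (ℕ → Str) → Str), (∀ x y z, PT (H x y z)) →
      PT fun φ ρ => H (headBit (ρ 1)) (headBit (ρ 2)) (headBit (ρ 3)) φ ρ := fun H hH =>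
    PT.caseOf (G := fun o φ ρ => H (o.getD .zero).bit (headBit (ρ 2)) (headBit (ρ 3)) φ ρ)
      (PT.var 1) fun o => PT.caseOf
      (G := fun o' φ ρ => H (o.getD .zero).bit (o'.getD .zero).bit (headBit (ρ 3)) φ ρ)
      (PT.var 2) fun o' => PT.caseOf
      (G := fun o'' φ ρ => H (o.getD .zero).bit (o'.getD .zero).bit (o''.getD .zero).bit φ ρ)
      (PT.var 3) fun o'' => hH _ _ _
  refine (PT.iterQuad (S := serialStep δ)
    (hcase (fun x y z _ ρ => digit (δ x y z).1 :: ρ 0) fun x y z => (PT.var 0).cons _)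
    (PT.var 1).tail (PT.var 2).tail
    (hcase (fun x y z _ ρ => [digit (δ x y z).2]) fun x y z => PT.nil.cons _) 1 ?_
    PT.nil (PT.var 0).reverse (PT.var 1).reverse PT.nil
    (((PT.var 0).append ((PT.var 0).drop (PT.var 1))).cons .zero)).congr ?_
  · rintro ⟨a, b, c, d⟩
    simp [Quad.size, serialStep]
    omega
  · intro φ ρ
    rw [IntervalComplexity.serial]
    congr 3
    simp
    omega

theorem iterate_serialStep_fst (δ : ℕ → ℕ → ℕ → ℕ × ℕ) (n : ℕ) (x : Quad) :
    ((serialStep δ)^[n] x).1.length = x.1.length + n ∧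
      (IsBits x.1 → IsBits ((serialStep δ)^[n] x).1) := by
  induction n generalizing x with
  | zero => exact ⟨rfl, id⟩
  | succ n ih =>
    rw [Function.iterate_succ_apply]
    refine ⟨(ih _).1.trans ?_, fun h => (ih _).2 (isBits_cons.2 ⟨digit_ne_point _, h⟩)⟩
    simp [serialStep]
    omega

theorem length_serial (δ : ℕ → ℕ → ℕ → ℕ × ℕ) (a b : Str) :
    (serial δ a b).length = max a.length b.length + 1 := by
  rw [serial, (iterate_serialStep_fst δ _ _).1]
  simp

theorem isBits_serial (δ : ℕ → ℕ → ℕ → ℕ × ℕ) (a b : Str) : IsBits (serial δ a b) :=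
  (iterate_serialStep_fst δ _ _).2 isBits_nil

/-- The transition table of addition. -/
def addTable (x y z : ℕ) : ℕ × ℕ := ((x + y + z) % 2, (x + y + z) / 2)

/-- The transition table of subtraction. -/
def subTable (x y z : ℕ) : ℕ × ℕ := ((x + 2 - y - z) % 2, 1 - (x + 2 - y - z) / 2)

theorem headBit_le (s : Str) : headBit s ≤ 1 := Letter.bit_le _

theorem iterate_addStep (n : ℕ) (o a b c : Str) (ha : a.length ≤ n) (hb : b.length ≤ n) :
    bitsVal ((serialStep addTable)^[n + 1] (o, a, b, c)).1
      = bitsVal o + 2 ^ o.length * (bitsVal a.reverse + bitsVal b.reverse + headBit c) := by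
  have hd : ∀ m, headBit [digit m] = (digit m).bit := fun m => rfl
  induction n generalizing o a b c with
  | zero =>
    obtain rfl := List.length_eq_zero_iff.1 (Nat.le_zero.1 ha)
    obtain rfl := List.length_eq_zero_iff.1 (Nat.le_zero.1 hb)
    have h := headBit_le c
    have h0 : headBit [] = 0 := rfl
    simp only [Function.iterate_succ_apply, Function.iterate_zero_apply, serialStep, addTable,
      bitsVal_cons, h0]
    rw [bit_digit (Nat.mod_lt _ (by norm_num)), Nat.mod_eq_of_lt (by omega)]
    simp [bitsVal_nil]
    ring
  | succ n ih =>
    rw [Function.iterate_succ_apply, serialStep, ih _ _ _ _ (by simp; omega) (by simp; omega)]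
    have h1 := headBit_le a
    have h2 := headBit_le b
    have h3 := headBit_le c
    simp only [addTable, hd]
    rw [bitsVal_cons, bit_digit (Nat.mod_lt _ (by norm_num)), bit_digit (by omega),
      bitsVal_reverse a, bitsVal_reverse b, List.length_cons, pow_succ]
    have h4 := Nat.mod_add_div (headBit a + headBit b + headBit c) 2
    generalize (headBit a + headBit b + headBit c) % 2 = u at *
    generalize (headBit a + headBit b + headBit c) / 2 = v at *
    linear_combination 2 ^ o.length * h4

theorem iterate_subStep (n : ℕ) (o a b c : Str) (ha : a.length ≤ n) (hb : b.length ≤ n) :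
    bitsVal ((serialStep subTable)^[n + 1] (o, a, b, c)).1
        + 2 ^ o.length * (bitsVal b.reverse + headBit c)
      = bitsVal o + 2 ^ o.length * bitsVal a.reverse
        + headBit ((serialStep subTable)^[n + 1] (o, a, b, c)).1 * 2 ^ (o.length + n + 1) := by
  have hd : ∀ m, headBit [digit m] = (digit m).bit := fun m => rfl
  induction n generalizing o a b c with
  | zero =>
    obtain rfl := List.length_eq_zero_iff.1 (Nat.le_zero.1 ha)
    obtain rfl := List.length_eq_zero_iff.1 (Nat.le_zero.1 hb)
    have h := headBit_le c
    have h0 : headBit [] = 0 := rfl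
    have h1 : ∀ x s, headBit (x :: s) = x.bit := fun x s => rfl
    simp only [Function.iterate_succ_apply, Function.iterate_zero_apply, serialStep, subTable,
      bitsVal_cons, h0, h1]
    generalize headBit c = z at *
    interval_cases z
    · simp [bitsVal_nil, digit, Letter.bit]
    · simp [bitsVal_nil, digit, Letter.bit]
      ring
  | succ n ih =>
    have ih' := ih (serialStep subTable (o, a, b, c)).1 a.tail b.tail
      (serialStep subTable (o, a, b, c)).2.2.2 (by simp; omega) (by simp; omega)
    rw [Function.iterate_succ_apply]
    have hS : serialStep subTable (o, a, b, c) = ((serialStep subTable (o, a, b, c)).1, a.tail,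
      b.tail, (serialStep subTable (o, a, b, c)).2.2.2) := rfl
    rw [hS]
    generalize ((serialStep subTable)^[n + 1] ((serialStep subTable (o, a, b, c)).1, a.tail,
      b.tail, (serialStep subTable (o, a, b, c)).2.2.2)).1 = r at *
    have h1 := headBit_le a
    have h2 := headBit_le b
    have h3 := headBit_le c
    simp only [serialStep, subTable, hd, bitsVal_cons, List.length_cons] at ih'
    rw [bit_digit (Nat.mod_lt _ (by norm_num)), bit_digit (by omega)] at ih'
    rw [bitsVal_reverse a, bitsVal_reverse b]
    have h4 : (headBit a + 2 - headBit b - headBit c) % 2 + headBit b + headBit c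
      = headBit a + 2 * (1 - (headBit a + 2 - headBit b - headBit c) / 2) := by omega
    generalize (headBit a + 2 - headBit b - headBit c) % 2 = u at *
    generalize 1 - (headBit a + 2 - headBit b - headBit c) / 2 = v at *
    rw [show o.length + (n + 1) + 1 = o.length + 1 + n + 1 by ring]
    rw [pow_succ 2 o.length] at ih'
    zify at *
    linear_combination ih' + 2 ^ o.length * h4

/-- Addition of binary numbers. -/
def addM (a b : Str) : Str := serial addTable a b

theorem bitsVal_addM (a b : Str) : bitsVal (addM a b) = bitsVal a + bitsVal b := by
  rw [addM, serial, iterate_addStep _ _ _ _ _ (by simp) (by simp)]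
  simp [bitsVal_nil, headBit, Letter.bit]

theorem isBits_addM (a b : Str) : IsBits (addM a b) := isBits_serial _ _ _

theorem length_addM (a b : Str) : (addM a b).length = max a.length b.length + 1 :=
  length_serial _ _ _

theorem PT.addM {f g : Baire → (ℕ → Str) → Str} (hf : PT f) (hg : PT g) :
    PT fun φ ρ => addM (f φ ρ) (g φ ρ) := hf.serial _ hg

/-- Truncated subtraction of binary numbers. -/
def subM (a b : Str) : Str :=
  if (serial subTable a b).head? = some .one then [] else serial subTable a b

theorem bitsVal_subM (a b : Str) : bitsVal (subM a b) = bitsVal a - bitsVal b := by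
  have h := iterate_subStep (max a.length b.length) [] a.reverse b.reverse [] (by simp) (by simp)
  rw [← serial] at h
  have h0 : headBit [] = 0 := rfl
  have hl := bitsVal_lt (serial subTable a b)
  rw [length_serial] at hl
  simp only [bitsVal_nil, h0, List.length_nil, List.reverse_reverse, pow_zero, Nat.zero_add,
    Nat.add_zero, Nat.one_mul] at h
  rw [subM]
  split_ifs with hc
  · have : headBit (serial subTable a b) = 1 := by rw [headBit, hc]; rfl
    rw [this] at h
    rw [bitsVal_nil]
    omega
  · have : headBit (serial subTable a b) = 0 := by
      rw [headBit]
      rcases ho : (serial subTable a b).head? with _ | _ | _ | _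
      · rfl
      · rfl
      · exact absurd ho hc
      · rfl
    rw [this] at h
    omega

theorem isBits_subM (a b : Str) : IsBits (subM a b) := by
  rw [subM]
  split_ifs
  · exact isBits_nil
  · exact isBits_serial _ _ _

theorem PT.subM {f g : Baire → (ℕ → Str) → Str} (hf : PT f) (hg : PT g) :
    PT fun φ ρ => subM (f φ ρ) (g φ ρ) :=
  PT.ite (p := fun o => o = some .one) (hf.serial subTable hg) PT.nil (hf.serial subTable hg)

/-- One step of the multiplication of binary numbers. -/
def mulStep (x : Quad) : Quad :=
  (addM (x.1 ++ [.zero]) (if x.2.1.head? = some .one then x.2.2.1 else []), x.2.1.tail, x.2.2.1, [])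

/-- Multiplication of binary numbers. -/
def mulM (a b : Str) : Str := (mulStep^[a.length] ([], a, b, [])).1

theorem PT.mulM {f g : Baire → (ℕ → Str) → Str} (hf : PT f) (hg : PT g) :
    PT fun φ ρ => mulM (f φ ρ) (g φ ρ) := by
  refine PT.app2 (h := fun _ a b => IntervalComplexity.mulM a b) ?_ hf hg
  refine PT.iterQuad (S := mulStep) (((PT.var 0).append (PT.const [.zero])).addM
    (PT.ite (p := fun o => o = some .one) (PT.var 1) (PT.var 2) PT.nil))
    (PT.var 1).tail (PT.var 2) PT.nil 2 ?_ PT.nil (PT.var 0) (PT.var 1) PT.nil (PT.var 0)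
  rintro ⟨a, b, c, d⟩
  simp only [Quad.size, mulStep, length_addM]
  split_ifs <;> simp <;> omega

theorem iterate_mulStep (n : ℕ) (o a b : Str) (ha : a.length = n) :
    bitsVal (mulStep^[n] (o, a, b, [])).1 = bitsVal o * 2 ^ n + bitsVal a * bitsVal b := by
  induction n generalizing o a with
  | zero =>
    obtain rfl := List.length_eq_zero_iff.1 ha
    simp [bitsVal_nil]
  | succ n ih =>
    obtain ⟨x, a, rfl⟩ : ∃ x a', a = x :: a' := by
      cases a with
      | nil => simp at ha
      | cons x a => exact ⟨x, a, rfl⟩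
    have ha' : a.length = n := by simpa using ha
    rw [Function.iterate_succ_apply, mulStep, List.tail_cons, ih _ _ ha', bitsVal_addM,
      bitsVal_append, bitsVal_singleton, bitsVal_cons, ha', pow_succ]
    cases x <;> simp [Letter.bit, bitsVal_nil] <;> ring

theorem bitsVal_mulM (a b : Str) : bitsVal (mulM a b) = bitsVal a * bitsVal b := by
  rw [mulM, iterate_mulStep _ _ _ _ rfl, bitsVal_nil]
  simp

/-! ### Codes of dyadic numbers -/

/-- Remove leading zeros. -/
def strip (s : Str) : Str := s.dropWhile fun x => x = .zero

theorem PT.strip {f : Baire → (ℕ → Str) → Str} (hf : PT f) : PT fun φ ρ => strip (f φ ρ) :=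
  hf.dropWhile _

theorem bitsVal_strip (s : Str) : bitsVal (strip s) = bitsVal s := by
  induction s with
  | nil => rfl
  | cons x s ih =>
    cases x
    · rw [bitsVal_cons, strip, List.dropWhile_cons_of_pos (by simp), ← strip, ih]
      simp [Letter.bit]
    · rfl
    · rfl

theorem IsBits.strip {s : Str} (h : IsBits s) :
    IsBits (strip s) ∧ (strip s = [] ∨ ∃ t, strip s = .one :: t) := by
  induction s with
  | nil => exact ⟨h, Or.inl rfl⟩
  | cons x s ih =>
    obtain ⟨hx, hs⟩ := isBits_cons.1 h
    cases x
    · rw [IntervalComplexity.strip, List.dropWhile_cons_of_pos (by simp)]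
      exact ih hs
    · exact ⟨h, Or.inr ⟨s, rfl⟩⟩
    · exact absurd rfl hx

theorem strip_eq_nil_iff {s : Str} (h : IsBits s) : strip s = [] ↔ bitsVal s = 0 := by
  rw [← bitsVal_strip]
  constructor
  · intro h0
    rw [h0, bitsVal_nil]
  · intro h0
    rcases h.strip.2 with h1 | ⟨t, h1⟩
    · exact h1
    · rw [h1, bitsVal_cons] at h0
      simp [Letter.bit] at h0

theorem bitsVal_reverse_split (n : ℕ) (s : Str) :
    bitsVal s.reverse = bitsVal (padTake n s).reverse + 2 ^ n * bitsVal (s.drop n).reverse := by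
  induction n generalizing s with
  | zero => simp [padTake_zero, bitsVal_nil]
  | succ n ih =>
    rw [bitsVal_reverse s, ih s.tail, padTake_succ, bitsVal_reverse (_ :: _), pow_succ]
    simp [headBit]
    ring

theorem IsBits.padTake {s : Str} (h : IsBits s) (n : ℕ) : IsBits (padTake n s) := by
  induction n generalizing s with
  | zero => exact isBits_nil
  | succ n ih =>
    rw [padTake_succ]
    cases s with
    | nil => exact isBits_cons.2 ⟨by simp, ih h⟩
    | cons x s => exact isBits_cons.2 ⟨(isBits_cons.1 h).1, ih (isBits_cons.1 h).2⟩

theorem IsBits.of_subset {s t : Str} (h : IsBits s) (hts : t ⊆ s) : IsBits t :=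
  fun ht => h (hts ht)

theorem padTake_eq {s : Str} {n : ℕ} (h : s.length ≤ n) :
    padTake n s = s ++ List.replicate (n - s.length) .zero := by
  induction n generalizing s with
  | zero =>
    obtain rfl := List.length_eq_zero_iff.1 (Nat.le_zero.1 h)
    rfl
  | succ n ih =>
    rw [padTake_succ]
    cases s with
    | nil => rw [List.tail_nil, ih (by simp)]; rfl
    | cons x s => rw [List.tail_cons, ih (by simpa using h)]; simp

theorem CodesDyadic.padTake {s : Str} {r : ℚ} (hs : CodesDyadic s r) {n : ℕ} (h : s.length ≤ n) :
    CodesDyadic (padTake n s) r := by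
  rw [padTake_eq h]
  generalize n - s.length = k
  obtain ⟨i, f, rfl, hi, hf, rfl⟩ := hs
  refine ⟨i, f ++ List.replicate k .zero, by simp, hi, isBits_append hf (by simp [IsBits]), ?_⟩
  rw [bitsVal_append_zeros, List.length_append, List.length_replicate, pow_add]
  push_cast
  field_simp

/-- A code of the difference of two natural numbers, divided by a power of two with unary
exponent. -/
def dyadicCode (a b q : Str) : Str :=
  (if (strip (subM b a)).head? = none then .zero else .one) ::
    (strip ((addM (subM a b) (subM b a)).reverse.drop q.length).reverse ++
      .point :: (padTake q.length (addM (subM a b) (subM b a)).reverse).reverse)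

theorem PT.dyadicCode {f g h : Baire → (ℕ → Str) → Str} (hf : PT f) (hg : PT g) (hh : PT h) :
    PT fun φ ρ => dyadicCode (f φ ρ) (g φ ρ) (h φ ρ) := by
  have hm := ((hf.subM hg).addM (hg.subM hf)).reverse
  have hX := (hh.drop hm).reverse.strip.append ((hh.padTake hm).reverse.cons .point)
  refine (PT.ite (p := fun o => o = none) (hg.subM hf).strip (hX.cons .zero) (hX.cons .one)).congr
    fun φ ρ => ?_
  rw [IntervalComplexity.dyadicCode]
  split_ifs <;> rfl

theorem codesDyadic_dyadicCode (a b q : Str) :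
    CodesDyadic (dyadicCode a b q) (((bitsVal a : ℚ) - bitsVal b) / 2 ^ q.length) := by
  have hm := isBits_addM (subM a b) (subM b a)
  have hv := bitsVal_addM (subM a b) (subM b a)
  have hsplit := bitsVal_reverse_split q.length (addM (subM a b) (subM b a)).reverse
  have hneg := strip_eq_nil_iff (isBits_subM b a)
  rw [List.reverse_reverse] at hsplit
  rw [bitsVal_subM, bitsVal_subM] at hv
  rw [bitsVal_subM] at hneg
  rw [dyadicCode]
  simp only [List.head?_eq_none_iff]
  generalize addM (subM a b) (subM b a) = m at *
  have hmr : IsBits m.reverse := hm.of_subset (by simp)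
  have hmd : IsBits (m.reverse.drop q.length).reverse :=
    hmr.of_subset fun x hx => List.drop_subset _ _ (List.mem_reverse.1 hx)
  refine ⟨_ :: strip (m.reverse.drop q.length).reverse, (padTake q.length m.reverse).reverse, rfl,
    ⟨isBits_cons.2 ⟨by split_ifs <;> simp, hmd.strip.1⟩, ?_⟩,
    (hmr.padTake q.length).of_subset (by simp), ?_⟩
  · rcases hmd.strip.2 with h | ⟨t, h⟩
    · left; simp [h]
    · exact Or.inr ⟨_, t, by rw [h]⟩
  · rw [List.tail_cons, bitsVal_strip, List.length_reverse, length_padTake]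
    have hval : (((bitsVal (m.reverse.drop q.length).reverse : ℕ) : ℚ) +
        (bitsVal (padTake q.length m.reverse).reverse : ℕ) / 2 ^ q.length)
        = (bitsVal m : ℚ) / 2 ^ q.length := by
      rw [hsplit]
      push_cast
      field_simp
      ring
    rw [hval, hv]
    split_ifs with h
    · have h2 : bitsVal b ≤ bitsVal a := by have := hneg.1 h; omega
      have h3 : ((bitsVal a - bitsVal b + (bitsVal b - bitsVal a) : ℕ) : ℚ)
          = bitsVal a - bitsVal b := by
        rw [Nat.sub_eq_zero_of_le h2, Nat.add_zero, Nat.cast_sub h2]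
      rw [h3]
      simp [codeSign]
    · have h2 : bitsVal a ≤ bitsVal b := by
        by_contra hlt
        exact h (hneg.2 (by omega))
      have h3 : ((bitsVal a - bitsVal b + (bitsVal b - bitsVal a) : ℕ) : ℚ)
          = bitsVal b - bitsVal a := by
        rw [Nat.sub_eq_zero_of_le h2, Nat.zero_add, Nat.cast_sub h2]
      rw [h3]
      simp [codeSign]
      ring

/-- A code of the interval with midpoint `a - b` and radius `e`, scaled by a power of two with unary
exponent. -/
def encode (a b e q : Str) : Str :=
  interleave (padTake (dyadicCode a b q ++ dyadicCode e [] q).length (dyadicCode a b q))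
    (padTake (dyadicCode a b q ++ dyadicCode e [] q).length (dyadicCode e [] q))

theorem PT.encode {f g h k : Baire → (ℕ → Str) → Str} (hf : PT f) (hg : PT g) (hh : PT h)
    (hk : PT k) : PT fun φ ρ => encode (f φ ρ) (g φ ρ) (h φ ρ) (k φ ρ) :=
  have h1 := hf.dyadicCode hg hk
  have h2 := hh.dyadicCode PT.nil hk
  ((h1.append h2).padTake h1).interleave ((h1.append h2).padTake h2)

theorem codesInterval_encode (a b e q : Str) {r ε : ℚ} (hr : IsDyadic r) (hε : IsDyadic ε)
    (pos : 0 < ε) (har : r = ((bitsVal a : ℚ) - bitsVal b) / 2 ^ q.length)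
    (heε : ε = bitsVal e / 2 ^ q.length) :
    CodesInterval (encode a b e q) (.finite r ε hr hε pos) := by
  refine ⟨_, _, interleave_eq_pairStr (by simp [length_padTake]), ?_, ?_⟩
  · rw [har]
    exact (codesDyadic_dyadicCode a b q).padTake (by simp)
  · rw [heε]
    have := codesDyadic_dyadicCode e [] q
    rw [bitsVal_nil, Nat.cast_zero, sub_zero] at this
    exact this.padTake (by simp)

/-! ### Reading codes of dyadic numbers -/

/-- The part of a string before the first separator symbol. -/
def intPart (s : Str) : Str := s.takeWhile fun x => x ≠ .point

/-- The part of a string after the first separator symbol. -/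
def fracPart (s : Str) : Str := (s.dropWhile fun x => x ≠ .point).tail

/-- The string is a code of a dyadic number of absolute value less than `2 ^ n`. -/
def Fits (n : ℕ) (s : Str) : Prop :=
  (s.dropWhile fun x => x ≠ .point).head? ≠ none ∧ ((intPart s).drop (n + 1)).head? = none

/-- The binary expansion of the integer part of `2 ^ n` times the absolute value of a dyadic
number. -/
def scaled (n : ℕ) (s : Str) : Str := (intPart s).tail ++ padTake n (fracPart s)

/-- The binary expansion of the integer part of `2 ^ n` times the positive part of a dyadic
number. -/
def posPart (n : ℕ) (s : Str) : Str := if s.head? = some .one then [] else scaled n s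

/-- The binary expansion of the integer part of `2 ^ n` times the negative part of a dyadic
number. -/
def negPart (n : ℕ) (s : Str) : Str := if s.head? = some .one then scaled n s else []

theorem PT.scaled {f g : Baire → (ℕ → Str) → Str} (hf : PT f) (hg : PT g) :
    PT fun φ ρ => scaled (f φ ρ).length (g φ ρ) :=
  (hg.takeWhile _).tail.append (hf.padTake (hg.dropWhile _).tail)

theorem PT.posPart {f g : Baire → (ℕ → Str) → Str} (hf : PT f) (hg : PT g) :
    PT fun φ ρ => posPart (f φ ρ).length (g φ ρ) :=
  PT.ite (p := fun o => o = some .one) hg PT.nil (hf.scaled hg)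

theorem PT.negPart {f g : Baire → (ℕ → Str) → Str} (hf : PT f) (hg : PT g) :
    PT fun φ ρ => negPart (f φ ρ).length (g φ ρ) :=
  PT.ite (p := fun o => o = some .one) hg (hf.scaled hg) PT.nil

open Classical in
theorem PT.iteFits {f g h k : Baire → (ℕ → Str) → Str} (hf : PT f) (hg : PT g) (hh : PT h)
    (hk : PT k) :
    PT fun φ ρ => if Fits (f φ ρ).length (g φ ρ) then h φ ρ else k φ ρ := by
  refine (PT.ite (p := fun o => o ≠ none) (hg.dropWhile fun x => x ≠ .point)
    (PT.ite (p := fun o => o = none) ((hf.cons .zero).drop (hg.takeWhile fun x => x ≠ .point))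
      hh hk) hk).congr fun φ ρ => ?_
  by_cases hF : Fits (f φ ρ).length (g φ ρ)
  · rw [if_pos hF, if_pos hF.1]
    exact (if_pos hF.2).symm
  · rw [if_neg hF]
    by_cases h1 : ((g φ ρ).dropWhile fun x => x ≠ .point).head? ≠ none
    · rw [if_pos h1]
      exact (if_neg fun h2 => hF ⟨h1, h2⟩).symm
    · rw [if_neg h1]

theorem intPart_append {i f : Str} (hi : IsBits i) : intPart (i ++ .point :: f) = i := by
  rw [intPart, List.takeWhile_append_of_pos fun x hx => by simpa using ne_of_mem_of_not_mem hx hi]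
  simp

theorem dropWhile_append_point {i f : Str} (hi : IsBits i) :
    (i ++ .point :: f).dropWhile (fun x => decide (x ≠ .point)) = .point :: f := by
  rw [List.dropWhile_append_of_pos fun x hx => by simpa using ne_of_mem_of_not_mem hx hi]
  simp

theorem fracPart_append {i f : Str} (hi : IsBits i) : fracPart (i ++ .point :: f) = f := by
  rw [fracPart, dropWhile_append_point hi, List.tail_cons]

theorem fits_append {i f : Str} (hi : IsBits i) (n : ℕ) :
    Fits n (i ++ .point :: f) ↔ i.length ≤ n + 1 := by
  rw [Fits, intPart_append hi, dropWhile_append_point hi]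
  simp

theorem bitsVal_padTake (n : ℕ) (f : Str) :
    bitsVal (padTake n f) = bitsVal f * 2 ^ n / 2 ^ f.length := by
  induction n generalizing f with
  | zero => simp [padTake_zero, bitsVal_nil, Nat.div_eq_of_lt (bitsVal_lt f)]
  | succ n ih =>
    rw [padTake_succ, bitsVal_cons, length_padTake, ih]
    cases f with
    | nil => simp [bitsVal_nil, Letter.bit]
    | cons x f =>
      rw [List.head?_cons, Option.getD_some, List.tail_cons, bitsVal_cons, List.length_cons,
        pow_succ, pow_succ, ← mul_assoc, Nat.mul_div_mul_right _ _ (by norm_num), add_mul,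
        show x.bit * 2 ^ f.length * 2 ^ n = x.bit * 2 ^ n * 2 ^ f.length by ring,
        add_comm (x.bit * 2 ^ n * 2 ^ f.length), Nat.add_mul_div_right _ _ (by positivity), add_comm]

theorem bitsVal_scaled {i f : Str} (hi : IsBits i) (n : ℕ) :
    bitsVal (scaled n (i ++ .point :: f))
      = ⌊((bitsVal i.tail : ℚ) + bitsVal f / 2 ^ f.length) * 2 ^ n⌋₊ := by
  rw [scaled, intPart_append hi, fracPart_append hi, bitsVal_append, length_padTake,
    bitsVal_padTake]
  rw [show ((bitsVal i.tail : ℚ) + bitsVal f / 2 ^ f.length) * 2 ^ n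
    = ((bitsVal f * 2 ^ n : ℕ) : ℚ) / ((2 ^ f.length : ℕ) : ℚ) + ((bitsVal i.tail * 2 ^ n : ℕ) : ℚ) by
      push_cast; ring]
  rw [Nat.floor_add_natCast (by positivity), Nat.floor_div_eq_div]
  ring

theorem CodesDyadic.bitsVal_posPart {s : Str} {r : ℚ} (h : CodesDyadic s r) (n : ℕ) :
    bitsVal (posPart n s) = ⌊r * 2 ^ n⌋₊ := by
  obtain ⟨i, f, rfl, hi, hf, rfl⟩ := h
  have hpos : 0 ≤ ((bitsVal i.tail : ℚ) + bitsVal f / 2 ^ f.length) * 2 ^ n := by positivity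
  have hs := bitsVal_scaled (f := f) hi.1 n
  rw [posPart]
  rcases i with _ | ⟨_ | _ | _, i⟩
  · simpa [codeSign] using hs
  · simpa [codeSign] using hs
  · rw [List.cons_append, List.head?_cons, if_pos rfl, bitsVal_nil, eq_comm, Nat.floor_eq_zero]
    simp only [codeSign, Int.cast_neg, Int.cast_one]
    linarith
  · exact absurd hi.1 (by simp [IsBits])

theorem CodesDyadic.bitsVal_negPart {s : Str} {r : ℚ} (h : CodesDyadic s r) (n : ℕ) :
    bitsVal (negPart n s) = ⌊-r * 2 ^ n⌋₊ := by
  obtain ⟨i, f, rfl, hi, hf, rfl⟩ := h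
  have hpos : 0 ≤ ((bitsVal i.tail : ℚ) + bitsVal f / 2 ^ f.length) * 2 ^ n := by positivity
  have hs := bitsVal_scaled (f := f) hi.1 n
  rw [negPart]
  have key : ∀ x : ℚ, 0 ≤ x * 2 ^ n → 0 = ⌊-x * 2 ^ n⌋₊ := by
    intro x hx
    rw [eq_comm, Nat.floor_eq_zero]
    linarith
  rcases i with _ | ⟨_ | _ | _, i⟩
  · simpa [codeSign, bitsVal_nil] using key _ hpos
  · simpa [codeSign, bitsVal_nil] using key _ hpos
  · rw [List.cons_append, List.head?_cons, if_pos rfl, ← List.cons_append]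
    simpa only [codeSign, Int.cast_neg, Int.cast_one, neg_mul, neg_neg, one_mul] using hs
  · exact absurd hi.1 (by simp [IsBits])

theorem CodesDyadic.fits_iff {s : Str} {r : ℚ} (h : CodesDyadic s r) (n : ℕ) :
    Fits n s ↔ |r| < 2 ^ n := by
  obtain ⟨i, f, rfl, hi, hf, rfl⟩ := h
  rw [fits_append hi.1]
  have habs : |(codeSign i : ℚ) * ((bitsVal i.tail : ℚ) + bitsVal f / 2 ^ f.length)|
      = (bitsVal i.tail : ℚ) + bitsVal f / 2 ^ f.length := by
    rw [abs_mul, abs_of_nonneg (a := (bitsVal i.tail : ℚ) + _) (by positivity)]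
    have : |(codeSign i : ℚ)| = 1 := by
      rcases i with _ | ⟨_ | _ | _, i⟩ <;> simp [codeSign]
    rw [this, one_mul]
  rw [habs]
  have hfrac : (bitsVal f : ℚ) / 2 ^ f.length < 1 := by
    rw [div_lt_one (by positivity)]
    exact_mod_cast bitsVal_lt f
  have hfrac0 : 0 ≤ (bitsVal f : ℚ) / 2 ^ f.length := by positivity
  constructor
  · intro hl
    have h1 : bitsVal i.tail + 1 ≤ 2 ^ n :=
      (bitsVal_lt i.tail).trans_le (Nat.pow_le_pow_right (by norm_num) (by simp; omega))
    have h2 : (bitsVal i.tail : ℚ) + 1 ≤ 2 ^ n := by exact_mod_cast h1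
    linarith
  · intro hlt
    rcases hi.2 with hl | ⟨σ, t, rfl⟩
    · omega
    · have h1 : (bitsVal (Letter.one :: t) : ℚ) < 2 ^ n := by
        refine lt_of_le_of_lt ?_ hlt
        simpa using hfrac0
      have h2 : bitsVal (Letter.one :: t) < 2 ^ n := by exact_mod_cast h1
      rw [bitsVal_cons] at h2
      have h3 : 2 ^ t.length < 2 ^ n := by simp only [Letter.bit] at h2; omega
      have := (Nat.pow_lt_pow_iff_right (by norm_num)).1 h3
      simp
      omega

theorem padTake_take {n m : ℕ} (h : n ≤ m) (s : Str) : padTake n (s.take m) = padTake n s := by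
  rw [padTake, padTake]
  apply List.map_congr_left
  intro i hi
  have := List.mem_range.1 hi
  simp [List.getD_eq_getElem?_getD, show i < m by omega]

theorem CodesDyadic.fits_take {s : Str} {r : ℚ} (h : CodesDyadic s r) (n : ℕ) :
    (Fits n (s.take (2 * n + 2)) ↔ Fits n s) ∧
      (Fits n s → posPart n (s.take (2 * n + 2)) = posPart n s ∧
        negPart n (s.take (2 * n + 2)) = negPart n s) := by
  obtain ⟨i, f, rfl, hi, hf, rfl⟩ := h
  by_cases hl : i.length ≤ n + 1
  · have ht : (i ++ Letter.point :: f).take (2 * n + 2)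
        = i ++ Letter.point :: f.take (2 * n + 1 - i.length) := by
      rw [List.take_append, List.take_of_length_le (by omega)]
      rw [show 2 * n + 2 - i.length = (2 * n + 1 - i.length) + 1 by omega, List.take_succ_cons]
    have hh : ∀ g, (i ++ Letter.point :: g).head? = (i ++ Letter.point :: f).head? := by
      intro g
      cases i <;> rfl
    refine ⟨by rw [ht, fits_append hi.1, fits_append hi.1], fun _ => ?_⟩
    have hs : scaled n (i ++ Letter.point :: f.take (2 * n + 1 - i.length))
        = scaled n (i ++ Letter.point :: f) := by
      rw [scaled, scaled, intPart_append hi.1, intPart_append hi.1, fracPart_append hi.1,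
        fracPart_append hi.1, padTake_take (by omega)]
    rw [ht, posPart, posPart, negPart, negPart, hs, hh]
    exact ⟨rfl, rfl⟩
  · have h2 : ¬ Fits n (i ++ Letter.point :: f) := by rwa [fits_append hi.1]
    refine ⟨iff_of_false (fun h3 => ?_) h2, fun h => absurd h h2⟩
    by_cases hl2 : i.length < 2 * n + 2
    · have ht : (i ++ Letter.point :: f).take (2 * n + 2)
          = i ++ Letter.point :: f.take (2 * n + 1 - i.length) := by
        rw [List.take_append, List.take_of_length_le (by omega)]
        rw [show 2 * n + 2 - i.length = (2 * n + 1 - i.length) + 1 by omega, List.take_succ_cons]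
      rw [ht, fits_append hi.1] at h3
      exact hl h3
    · rw [List.take_append_of_le_length (by omega)] at h3
      apply h3.1
      rw [List.head?_eq_none_iff, List.dropWhile_eq_nil_iff]
      intro x hx
      simpa using ne_of_mem_of_not_mem (List.mem_of_mem_take hx) hi.1

/-! ### Reading codes of intervals -/

theorem take_flatMap_range (u : ℕ → Str) (hu : ∀ n, (u n).length = 3) (L m : ℕ) :
    ((List.range L).flatMap u).take (3 * m) = (List.range (min m L)).flatMap u := by
  have hlen : ∀ L, ((List.range L).flatMap u).length = 3 * L := by
    intro L
    simp [List.length_flatMap, hu, mul_comm]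
  rcases le_total L m with h | h
  · rw [min_eq_right h, List.take_of_length_le (by rw [hlen]; omega)]
  · obtain ⟨k, rfl⟩ := Nat.exists_eq_add_of_le h
    rw [min_eq_left h, List.range_add, List.flatMap_append, List.take_append_of_le_length
      (by rw [hlen]), List.take_of_length_le (by rw [hlen])]

theorem col_take_pairStr (a b : Str) (m : ℕ) :
    col 1 ((pairStr a b).take (3 * m)) = (col 1 (pairStr a b)).take m ∧
      col 2 ((pairStr a b).take (3 * m)) = (col 2 (pairStr a b)).take m := by
  rw [pairStr, take_flatMap_range _ (fun n => rfl)]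
  constructor <;>
  · rw [col_flatMap _ _ (fun n => rfl) (by norm_num), col_flatMap _ _ (fun n => rfl) (by norm_num),
      ← List.map_take, List.take_range]

theorem CodesDyadic.col {a b : Str} {r ε : ℚ} (ha : CodesDyadic a r) (hb : CodesDyadic b ε) :
    CodesDyadic (col 1 (pairStr a b)) r ∧ CodesDyadic (col 2 (pairStr a b)) ε := by
  rw [pairStr]
  constructor
  · rw [col_flatMap _ _ (fun n => rfl) (by norm_num)]
    exact ha.padTake (le_max_left _ _ |>.trans (le_max_left _ _))
  · rw [col_flatMap _ _ (fun n => rfl) (by norm_num)]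
    exact hb.padTake (le_max_right _ _ |>.trans (le_max_left _ _))

/-! ### Dyadic intervals -/

theorem IsDyadic.mul {p q : ℚ} (hp : IsDyadic p) (hq : IsDyadic q) : IsDyadic (p * q) := by
  obtain ⟨r, n, rfl⟩ := hp
  obtain ⟨s, m, rfl⟩ := hq
  refine ⟨r * s, n + m, ?_⟩
  push_cast
  rw [pow_add]
  field_simp

theorem IsDyadic.abs {p : ℚ} (hp : IsDyadic p) : IsDyadic |p| := by
  rcases abs_choice p with h | h <;> rw [h]
  · exact hp
  · exact hp.neg

theorem isDyadic_natCast_div (r n : ℕ) : IsDyadic ((r : ℚ) / 2 ^ n) := ⟨r, n, by simp⟩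

theorem mem_toSet_finite {r ε : ℚ} {hr : IsDyadic r} {hε : IsDyadic ε} {pos : 0 < ε} {x : ℝ} :
    x ∈ (DyadicInterval.finite r ε hr hε pos).toSet ↔ |x - r| ≤ ε := by
  simp only [DyadicInterval.toSet, Set.mem_Icc, abs_le]
  push_cast
  constructor <;> rintro ⟨h1, h2⟩ <;> constructor <;> linarith

theorem toSet_finite_subset_iff {r ε s δ : ℚ} {hr : IsDyadic r} {hε : IsDyadic ε} {pos : 0 < ε}
    {hs : IsDyadic s} {hδ : IsDyadic δ} {pos' : 0 < δ} :
    (DyadicInterval.finite s δ hs hδ pos').toSet ⊆ (DyadicInterval.finite r ε hr hε pos).toSet ↔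
      |s - r| ≤ ε - δ := by
  simp only [DyadicInterval.toSet]
  rw [Set.Icc_subset_Icc_iff (by exact_mod_cast (by linarith : s - δ ≤ s + δ)), abs_le]
  norm_cast
  constructor <;> rintro ⟨h1, h2⟩ <;> constructor <;> linarith

theorem exists_of_diam_le {J : DyadicInterval} {q : ℚ} (h : J.diam ≤ (q : WithTop ℚ)) :
    ∃ r ε hr hε pos, J = .finite r ε hr hε pos ∧ 2 * ε ≤ q := by
  cases J with
  | whole => exact absurd h (by simp [DyadicInterval.diam])
  | finite r ε hr hε pos => exact ⟨r, ε, hr, hε, pos, rfl, WithTop.coe_le_coe.1 h⟩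

theorem exists_of_subset_finite {J : DyadicInterval} {r ε : ℚ} {hr : IsDyadic r} {hε : IsDyadic ε}
    {pos : 0 < ε} (h : J.toSet ⊆ (DyadicInterval.finite r ε hr hε pos).toSet) :
    ∃ s δ hs hδ pos', J = .finite s δ hs hδ pos' ∧ |s - r| ≤ ε - δ := by
  cases J with
  | whole => exact absurd (diam_mono h) (not_le.2 (WithTop.coe_lt_top _))
  | finite s δ hs hδ pos' => exact ⟨s, δ, hs, hδ, pos', rfl, toSet_finite_subset_iff.1 h⟩

/-! ### Interval functions -/

theorem IsIntervalExtension.mem {Ψ : DyadicInterval → DyadicInterval} {f : C(unitInterval, ℝ)}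
    (h : IsIntervalExtension Ψ f) {J : DyadicInterval} {x : unitInterval} (hx : (x : ℝ) ∈ J.toSet) :
    f x ∈ (Ψ J).toSet := by
  obtain ⟨φ, hφ, hsub⟩ := exists_name_within J hx
  have hx0 : (x : ℝ) ∈ (φ 0).toSet := by
    have : (x : ℝ) ∈ ⋂ n, (φ n).toSet := by rw [hφ.2]; rfl
    exact Set.mem_iInter.1 this 0
  refine h.mono (hsub 0) ⟨x, hx0, x.2⟩ ?_
  have : f x ∈ ⋂ n, (Ψ (φ n)).toSet := by
    have := (h φ x hφ).2
    simp only [Function.comp_apply] at this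
    rw [this]; rfl
  exact Set.mem_iInter.1 this 0

/-- The interval function maps intervals of length at most `2 ^ (-N)` that meet `[0, 1]` to intervals
of length at most `2 ^ (-n)`. -/
def ModulusAt (Ψ : DyadicInterval → DyadicInterval) (n N : ℕ) : Prop :=
  ∀ J, (J.toSet ∩ Set.Icc 0 1).Nonempty → J.diam ≤ (((1 / 2) ^ N : ℚ) : WithTop ℚ) →
    (Ψ J).diam ≤ (((1 / 2) ^ n : ℚ) : WithTop ℚ)

theorem mem_moduli_iff {ψ : Baire} {Ψ : DyadicInterval → DyadicInterval}
    (h : CodesIntervalFun ψ Ψ) {n N : ℕ} : N ∈ moduli ψ n ↔ ModulusAt Ψ n N := by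
  constructor
  · intro hN J hJ hd
    obtain ⟨s, hs⟩ := exists_codesInterval J
    exact hN J s _ hJ hs (h J s hs) hd
  · intro hN J s K hJ hs hK hd
    obtain rfl := codesInterval_unique (h J s hs) hK
    exact hN J hJ hd

theorem half_pow_anti {m n : ℕ} (h : m ≤ n) : (1 / 2 : ℚ) ^ n ≤ (1 / 2) ^ m :=
  pow_le_pow_of_le_one (by norm_num) (by norm_num) h

theorem ModulusAt.mono {Ψ : DyadicInterval → DyadicInterval} {n N N' : ℕ} (h : ModulusAt Ψ n N)
    (hN : N ≤ N') : ModulusAt Ψ n N' := fun J hJ hd =>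
  h J hJ (hd.trans (WithTop.coe_le_coe.2 (half_pow_anti hN)))

theorem isIntervalExtension_of {Θ : DyadicInterval → DyadicInterval} {h : C(unitInterval, ℝ)}
    (hmem : ∀ (J : DyadicInterval) (x : unitInterval), (x : ℝ) ∈ J.toSet → h x ∈ (Θ J).toSet)
    (hmono : ∀ J K : DyadicInterval, K.toSet ⊆ J.toSet → (K.toSet ∩ Set.Icc 0 1).Nonempty →
      (Θ K).toSet ⊆ (Θ J).toSet)
    (hmod : ∀ n, ∃ N, ModulusAt Θ n N) : IsIntervalExtension Θ h := by
  intro φ x hφ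
  have hx : ∀ n, (x : ℝ) ∈ (φ n).toSet := by
    have : (x : ℝ) ∈ ⋂ n, (φ n).toSet := by rw [hφ.2]; rfl
    exact Set.mem_iInter.1 this
  refine ⟨fun n => hmono _ _ (hφ.1 n) ⟨x, hx _, x.2⟩, Set.Subset.antisymm ?_ ?_⟩
  · intro y hy
    refine eq_of_two_div_pow fun n => ?_
    obtain ⟨N, hN⟩ := hmod n
    obtain ⟨k, hk⟩ := hφ.exists_diam_le N
    obtain ⟨r, ε, hr, hε, pos, hJ, hle⟩ := exists_of_diam_le (hN _ ⟨x, hx k, x.2⟩ hk)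
    have h1 := Set.mem_iInter.1 hy k
    have h2 := hmem _ _ (hx k)
    simp only [Function.comp_apply] at h1
    rw [hJ, mem_toSet_finite, abs_le] at h1 h2
    have hle' : 2 * (ε : ℝ) ≤ (1 / 2) ^ n := by
      have := (Rat.cast_le (K := ℝ)).2 hle
      push_cast at this
      exact this
    rw [one_div_pow] at hle'
    have h3 : (2 : ℝ) / 2 ^ n = 2 * (1 / 2 ^ n) := by ring
    have h4 : (0 : ℝ) < 1 / 2 ^ n := by positivity
    rw [abs_le]
    constructor <;> linarith [h1.1, h1.2, h2.1, h2.2]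
  · rintro _ rfl
    exact Set.mem_iInter.2 fun n => hmem _ _ (hx n)

/-! ### Truncation -/

/-- The enlargement of an interval to an interval with midpoint and radius in `2 ^ (-p) ℤ`. -/
def trunc (p : ℕ) : DyadicInterval → DyadicInterval
  | .finite r ε _ _ _ =>
    if |r| < 2 ^ p ∧ |ε| < 2 ^ p then
      .finite (((⌊r * 2 ^ p⌋₊ : ℕ) : ℚ) / 2 ^ p - ((⌊-r * 2 ^ p⌋₊ : ℕ) : ℚ) / 2 ^ p)
        (((⌊ε * 2 ^ p⌋₊ + 3 : ℕ) : ℚ) / 2 ^ p)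
        ((isDyadic_natCast_div _ _).sub (isDyadic_natCast_div _ _)) (isDyadic_natCast_div _ _)
        (by positivity)
    else .whole
  | .whole => .whole

theorem abs_trunc_sub_le (r : ℚ) (p : ℕ) :
    |((⌊r * 2 ^ p⌋₊ : ℕ) : ℚ) / 2 ^ p - ((⌊-r * 2 ^ p⌋₊ : ℕ) : ℚ) / 2 ^ p - r| ≤ 1 / 2 ^ p := by
  have hp : (0 : ℚ) < 2 ^ p := by positivity
  rw [← sub_div, abs_le, neg_le_sub_iff_le_add, sub_le_iff_le_add, ← sub_le_iff_le_add',
    le_div_iff₀ hp, div_le_iff₀ hp, sub_mul, add_mul, div_mul_cancel₀ _ hp.ne']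
  have h1p : (1 : ℚ) / 2 ^ p * 2 ^ p = 1 := div_mul_cancel₀ _ hp.ne'
  rcases le_total 0 r with h | h
  · have h0 : 0 ≤ r * 2 ^ p := by positivity
    rw [Nat.floor_of_nonpos (a := -r * 2 ^ p) (by linarith)]
    have h1 := Nat.floor_le h0
    have h2 := Nat.lt_floor_add_one (r * 2 ^ p)
    constructor <;> push_cast <;> linarith
  · have h0 : 0 ≤ -r * 2 ^ p := mul_nonneg (by linarith) hp.le
    rw [Nat.floor_of_nonpos (a := r * 2 ^ p) (by linarith)]
    have h1 := Nat.floor_le h0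
    have h2 := Nat.lt_floor_add_one (-r * 2 ^ p)
    constructor <;> push_cast <;> linarith

theorem trunc_radius_bounds {ε : ℚ} (pos : 0 < ε) (p : ℕ) :
    ε + 2 / 2 ^ p ≤ ((⌊ε * 2 ^ p⌋₊ + 3 : ℕ) : ℚ) / 2 ^ p ∧
      ((⌊ε * 2 ^ p⌋₊ + 3 : ℕ) : ℚ) / 2 ^ p ≤ ε + 3 / 2 ^ p := by
  have hp : (0 : ℚ) < 2 ^ p := by positivity
  have h1 := Nat.floor_le (a := ε * 2 ^ p) (by positivity)
  have h2 := Nat.lt_floor_add_one (ε * 2 ^ p)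
  rw [le_div_iff₀ hp, div_le_iff₀ hp, add_mul, add_mul, div_mul_cancel₀ _ hp.ne',
    div_mul_cancel₀ _ hp.ne']
  push_cast
  constructor <;> linarith

/-- `L` and the precision `q` are the same as `K` and `p`, or `L` is part of `K` and the precision is
larger. -/
def Refines (L : DyadicInterval) (q : ℕ) (K : DyadicInterval) (p : ℕ) : Prop :=
  (L = K ∧ q = p) ∨ (L.toSet ⊆ K.toSet ∧ p + 2 ≤ q)

theorem trunc_mono {K L : DyadicInterval} {p q : ℕ} (h : Refines L q K p) :
    (trunc q L).toSet ⊆ (trunc p K).toSet := by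
  rcases h with ⟨rfl, rfl⟩ | ⟨h, hpq⟩
  · rfl
  cases K with
  | whole => exact Set.subset_univ _
  | finite r ε hr hε pos =>
    obtain ⟨s, δ, hs, hδ, pos', rfl, hle⟩ := exists_of_subset_finite h
    rw [trunc, trunc]
    split_ifs with h1 h2 h2
    · rw [toSet_finite_subset_iff]
      have h3 := abs_le.1 (abs_trunc_sub_le r p)
      have h4 := abs_le.1 (abs_trunc_sub_le s q)
      have h5 := (trunc_radius_bounds pos p).1
      have h6 := (trunc_radius_bounds pos' q).2
      have h7 := abs_le.1 hle
      have h8 : (4 : ℚ) * (1 / 2 ^ q) ≤ 1 / 2 ^ p := by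
        obtain ⟨d, rfl⟩ := Nat.exists_eq_add_of_le hpq
        have hd : (1 : ℚ) ≤ 2 ^ d := one_le_pow₀ (by norm_num)
        rw [pow_add, pow_add, mul_one_div, div_le_div_iff₀ (by positivity) (by positivity)]
        nlinarith [pow_pos (two_pos (α := ℚ)) p]
      have h9 : (3 : ℚ) / 2 ^ q = 3 * (1 / 2 ^ q) := by ring
      have h10 : (2 : ℚ) / 2 ^ p = 2 * (1 / 2 ^ p) := by ring
      rw [abs_le]
      constructor <;> linarith [h3.1, h3.2, h4.1, h4.2, h7.1, h7.2]
    · exact Set.subset_univ _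
    · exfalso
      apply h1
      rw [abs_of_pos pos] at h2
      rw [abs_of_pos pos']
      have h7 := abs_le.1 hle
      have h11 := abs_lt.1 h2.1
      have h12 : (2 : ℚ) * 2 ^ p ≤ 2 ^ q := by
        rw [← pow_succ']
        exact pow_le_pow_right₀ (by norm_num) (by omega)
      refine ⟨abs_lt.2 ?_, ?_⟩
      · constructor <;> linarith [h7.1, h7.2, h11.1, h11.2]
      · linarith [h7.1, h7.2]
    · rfl

theorem subset_trunc (p : ℕ) (K : DyadicInterval) : K.toSet ⊆ (trunc p K).toSet := by
  cases K with
  | whole => rfl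
  | finite r ε hr hε pos =>
    rw [trunc]
    split_ifs with h
    · rw [toSet_finite_subset_iff, abs_sub_comm]
      have h1 := abs_trunc_sub_le r p
      have h2 := (trunc_radius_bounds pos p).1
      have h3 : (2 : ℚ) / 2 ^ p = 2 * (1 / 2 ^ p) := by ring
      have h4 : (0 : ℚ) < 1 / 2 ^ p := by positivity
      linarith
    · exact Set.subset_univ _

/-- The truncation of a short interval that contains a point of small absolute value is short. -/
theorem diam_trunc_le {K : DyadicInterval} {n p l : ℕ} {y : ℝ} (hy : y ∈ K.toSet)
    (hyl : |y| + 1 ≤ 2 ^ l) (hK : K.diam ≤ (((1 / 2) ^ (n + 1) : ℚ) : WithTop ℚ))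
    (hl : l ≤ p) (hp : n + 4 ≤ p) :
    (trunc p K).diam ≤ (((1 / 2) ^ n : ℚ) : WithTop ℚ) := by
  obtain ⟨r, ε, hr, hε, pos, rfl, hle⟩ := exists_of_diam_le hK
  have h1 : (1 / 2 : ℚ) ^ (n + 1) = 1 / 2 * (1 / 2) ^ n := pow_succ' _ _
  have h2 : (1 / 2 : ℚ) ^ n ≤ 1 := pow_le_one₀ (by norm_num) (by norm_num)
  have hε1 : ε < 1 := by linarith
  have hp1 : (1 : ℚ) ≤ 2 ^ p := one_le_pow₀ (by norm_num)
  have hfit : |r| < 2 ^ p ∧ |ε| < 2 ^ p := by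
    refine ⟨?_, by rw [abs_of_pos pos]; linarith⟩
    have h3 := abs_le.1 (mem_toSet_finite.1 hy)
    have h4 := abs_le.1 (le_refl |y|)
    have h5 : (ε : ℝ) < 1 := by exact_mod_cast hε1
    have h6 : (2 : ℝ) ^ l ≤ 2 ^ p := pow_le_pow_right₀ (by norm_num) hl
    have h7 : |(r : ℝ)| < 2 ^ p := by
      rw [abs_lt]
      constructor <;> linarith [h3.1, h3.2, h4.1, h4.2]
    exact_mod_cast h7
  rw [trunc, if_pos hfit]
  refine WithTop.coe_le_coe.2 ?_
  have h3 := (trunc_radius_bounds pos p).2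
  have h4 : (1 : ℚ) / 2 ^ p ≤ 1 / 16 * (1 / 2) ^ n := by
    rw [← one_div_pow]
    refine (half_pow_anti hp).trans ?_
    rw [pow_add]
    norm_num
    linarith
  have h5 : (3 : ℚ) / 2 ^ p = 3 * (1 / 2 ^ p) := by ring
  linarith

/-! ### Interval arithmetic -/

/-- The sum of two intervals. -/
def addI : DyadicInterval → DyadicInterval → DyadicInterval
  | .finite r ε hr hε pos, .finite s δ hs hδ pos' =>
    .finite (r + s) (ε + δ) (hr.add hs) (hε.add hδ) (by positivity)
  | _, _ => .whole

/-- The difference of two intervals. -/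
def subI : DyadicInterval → DyadicInterval → DyadicInterval
  | .finite r ε hr hε pos, .finite s δ hs hδ pos' =>
    .finite (r - s) (ε + δ) (hr.sub hs) (hε.add hδ) (by positivity)
  | _, _ => .whole

/-- An enclosure of the product of two intervals. -/
def mulI : DyadicInterval → DyadicInterval → DyadicInterval
  | .finite r ε hr hε pos, .finite s δ hs hδ pos' =>
    .finite (r * s) (|r| * δ + ε * (|s| + δ)) (hr.mul hs)
      ((hr.abs.mul hδ).add (hε.mul (hs.abs.add hδ))) (by positivity)
  | _, _ => .whole

/-- An operation on intervals encloses a continuous operation and respects inclusions. -/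
structure IsEnclosure (T : DyadicInterval → DyadicInterval → DyadicInterval)
    (t : ℝ → ℝ → ℝ) : Prop where
  mem : ∀ K L y z, y ∈ K.toSet → z ∈ L.toSet → t y z ∈ (T K L).toSet
  mono : ∀ K L K' L' : DyadicInterval, K'.toSet ⊆ K.toSet → L'.toSet ⊆ L.toSet →
    (T K' L').toSet ⊆ (T K L).toSet

theorem isEnclosure_addI : IsEnclosure addI fun y z => y + z := by
  constructor
  · rintro (⟨r, ε, hr, hε, pos⟩ | _) (⟨s, δ, hs, hδ, pos'⟩ | _) y z hy hz
    · rw [addI, mem_toSet_finite]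
      rw [mem_toSet_finite] at hy hz
      push_cast
      rw [show y + z - (r + s) = (y - r) + (z - s) by ring]
      exact (abs_add_le _ _).trans (add_le_add hy hz)
    all_goals trivial
  · rintro (⟨r, ε, hr, hε, pos⟩ | _) (⟨s, δ, hs, hδ, pos'⟩ | _) K' L' hK hL
    · obtain ⟨r', ε', hr', hε', pos1, rfl, h1⟩ := exists_of_subset_finite hK
      obtain ⟨s', δ', hs', hδ', pos2, rfl, h2⟩ := exists_of_subset_finite hL
      rw [addI, addI, toSet_finite_subset_iff,
        show r' + s' - (r + s) = (r' - r) + (s' - s) by ring]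
      exact (abs_add_le _ _).trans (by linarith)
    all_goals exact Set.subset_univ _

theorem isEnclosure_subI : IsEnclosure subI fun y z => y - z := by
  constructor
  · rintro (⟨r, ε, hr, hε, pos⟩ | _) (⟨s, δ, hs, hδ, pos'⟩ | _) y z hy hz
    · rw [subI, mem_toSet_finite]
      rw [mem_toSet_finite] at hy hz
      push_cast
      rw [show y - z - (r - s) = (y - r) - (z - s) by ring]
      exact (abs_sub _ _).trans (add_le_add hy hz)
    all_goals trivial
  · rintro (⟨r, ε, hr, hε, pos⟩ | _) (⟨s, δ, hs, hδ, pos'⟩ | _) K' L' hK hL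
    · obtain ⟨r', ε', hr', hε', pos1, rfl, h1⟩ := exists_of_subset_finite hK
      obtain ⟨s', δ', hs', hδ', pos2, rfl, h2⟩ := exists_of_subset_finite hL
      rw [subI, subI, toSet_finite_subset_iff,
        show r' - s' - (r - s) = (r' - r) - (s' - s) by ring]
      exact (abs_sub _ _).trans (by linarith)
    all_goals exact Set.subset_univ _

theorem abs_mul_sub_mul_le {F : Type} [Field F] [LinearOrder F] [IsStrictOrderedRing F]
    {r s r' s' ε δ ε' δ' : F} (hε' : 0 ≤ ε') (hδ' : 0 ≤ δ') (h1 : |r' - r| ≤ ε - ε')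
    (h2 : |s' - s| ≤ δ - δ') :
    |r' * s' - r * s| ≤ |r| * δ + ε * (|s| + δ) - (|r'| * δ' + ε' * (|s'| + δ')) := by
  have h3 : |r'| ≤ |r| + (ε - ε') := by
    have := abs_add_le r (r' - r)
    rw [add_sub_cancel] at this
    linarith
  have h4 : |s'| ≤ |s| + (δ - δ') := by
    have := abs_add_le s (s' - s)
    rw [add_sub_cancel] at this
    linarith
  have h5 : |r' * s' - r * s| ≤ |r| * |s' - s| + |r' - r| * |s| + |r' - r| * |s' - s| := by
    rw [show r' * s' - r * s = r * (s' - s) + (r' - r) * s + (r' - r) * (s' - s) by ring,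
      ← abs_mul, ← abs_mul, ← abs_mul]
    exact (abs_add_le _ _).trans (add_le_add_left (abs_add_le _ _) _)
  have h6 : |r| * |s' - s| ≤ |r| * (δ - δ') := mul_le_mul_of_nonneg_left h2 (abs_nonneg _)
  have h7 : |r' - r| * |s| ≤ (ε - ε') * |s| := mul_le_mul_of_nonneg_right h1 (abs_nonneg _)
  have h8 : |r' - r| * |s' - s| ≤ (ε - ε') * (δ - δ') :=
    mul_le_mul h1 h2 (abs_nonneg _) ((abs_nonneg _).trans h1)
  have h9 : |r'| * δ' ≤ (|r| + (ε - ε')) * δ' := mul_le_mul_of_nonneg_right h3 hδ'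
  have h10 : ε' * (|s'| + δ') ≤ ε' * (|s| + (δ - δ') + δ') :=
    mul_le_mul_of_nonneg_left (by linarith) hε'
  linarith

theorem isEnclosure_mulI : IsEnclosure mulI fun y z => y * z := by
  constructor
  · rintro (⟨r, ε, hr, hε, pos⟩ | _) (⟨s, δ, hs, hδ, pos'⟩ | _) y z hy hz
    · rw [mulI, mem_toSet_finite]
      rw [mem_toSet_finite] at hy hz
      have := abs_mul_sub_mul_le (ε' := 0) (δ' := 0) le_rfl le_rfl
        (by rwa [sub_zero] : |y - r| ≤ ε - 0) (by rwa [sub_zero] : |z - s| ≤ δ - 0)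
      push_cast
      linarith
    all_goals trivial
  · rintro (⟨r, ε, hr, hε, pos⟩ | _) (⟨s, δ, hs, hδ, pos'⟩ | _) K' L' hK hL
    · obtain ⟨r', ε', hr', hε', pos1, rfl, h1⟩ := exists_of_subset_finite hK
      obtain ⟨s', δ', hs', hδ', pos2, rfl, h2⟩ := exists_of_subset_finite hL
      rw [mulI, mulI, toSet_finite_subset_iff]
      exact abs_mul_sub_mul_le pos1.le pos2.le h1 h2
    all_goals exact Set.subset_univ _

theorem diam_addI_le {K L : DyadicInterval} {n : ℕ}
    (hK : K.diam ≤ (((1 / 2) ^ (n + 1) : ℚ) : WithTop ℚ))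
    (hL : L.diam ≤ (((1 / 2) ^ (n + 1) : ℚ) : WithTop ℚ)) :
    (addI K L).diam ≤ (((1 / 2) ^ n : ℚ) : WithTop ℚ) ∧
      (subI K L).diam ≤ (((1 / 2) ^ n : ℚ) : WithTop ℚ) := by
  obtain ⟨r, ε, hr, hε, pos, rfl, h1⟩ := exists_of_diam_le hK
  obtain ⟨s, δ, hs, hδ, pos', rfl, h2⟩ := exists_of_diam_le hL
  rw [pow_succ] at h1 h2
  constructor <;> exact WithTop.coe_le_coe.2 (by linarith)

theorem diam_mulI_le {K L : DyadicInterval} {n l : ℕ} {y z : ℝ} (hy : y ∈ K.toSet)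
    (hz : z ∈ L.toSet) (hyl : |y| + 1 ≤ 2 ^ l) (hzl : |z| + 1 ≤ 2 ^ l)
    (hK : K.diam ≤ (((1 / 2) ^ (n + l + 2) : ℚ) : WithTop ℚ))
    (hL : L.diam ≤ (((1 / 2) ^ (n + l + 2) : ℚ) : WithTop ℚ)) :
    (mulI K L).diam ≤ (((1 / 2) ^ n : ℚ) : WithTop ℚ) := by
  obtain ⟨r, ε, hr, hε, pos, rfl, h1⟩ := exists_of_diam_le hK
  obtain ⟨s, δ, hs, hδ, pos', rfl, h2⟩ := exists_of_diam_le hL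
  have hle : (1 / 2 : ℚ) ^ (n + l + 2) ≤ 1 := pow_le_one₀ (by norm_num) (by norm_num)
  have habs : ∀ {u : ℝ} {v η : ℚ}, |u - v| ≤ η → 2 * η ≤ 1 → |u| + 1 ≤ 2 ^ l → |v| ≤ 2 ^ l := by
    intro u v η h3 h4 h5
    have h6 := abs_sub_abs_le_abs_sub (v : ℝ) u
    rw [abs_sub_comm] at h6
    have h7 : 2 * (η : ℝ) ≤ 1 := by exact_mod_cast h4
    have h8 : |(v : ℝ)| ≤ 2 ^ l := by linarith
    exact_mod_cast h8
  have h3 := habs (mem_toSet_finite.1 hy) (h1.trans hle) hyl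
  have h4 := habs (mem_toSet_finite.1 hz) (h2.trans hle) hzl
  refine WithTop.coe_le_coe.2 ?_
  set e : ℚ := (1 / 2) ^ (n + l + 2) with he
  have he0 : 0 < e := by positivity
  have hel : 4 * (2 ^ l * e) = (1 / 2) ^ n := by
    rw [he, pow_add, pow_add]
    have : (2 : ℚ) ^ l * (1 / 2) ^ l = 1 := by rw [← mul_pow]; norm_num
    linear_combination (1 / 2 : ℚ) ^ n * this
  have hl1 : (1 : ℚ) ≤ 2 ^ l := one_le_pow₀ (by norm_num)
  have h5 : |r| * (2 * δ) ≤ 2 ^ l * e := mul_le_mul h3 h2 (by positivity) (by positivity)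
  have h6 : (2 * ε) * |s| ≤ e * 2 ^ l := mul_le_mul h1 h4 (abs_nonneg _) he0.le
  have h7 : (2 * ε) * (2 * δ) ≤ e * 1 := mul_le_mul h1 (h2.trans hle) (by positivity) he0.le
  have h8 : 1 * e ≤ 2 ^ l * e := mul_le_mul_of_nonneg_right hl1 he0.le
  linarith

/-! ### Grids -/

/-- The interval `[l / 2 ^ k, u / 2 ^ k]`. -/
def gridInterval (k l u : ℕ) : DyadicInterval :=
  if h : l < u then .finite (((u + l : ℕ) : ℚ) / 2 ^ (k + 1)) (((u - l : ℕ) : ℚ) / 2 ^ (k + 1))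
    (isDyadic_natCast_div _ _) (isDyadic_natCast_div _ _)
    (div_pos (Nat.cast_pos.2 (Nat.sub_pos_of_lt h)) (by positivity))
  else .whole

theorem toSet_gridInterval {k l u : ℕ} (h : l < u) :
    (gridInterval k l u).toSet = Set.Icc ((l : ℝ) / 2 ^ k) (u / 2 ^ k) := by
  rw [gridInterval, dif_pos h, DyadicInterval.toSet]
  push_cast
  rw [Nat.cast_sub h.le, pow_succ]
  congr 1 <;> · field_simp; ring

/-- The exponent `k` with `2 ^ (-k - 1) ≤ ε < 2 ^ (-k)`. -/
def gridExp (ε : ℚ) : ℕ := sInf {k | 1 ≤ ε * 2 ^ (k + 1)}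

theorem gridExp_spec {ε : ℚ} (pos : 0 < ε) (hε : ε < 1) :
    ε * 2 ^ gridExp ε < 1 ∧ 1 ≤ ε * 2 ^ (gridExp ε + 1) := by
  have hne : {k : ℕ | 1 ≤ ε * 2 ^ (k + 1)}.Nonempty := by
    obtain ⟨n, hn⟩ := pow_unbounded_of_one_lt (1 / ε) (one_lt_two (α := ℚ))
    refine ⟨n, ?_⟩
    rw [div_lt_iff₀ pos] at hn
    rw [Set.mem_ofPred_eq, pow_succ]
    linarith
  refine ⟨?_, Nat.sInf_mem hne⟩
  by_contra hcon
  rw [not_lt] at hcon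
  rcases hk : gridExp ε with _ | k
  · rw [hk] at hcon
    linarith
  · rw [hk] at hcon
    have : gridExp ε ≤ k := Nat.sInf_le hcon
    omega

theorem le_of_grid_bounds {ε δ : ℚ} {k l : ℕ} (pos : 0 < δ) (h : δ ≤ ε) (hk : ε * 2 ^ k < 1)
    (hl : 1 ≤ δ * 2 ^ (l + 1)) : k ≤ l := by
  by_contra hlt
  have h1 : (2 : ℚ) ^ (l + 1) ≤ 2 ^ k := pow_le_pow_right₀ (by norm_num) (by omega)
  have h2 : δ * 2 ^ (l + 1) ≤ ε * 2 ^ k := mul_le_mul h h1 (by positivity) (by linarith)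
  linarith

/-- The lower end of the grid interval around the interval with midpoint `r` and radius `ε`. -/
def gridLow (r ε : ℚ) : ℕ := ⌊(max r 0 - ε) * 2 ^ gridExp ε⌋₊

/-- The upper end of the grid interval around the interval with midpoint `r` and radius `ε`. -/
def gridHigh (r ε : ℚ) : ℕ := ⌊(max r 0 + ε) * 2 ^ gridExp ε⌋₊ + 1

/-- The precision that belongs to a grid interval. -/
def gridPrec (k l u : ℕ) : ℕ := 8 * k + 2 + (if u - l ≤ 1 then 4 else if u - l ≤ 2 then 2 else 0)

theorem gridLow_lt_gridHigh {r ε : ℚ} (pos : 0 < ε) : gridLow r ε < gridHigh r ε := by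
  refine Nat.lt_succ_of_le (Nat.floor_le_floor ?_)
  exact mul_le_mul_of_nonneg_right (by linarith) (by positivity)

theorem gridHigh_le {r ε : ℚ} (pos : 0 < ε) (hε : ε < 1) :
    gridHigh r ε ≤ gridLow r ε + 3 := by
  have h1 := (gridExp_spec pos hε).1
  have h2 : (max r 0 - ε) * 2 ^ gridExp ε < gridLow r ε + 1 := Nat.lt_floor_add_one _
  have h3 : ⌊(max r 0 + ε) * 2 ^ gridExp ε⌋₊ < gridLow r ε + 3 := by
    rw [Nat.floor_lt (by positivity)]
    push_cast
    linarith
  rw [gridHigh]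
  omega

theorem gridInterval_subset {k l u d l' u' : ℕ} (hlu : l < u) (hlu' : l' < u')
    (hl : l * 2 ^ d ≤ l') (hu : u' ≤ u * 2 ^ d) :
    (gridInterval (k + d) l' u').toSet ⊆ (gridInterval k l u).toSet := by
  rw [toSet_gridInterval hlu, toSet_gridInterval hlu']
  have hl2 : (l : ℝ) * 2 ^ d ≤ l' := by exact_mod_cast hl
  have hu2 : (u' : ℝ) ≤ u * 2 ^ d := by exact_mod_cast hu
  refine Set.Icc_subset_Icc ?_ ?_
  · rw [div_le_div_iff₀ (by positivity) (by positivity), pow_add]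
    nlinarith [pow_pos (two_pos (α := ℝ)) k]
  · rw [div_le_div_iff₀ (by positivity) (by positivity), pow_add]
    nlinarith [pow_pos (two_pos (α := ℝ)) k]

theorem refines_grid {r ε s δ : ℚ} (pos : 0 < δ) (hε : ε < 1) (h : |s - r| ≤ ε - δ) :
    Refines (gridInterval (gridExp δ) (gridLow s δ) (gridHigh s δ))
      (gridPrec (gridExp δ) (gridLow s δ) (gridHigh s δ))
      (gridInterval (gridExp ε) (gridLow r ε) (gridHigh r ε))
      (gridPrec (gridExp ε) (gridLow r ε) (gridHigh r ε)) := by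
  have h0 := (abs_nonneg _).trans h
  have hδε : δ ≤ ε := by linarith
  have pos' : 0 < ε := by linarith
  have hk : gridExp ε ≤ gridExp δ := le_of_grid_bounds pos hδε (gridExp_spec pos' hε).1
    (gridExp_spec pos (by linarith)).2
  have hm : |max s 0 - max r 0| ≤ ε - δ := (abs_max_sub_max_le_abs _ _ _).trans h
  have hm' := abs_le.1 hm
  obtain ⟨d, hd⟩ := Nat.exists_eq_add_of_le hk
  have hl : gridLow r ε * 2 ^ d ≤ gridLow s δ := by
    rcases Nat.eq_zero_or_pos (gridLow r ε) with h1 | h1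
    · rw [h1, Nat.zero_mul]
      exact Nat.zero_le _
    · refine Nat.le_floor ?_
      have h2 : (gridLow r ε : ℚ) ≤ (max r 0 - ε) * 2 ^ gridExp ε := by
        refine Nat.floor_le ?_
        by_contra hneg
        rw [gridLow, Nat.floor_of_nonpos (le_of_not_ge hneg)] at h1
        exact absurd h1 (lt_irrefl _)
      push_cast
      rw [hd, pow_add, ← mul_assoc]
      refine mul_le_mul_of_nonneg_right (h2.trans ?_) (by positivity)
      exact mul_le_mul_of_nonneg_right (by linarith [hm'.1]) (by positivity)
  have hu : gridHigh s δ ≤ gridHigh r ε * 2 ^ d := by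
    refine Nat.succ_le_of_lt ((Nat.floor_lt (by positivity)).2 ?_)
    have h2 : (max r 0 + ε) * 2 ^ gridExp ε < gridHigh r ε := by
      rw [gridHigh]
      push_cast
      exact Nat.lt_floor_add_one _
    push_cast
    rw [hd, pow_add, ← mul_assoc]
    refine mul_lt_mul_of_pos_right (lt_of_le_of_lt ?_ h2) (by positivity)
    exact mul_le_mul_of_nonneg_right (by linarith [hm'.2]) (by positivity)
  have hlu := gridLow_lt_gridHigh (r := r) pos'
  have hlu' := gridLow_lt_gridHigh (r := s) pos
  have hu3 := gridHigh_le (r := r) pos' hε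
  have hsub := gridInterval_subset (k := gridExp ε) hlu hlu' hl hu
  rw [hd]
  generalize gridLow r ε = l at *
  generalize gridHigh r ε = u at *
  generalize gridLow s δ = l' at *
  generalize gridHigh s δ = u' at *
  rcases Nat.eq_zero_or_pos d with rfl | hd0
  · rw [pow_zero, Nat.mul_one] at hl hu
    rw [Nat.add_zero] at hsub ⊢
    by_cases heq : l' = l ∧ u' = u
    · rw [heq.1, heq.2]
      exact Or.inl ⟨rfl, rfl⟩
    · refine Or.inr ⟨hsub, ?_⟩
      rw [gridPrec, gridPrec]
      split_ifs <;> omega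
  · refine Or.inr ⟨hsub, ?_⟩
    rw [gridPrec, gridPrec]
    split_ifs <;> omega

/-- Apply an operation to the grid interval around an interval and to its precision. -/
def onGrid (Φ : DyadicInterval → ℕ → DyadicInterval) : DyadicInterval → DyadicInterval
  | .finite r ε _ _ _ =>
    if |r| < 2 ^ 1 ∧ |ε| < 2 ^ 0 then
      Φ (gridInterval (gridExp ε) (gridLow r ε) (gridHigh r ε))
        (gridPrec (gridExp ε) (gridLow r ε) (gridHigh r ε))
    else .whole
  | .whole => .whole

theorem mem_gridInterval {r ε : ℚ} (pos : 0 < ε) {x : ℝ} (hx : |x - r| ≤ ε) (h0 : 0 ≤ x) :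
    x ∈ (gridInterval (gridExp ε) (gridLow r ε) (gridHigh r ε)).toSet := by
  rw [toSet_gridInterval (gridLow_lt_gridHigh pos)]
  have hx' := abs_le.1 hx
  have hm : x ≤ ((max r 0 + ε : ℚ) : ℝ) := by
    have : (r : ℝ) ≤ ((max r 0 : ℚ) : ℝ) := by exact_mod_cast le_max_left r 0
    push_cast at this ⊢
    linarith [hx'.2]
  have hm2 : ((max r 0 - ε : ℚ) : ℝ) ≤ x := by
    have h1 : ((ε : ℚ) : ℝ) > 0 := by exact_mod_cast pos
    rcases max_choice r 0 with h | h <;> rw [h] <;> push_cast <;> linarith [hx'.1]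
  constructor
  · rw [div_le_iff₀ (by positivity)]
    rcases le_total 0 ((max r 0 - ε) * 2 ^ gridExp ε) with h | h
    · have h1 : (gridLow r ε : ℚ) ≤ (max r 0 - ε) * 2 ^ gridExp ε := Nat.floor_le h
      have h2 : (gridLow r ε : ℝ) ≤ ((max r 0 - ε : ℚ) : ℝ) * 2 ^ gridExp ε := by exact_mod_cast h1
      exact h2.trans (mul_le_mul_of_nonneg_right hm2 (by positivity))
    · rw [gridLow, Nat.floor_of_nonpos h, Nat.cast_zero]
      positivity
  · rw [le_div_iff₀ (by positivity)]
    have h1 : (max r 0 + ε) * 2 ^ gridExp ε ≤ gridHigh r ε := by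
      rw [gridHigh]
      push_cast
      exact (Nat.lt_floor_add_one _).le
    have h2 : ((max r 0 + ε : ℚ) : ℝ) * 2 ^ gridExp ε ≤ gridHigh r ε := by exact_mod_cast h1
    exact (mul_le_mul_of_nonneg_right hm (by positivity)).trans h2

theorem onGrid_mem {Φ : DyadicInterval → ℕ → DyadicInterval} {h : C(unitInterval, ℝ)}
    (hmem : ∀ G p (x : unitInterval), (x : ℝ) ∈ G.toSet → h x ∈ (Φ G p).toSet)
    (J : DyadicInterval) (x : unitInterval) (hx : (x : ℝ) ∈ J.toSet) :
    h x ∈ (onGrid Φ J).toSet := by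
  cases J with
  | whole => trivial
  | finite r ε hr hε pos =>
    rw [onGrid]
    split_ifs
    · exact hmem _ _ _ (mem_gridInterval pos (mem_toSet_finite.1 hx) x.2.1)
    · trivial

theorem onGrid_mono {Φ : DyadicInterval → ℕ → DyadicInterval}
    (hmono : ∀ G p G' p', Refines G' p' G p → (G'.toSet ∩ Set.Icc 0 1).Nonempty →
      (Φ G' p').toSet ⊆ (Φ G p).toSet) (J K : DyadicInterval) (hKJ : K.toSet ⊆ J.toSet)
    (hK : (K.toSet ∩ Set.Icc 0 1).Nonempty) : (onGrid Φ K).toSet ⊆ (onGrid Φ J).toSet := by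
  cases J with
  | whole => exact Set.subset_univ _
  | finite r ε hr hε pos =>
    obtain ⟨s, δ, hs, hδ, pos', rfl, hle⟩ := exists_of_subset_finite hKJ
    obtain ⟨x, hx, hx01⟩ := hK
    rw [mem_toSet_finite] at hx
    rw [onGrid, onGrid]
    split_ifs with h1 h2 h2
    · rw [pow_zero, abs_of_pos pos] at h2
      exact hmono _ _ _ _ (refines_grid pos' h2.2 hle) ⟨x, mem_gridInterval pos' hx hx01.1, hx01⟩
    · exact Set.subset_univ _
    · exfalso
      apply h1
      rw [pow_zero, abs_of_pos pos] at h2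
      have h0 := (abs_nonneg _).trans hle
      have hδ1 : δ < 1 := by linarith
      refine ⟨?_, by rw [abs_of_pos pos', pow_zero]; exact hδ1⟩
      have hδ2 : (δ : ℝ) < 1 := by exact_mod_cast hδ1
      have hx' := abs_le.1 hx
      have : |(s : ℝ)| < 2 ^ 1 := by
        rw [abs_lt]
        constructor <;> linarith [hx'.1, hx'.2, hx01.1, hx01.2]
      exact_mod_cast this
    · rfl

theorem onGrid_modulusAt {Φ : DyadicInterval → ℕ → DyadicInterval} {n m : ℕ}
    (hmod : ∀ G p, (G.toSet ∩ Set.Icc 0 1).Nonempty → G.diam ≤ (((1 / 2) ^ m : ℚ) : WithTop ℚ) →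
      m ≤ p → (Φ G p).diam ≤ (((1 / 2) ^ n : ℚ) : WithTop ℚ)) :
    ModulusAt (onGrid Φ) n (m + 2) := by
  intro J hJ hd
  obtain ⟨r, ε, hr, hε, pos, rfl, hle⟩ := exists_of_diam_le hd
  obtain ⟨x, hx, hx01⟩ := hJ
  rw [mem_toSet_finite] at hx
  have hm1 : (1 / 2 : ℚ) ^ (m + 2) ≤ 1 := pow_le_one₀ (by norm_num) (by norm_num)
  have hε1 : ε < 1 := by linarith
  have hfit : |r| < 2 ^ 1 ∧ |ε| < 2 ^ 0 := by
    refine ⟨?_, by rw [abs_of_pos pos, pow_zero]; exact hε1⟩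
    have hε2 : (ε : ℝ) < 1 := by exact_mod_cast hε1
    have hx' := abs_le.1 hx
    have : |(r : ℝ)| < 2 ^ 1 := by
      rw [abs_lt]
      constructor <;> linarith [hx'.1, hx'.2, hx01.1, hx01.2]
    exact_mod_cast this
  rw [onGrid, if_pos hfit]
  have hk : m + 2 ≤ gridExp ε := by
    refine le_of_grid_bounds pos le_rfl ?_ (gridExp_spec pos hε1).2
    have h1 : (1 / 2 : ℚ) ^ (m + 2) * 2 ^ (m + 2) = 1 := by rw [← mul_pow]; norm_num
    have h2 : 2 * ε * 2 ^ (m + 2) ≤ (1 / 2 : ℚ) ^ (m + 2) * 2 ^ (m + 2) :=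
      mul_le_mul_of_nonneg_right hle (by positivity)
    linarith
  refine hmod _ _ ⟨x, mem_gridInterval pos hx hx01.1, hx01⟩ ?_ ?_
  · rw [gridInterval, dif_pos (gridLow_lt_gridHigh pos)]
    refine WithTop.coe_le_coe.2 ?_
    have h1 := gridHigh_le (r := r) pos hε1
    have h2 : ((gridHigh r ε - gridLow r ε : ℕ) : ℚ) ≤ 3 := by exact_mod_cast (by omega)
    have h3 : (1 : ℚ) / 2 ^ gridExp ε ≤ 1 / 4 * (1 / 2) ^ m := by
      rw [← one_div_pow]
      refine (half_pow_anti hk).trans (le_of_eq ?_)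
      rw [pow_add]
      norm_num
      ring
    rw [pow_succ, ← mul_div_assoc, mul_comm (2 : ℚ), mul_div_mul_right _ _ (by norm_num),
      ← mul_one_div]
    have h4 : ((gridHigh r ε - gridLow r ε : ℕ) : ℚ) * (1 / 2 ^ gridExp ε)
        ≤ 3 * (1 / 4 * (1 / 2) ^ m) := mul_le_mul h2 h3 (by positivity) (by norm_num)
    have h5 : (0 : ℚ) < (1 / 2) ^ m := by positivity
    linarith
  · rw [gridPrec]
    omega

/-! ### Interval functions of sums, differences, products and compositions -/

/-- An interval extension of `f` with the modulus `l`, where `l` also bounds the norm of `f`. -/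
structure IsControlled (Ψ : DyadicInterval → DyadicInterval) (f : C(unitInterval, ℝ))
    (l : ℕ → ℕ) : Prop where
  extension : IsIntervalExtension Ψ f
  modulus : ∀ n, ModulusAt Ψ n (l n)
  norm_le : ∀ n, ‖f‖ + 1 ≤ 2 ^ l n

section

variable {Ψ Χ : DyadicInterval → DyadicInterval} {f g h : C(unitInterval, ℝ)} {l : ℕ → ℕ}

theorem IsControlled.abs_le (hΨ : IsControlled Ψ f l) (x : unitInterval) (n : ℕ) :
    |f x| + 1 ≤ 2 ^ l n := by
  have := f.norm_coe_le_norm x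
  rw [Real.norm_eq_abs] at this
  linarith [hΨ.norm_le n]

theorem IsControlled.diam_trunc (hΨ : IsControlled Ψ f l) {G : DyadicInterval} {n m p : ℕ}
    {x : unitInterval} (hx : (x : ℝ) ∈ G.toSet) (hG : G.diam ≤ (((1 / 2) ^ m : ℚ) : WithTop ℚ))
    (hm : l (n + 1) ≤ m) (hp : l (n + 1) ≤ p) (hn : n + 4 ≤ p) :
    (trunc p (Ψ G)).diam ≤ (((1 / 2) ^ n : ℚ) : WithTop ℚ) :=
  diam_trunc_le (hΨ.extension.mem hx) (hΨ.abs_le x (n + 1))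
    ((hΨ.modulus (n + 1)).mono hm G ⟨x, hx, x.2⟩ hG) hp hn

theorem Refines.map (hΨ : IsIntervalExtension Ψ f) {G G' : DyadicInterval} {p p' : ℕ}
    (h : Refines G' p' G p) (hG : (G'.toSet ∩ Set.Icc 0 1).Nonempty) :
    Refines (Ψ G') p' (Ψ G) p := by
  rcases h with ⟨rfl, rfl⟩ | ⟨h1, h2⟩
  · exact Or.inl ⟨rfl, rfl⟩
  · exact Or.inr ⟨hΨ.mono h1 hG, h2⟩

theorem Refines.trunc {G G' : DyadicInterval} {p p' : ℕ} (h : Refines G' p' G p) :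
    Refines (trunc p' G') p' (trunc p G) p := by
  rcases h with ⟨rfl, rfl⟩ | ⟨h1, h2⟩
  · exact Or.inl ⟨rfl, rfl⟩
  · exact Or.inr ⟨trunc_mono (Or.inr ⟨h1, h2⟩), h2⟩

/-- The interval function that applies an operation to the truncated values of two interval
functions. -/
def pointwiseI (T : DyadicInterval → DyadicInterval → DyadicInterval)
    (Ψ Χ : DyadicInterval → DyadicInterval) : DyadicInterval → DyadicInterval :=
  onGrid fun G p => T (trunc p (Ψ G)) (trunc p (Χ G))

/-- The composition of interval functions with truncated values. -/
def compI (Ψ Χ : DyadicInterval → DyadicInterval) : DyadicInterval → DyadicInterval :=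
  onGrid fun G p => trunc p (Ψ (trunc p (Χ G)))

theorem isIntervalExtension_pointwiseI {T : DyadicInterval → DyadicInterval → DyadicInterval}
    {t : ℝ → ℝ → ℝ} (hT : IsEnclosure T t) (hΨ : IsIntervalExtension Ψ f)
    (hΧ : IsIntervalExtension Χ g) (hh : ∀ x, h x = t (f x) (g x))
    (hmod : ∀ n, ∃ N, ModulusAt (pointwiseI T Ψ Χ) n N) :
    IsIntervalExtension (pointwiseI T Ψ Χ) h := by
  refine isIntervalExtension_of (onGrid_mem fun G p x hx => ?_)
    (onGrid_mono fun G p G' p' hr hG => ?_) hmod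
  · rw [hh]
    exact hT.mem _ _ _ _ (subset_trunc _ _ (hΨ.mem hx)) (subset_trunc _ _ (hΧ.mem hx))
  · exact hT.mono _ _ _ _ (trunc_mono (hr.map hΨ hG)) (trunc_mono (hr.map hΧ hG))

theorem isIntervalExtension_compI {g : C(unitInterval, unitInterval)}
    (hΨ : IsIntervalExtension Ψ f) (hΧ : IsIntervalExtension Χ (toRealFun g))
    (hmod : ∀ n, ∃ N, ModulusAt (compI Ψ Χ) n N) : IsIntervalExtension (compI Ψ Χ) (f.comp g) := by
  refine isIntervalExtension_of (onGrid_mem fun G p x hx => ?_)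
    (onGrid_mono fun G p G' p' hr hG => ?_) hmod
  · exact subset_trunc _ _ (hΨ.mem (x := g x) (subset_trunc _ _ (hΧ.mem hx)))
  · refine trunc_mono (((hr.map hΧ hG).trunc).map hΨ ?_)
    obtain ⟨x, hx, hx01⟩ := hG
    exact ⟨g ⟨x, hx01⟩, subset_trunc _ _ (hΧ.mem (x := ⟨x, hx01⟩) hx), (g ⟨x, hx01⟩).2⟩

theorem modulusAt_addI (hΨ : IsControlled Ψ f l) (hΧ : IsControlled Χ g l) (n : ℕ) :
    ModulusAt (pointwiseI addI Ψ Χ) n (l (n + 1 + 1) + n + 7) ∧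
      ModulusAt (pointwiseI subI Ψ Χ) n (l (n + 1 + 1) + n + 7) := by
  have key : ∀ {G : DyadicInterval} {p : ℕ}, (G.toSet ∩ Set.Icc 0 1).Nonempty →
      G.diam ≤ (((1 / 2) ^ (l (n + 1 + 1) + n + 5) : ℚ) : WithTop ℚ) → l (n + 1 + 1) + n + 5 ≤ p →
      (addI (trunc p (Ψ G)) (trunc p (Χ G))).diam ≤ (((1 / 2) ^ n : ℚ) : WithTop ℚ) ∧
      (subI (trunc p (Ψ G)) (trunc p (Χ G))).diam ≤ (((1 / 2) ^ n : ℚ) : WithTop ℚ) := by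
    rintro G p ⟨x, hx, hx01⟩ hG hp
    lift x to unitInterval using hx01
    exact diam_addI_le (hΨ.diam_trunc hx hG (by omega) (by omega) (by omega))
      (hΧ.diam_trunc hx hG (by omega) (by omega) (by omega))
  exact ⟨onGrid_modulusAt (m := l (n + 1 + 1) + n + 5) fun G p hG hd hp => (key hG hd hp).1,
    onGrid_modulusAt (m := l (n + 1 + 1) + n + 5) fun G p hG hd hp => (key hG hd hp).2⟩

theorem modulusAt_mulI (hΨ : IsControlled Ψ f l) (hΧ : IsControlled Χ g l) (n : ℕ) :
    ModulusAt (pointwiseI mulI Ψ Χ) n (l (n + l n + 2 + 1) + n + l n + 8) := by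
  refine onGrid_modulusAt (m := l (n + l n + 2 + 1) + n + l n + 6) ?_
  rintro G p ⟨x, hx, hx01⟩ hG hp
  lift x to unitInterval using hx01
  exact diam_mulI_le (subset_trunc _ _ (hΨ.extension.mem hx))
    (subset_trunc _ _ (hΧ.extension.mem hx)) (hΨ.abs_le x n) (hΧ.abs_le x n)
    (hΨ.diam_trunc hx hG (by omega) (by omega) (by omega))
    (hΧ.diam_trunc hx hG (by omega) (by omega) (by omega))

theorem modulusAt_compI {g : C(unitInterval, unitInterval)} (hΨ : IsControlled Ψ f l)
    (hΧ : IsControlled Χ (toRealFun g) l) (n : ℕ) :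
    ModulusAt (compI Ψ Χ) n (l (l (n + 1) + 1) + l (n + 1) + n + 6) := by
  refine onGrid_modulusAt (m := l (l (n + 1) + 1) + l (n + 1) + n + 4) ?_
  rintro G p ⟨x, hx, hx01⟩ hG hp
  lift x to unitInterval using hx01
  exact hΨ.diam_trunc (x := g x) (m := l (n + 1)) (subset_trunc _ _ (hΧ.extension.mem hx))
    (hΧ.diam_trunc hx hG (by omega) (by omega) (by omega)) le_rfl (by omega) (by omega)

end

/-! ### Computing the grid interval -/

/-- Remove the last digits. -/
def dropEnd (n : ℕ) (s : Str) : Str := (s.reverse.drop n).reverse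

theorem bitsVal_dropEnd (n : ℕ) (s : Str) : bitsVal (dropEnd n s) = bitsVal s / 2 ^ n := by
  have h := bitsVal_reverse_split n s.reverse
  have hlt := bitsVal_lt (padTake n s.reverse).reverse
  rw [List.length_reverse, length_padTake] at hlt
  rw [List.reverse_reverse] at h
  rw [h, Nat.add_mul_div_left _ _ (by positivity), Nat.div_eq_of_lt hlt, Nat.zero_add, dropEnd]

theorem PT.dropEnd {f g : Baire → (ℕ → Str) → Str} (hf : PT f) (hg : PT g) :
    PT fun φ ρ => dropEnd (f φ ρ).length (g φ ρ) :=
  (hf.drop hg.reverse).reverse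

/-- The digits of the radius of an interval of radius less than `1`. -/
def radiusDigits (a : Str) : Str := padTake a.length (fracPart (col 2 a))

/-- A string whose length is the exponent of the grid. -/
def gridExpStr (a : Str) : Str := (radiusDigits a).takeWhile fun x => x = .zero

/-- The binary expansion of the lower end of the grid interval. -/
def gridLowStr (a : Str) : Str :=
  dropEnd (strip (radiusDigits a)).length (subM (posPart a.length (col 1 a)) (radiusDigits a))

/-- The binary expansion of the upper end of the grid interval. -/
def gridHighStr (a : Str) : Str :=
  addM (dropEnd (strip (radiusDigits a)).length
    (addM (posPart a.length (col 1 a)) (radiusDigits a))) [.one]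

/-- A code of the grid interval. -/
def gridCode (a : Str) : Str :=
  encode (addM (gridHighStr a) (gridLowStr a)) [] (subM (gridHighStr a) (gridLowStr a))
    (.zero :: gridExpStr a)

/-- A string of twice the length. -/
def double (s : Str) : Str := s ++ s

/-- A string whose length is the precision of the grid interval. -/
def gridPrecStr (a : Str) : Str :=
  double (double (double (gridExpStr a))) ++ .zero :: .zero ::
    if (strip (subM (subM (gridHighStr a) (gridLowStr a)) [.one])).head? = none then
      List.replicate 4 .zero
    else if (strip (subM (subM (gridHighStr a) (gridLowStr a)) [.one, .zero])).head? = none then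
      List.replicate 2 .zero
    else []

theorem PT.double {f : Baire → (ℕ → Str) → Str} (hf : PT f) :
    PT fun φ ρ => double (f φ ρ) := hf.append hf

theorem PT.radiusDigits {f : Baire → (ℕ → Str) → Str} (hf : PT f) :
    PT fun φ ρ => radiusDigits (f φ ρ) :=
  hf.padTake ((hf.col 2).dropWhile _).tail

theorem PT.gridExpStr {f : Baire → (ℕ → Str) → Str} (hf : PT f) :
    PT fun φ ρ => gridExpStr (f φ ρ) := hf.radiusDigits.takeWhile _

theorem PT.gridLowStr {f : Baire → (ℕ → Str) → Str} (hf : PT f) :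
    PT fun φ ρ => gridLowStr (f φ ρ) :=
  hf.radiusDigits.strip.dropEnd ((hf.posPart (hf.col 1)).subM hf.radiusDigits)

theorem PT.gridHighStr {f : Baire → (ℕ → Str) → Str} (hf : PT f) :
    PT fun φ ρ => gridHighStr (f φ ρ) :=
  (hf.radiusDigits.strip.dropEnd ((hf.posPart (hf.col 1)).addM hf.radiusDigits)).addM (PT.const _)

theorem PT.gridCode {f : Baire → (ℕ → Str) → Str} (hf : PT f) :
    PT fun φ ρ => gridCode (f φ ρ) :=
  PT.encode (hf.gridHighStr.addM hf.gridLowStr) PT.nil (hf.gridHighStr.subM hf.gridLowStr)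
    (hf.gridExpStr.cons _)

theorem PT.gridPrecStr {f : Baire → (ℕ → Str) → Str} (hf : PT f) :
    PT fun φ ρ => gridPrecStr (f φ ρ) := by
  have hd := hf.gridHighStr.subM hf.gridLowStr
  exact hf.gridExpStr.double.double.double.append (((PT.ite (p := fun o => o = none)
    (hd.subM (PT.const [.one])).strip (PT.const _) (PT.ite (p := fun o => o = none)
    (hd.subM (PT.const [.one, .zero])).strip (PT.const _) PT.nil)).cons _).cons _)

theorem CodesDyadic.floor_eq {s : Str} {q : ℚ} (h : CodesDyadic s q) {n : ℕ} (hn : s.length ≤ n) :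
    ((⌊q * 2 ^ n⌋₊ : ℕ) : ℚ) = max q 0 * 2 ^ n := by
  obtain ⟨i, f, rfl, -, -, rfl⟩ := h
  obtain ⟨d, rfl⟩ : ∃ d, n = f.length + d := ⟨n - f.length, by simp at hn; omega⟩
  have h1 : (codeSign i : ℚ) * ((bitsVal i.tail : ℚ) + bitsVal f / 2 ^ f.length)
      * 2 ^ (f.length + d)
      = ((codeSign i * (bitsVal i.tail * 2 ^ (f.length + d) + bitsVal f * 2 ^ d) : ℤ) : ℚ) := by
    push_cast
    rw [pow_add]
    field_simp
  have h2 : (0 : ℚ) ≤ 2 ^ (f.length + d) := by positivity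
  rw [max_mul_of_nonneg _ _ h2, h1, zero_mul, ← Int.floor_toNat, Int.floor_intCast]
  have h3 := Int.toNat_eq_max
    (codeSign i * (bitsVal i.tail * 2 ^ (f.length + d) + bitsVal f * 2 ^ d))
  exact_mod_cast h3

theorem length_col_pairStr (a b : Str) :
    (col 1 (pairStr a b)).length ≤ (pairStr a b).length ∧
      (col 2 (pairStr a b)).length ≤ (pairStr a b).length := by
  rw [pairStr_length, pairStr, col_flatMap _ _ (fun n => rfl) (by norm_num),
    col_flatMap _ _ (fun n => rfl) (by norm_num)]
  simp
  omega

theorem CodesInterval.cols {a : Str} {r ε : ℚ} {hr : IsDyadic r} {hε : IsDyadic ε} {pos : 0 < ε}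
    (h : CodesInterval a (.finite r ε hr hε pos)) :
    CodesDyadic (col 1 a) r ∧ CodesDyadic (col 2 a) ε ∧ (col 1 a).length ≤ a.length ∧
      (col 2 a).length ≤ a.length := by
  obtain ⟨b, c, rfl, hb, hc⟩ := h
  exact ⟨(hb.col hc).1, (hb.col hc).2, length_col_pairStr b c⟩

theorem CodesDyadic.posPart_of_fits {s : Str} {ε : ℚ} (h : CodesDyadic s ε) (pos : 0 < ε)
    (hf : Fits 0 s) (n : ℕ) : posPart n s = IntervalComplexity.padTake n (fracPart s) := by
  obtain ⟨i, f, rfl, hi, -, rfl⟩ := h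
  rw [fits_append hi.1] at hf
  rcases i with _ | ⟨_ | _ | _, _ | ⟨y, i⟩⟩
  · rfl
  · rfl
  · simp at hf
  · exfalso
    simp only [codeSign, List.tail_cons, bitsVal_nil, Int.cast_neg, Int.cast_one] at pos
    have : (0 : ℚ) ≤ bitsVal f / 2 ^ f.length := by positivity
    push_cast at pos
    linarith
  · simp at hf
  · exact absurd hi.1 (by simp [IsBits])
  · simp at hf

theorem floor_eq_div {x : ℚ} {m j : ℕ} (h : (m : ℚ) = x * 2 ^ j) : ⌊x⌋₊ = m / 2 ^ j := by
  have h1 : x = (m : ℚ) / ((2 ^ j : ℕ) : ℚ) := by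
    rw [h]
    push_cast
    field_simp
  rw [h1, Nat.floor_div_eq_div]

theorem grid_spec {a : Str} {r ε : ℚ} {hr : IsDyadic r} {hε : IsDyadic ε} {pos : 0 < ε}
    (h : CodesInterval a (.finite r ε hr hε pos)) (hfit : |ε| < 2 ^ 0) :
    (gridExpStr a).length = gridExp ε ∧ bitsVal (gridLowStr a) = gridLow r ε ∧
      bitsVal (gridHighStr a) = gridHigh r ε := by
  obtain ⟨h1, h2, hl1, hl2⟩ := h.cols
  have hE : posPart a.length (col 2 a) = radiusDigits a :=
    h2.posPart_of_fits pos ((h2.fits_iff 0).2 hfit) _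
  have hEv : (bitsVal (radiusDigits a) : ℚ) = ε * 2 ^ a.length := by
    rw [← hE, h2.bitsVal_posPart, h2.floor_eq hl2, max_eq_left pos.le]
  have hRv : (bitsVal (posPart a.length (col 1 a)) : ℚ) = max r 0 * 2 ^ a.length := by
    rw [h1.bitsVal_posPart, h1.floor_eq hl1]
  have hbits : IsBits (radiusDigits a) := by
    obtain ⟨i, f, hs, hi, hf, -⟩ := h2
    rw [radiusDigits, hs, fracPart_append hi.1]
    exact hf.padTake _
  have hlen : (gridExpStr a).length + (strip (radiusDigits a)).length = a.length := by
    have := congrArg List.length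
      (List.takeWhile_append_dropWhile (p := fun x => decide (x = Letter.zero))
        (l := radiusDigits a))
    rwa [List.length_append, radiusDigits, length_padTake] at this
  have hpos : 0 < bitsVal (radiusDigits a) := by
    have : (0 : ℚ) < bitsVal (radiusDigits a) := by rw [hEv]; positivity
    exact_mod_cast this
  obtain ⟨t, ht⟩ := hbits.strip.2.resolve_left fun h0 =>
    hpos.ne' ((strip_eq_nil_iff hbits).1 h0)
  have hval := bitsVal_strip (radiusDigits a)
  have hlt := bitsVal_lt (strip (radiusDigits a))
  have hge : 2 ^ t.length ≤ bitsVal (radiusDigits a) := by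
    rw [← hval, ht, bitsVal_cons]
    simp [Letter.bit]
  rw [hval] at hlt
  have hk : (gridExpStr a).length = gridExp ε := by
    have hε1 : ε < 1 := by rwa [abs_of_pos pos, pow_zero] at hfit
    have hs := gridExp_spec pos hε1
    have hltQ : ε * 2 ^ a.length < 2 ^ (strip (radiusDigits a)).length := by
      rw [← hEv]; exact_mod_cast hlt
    have hgeQ : 2 ^ t.length ≤ ε * 2 ^ a.length := by
      rw [← hEv]; exact_mod_cast hge
    apply le_antisymm
    · refine le_of_grid_bounds pos le_rfl ?_ hs.2
      rw [← hlen, pow_add, ← mul_assoc] at hltQ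
      by_contra hcon
      have := mul_le_mul_of_nonneg_right (not_lt.1 hcon)
        (by positivity : (0 : ℚ) ≤ 2 ^ (strip (radiusDigits a)).length)
      linarith
    · refine le_of_grid_bounds pos le_rfl hs.1 ?_
      rw [ht, List.length_cons] at hlen
      rw [← hlen, show (gridExpStr a).length + (t.length + 1)
        = (gridExpStr a).length + 1 + t.length by ring, pow_add, ← mul_assoc] at hgeQ
      by_contra hcon
      have := mul_lt_mul_of_pos_right (not_le.1 hcon)
        (by positivity : (0 : ℚ) < 2 ^ t.length)
      linarith
  rw [hk] at hlen
  refine ⟨hk, ?_, ?_⟩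
  · rw [gridLowStr, bitsVal_dropEnd, bitsVal_subM, gridLow]
    rcases le_total (bitsVal (radiusDigits a)) (bitsVal (posPart a.length (col 1 a))) with hle | hle
    · refine (floor_eq_div ?_).symm
      rw [Nat.cast_sub hle, hRv, hEv, ← hlen, pow_add]
      ring
    · rw [Nat.sub_eq_zero_of_le hle, Nat.zero_div, eq_comm]
      refine Nat.floor_of_nonpos (mul_nonpos_of_nonpos_of_nonneg ?_ (by positivity))
      have : (bitsVal (posPart a.length (col 1 a)) : ℚ) ≤ bitsVal (radiusDigits a) := by
        exact_mod_cast hle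
      rw [hRv, hEv] at this
      linarith [le_of_mul_le_mul_right this (by positivity)]
  · rw [gridHighStr, bitsVal_addM, bitsVal_dropEnd, bitsVal_addM, gridHigh, bitsVal_singleton]
    congr 1
    refine (floor_eq_div ?_).symm
    rw [Nat.cast_add, hRv, hEv, ← hlen, pow_add]
    ring

theorem codesInterval_gridCode {a : Str} {r ε : ℚ} {hr : IsDyadic r} {hε : IsDyadic ε}
    {pos : 0 < ε} (h : CodesInterval a (.finite r ε hr hε pos)) (hfit : |ε| < 2 ^ 0) :
    CodesInterval (gridCode a) (gridInterval (gridExp ε) (gridLow r ε) (gridHigh r ε)) := by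
  obtain ⟨h1, h2, h3⟩ := grid_spec h hfit
  rw [gridInterval, dif_pos (gridLow_lt_gridHigh pos)]
  refine codesInterval_encode _ _ _ _ _ _ _ ?_ ?_
  · rw [bitsVal_addM, h2, h3, List.length_cons, h1, bitsVal_nil]
    simp
  · rw [bitsVal_subM, h2, h3, List.length_cons, h1]

theorem length_gridPrecStr {a : Str} {r ε : ℚ} {hr : IsDyadic r} {hε : IsDyadic ε}
    {pos : 0 < ε} (h : CodesInterval a (.finite r ε hr hε pos)) (hfit : |ε| < 2 ^ 0) :
    (gridPrecStr a).length = gridPrec (gridExp ε) (gridLow r ε) (gridHigh r ε) := by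
  obtain ⟨h1, h2, h3⟩ := grid_spec h hfit
  have key : ∀ c : Str, ((strip (subM (subM (gridHighStr a) (gridLowStr a)) c)).head? = none ↔
      gridHigh r ε - gridLow r ε ≤ bitsVal c) := by
    intro c
    rw [List.head?_eq_none_iff, strip_eq_nil_iff (isBits_subM _ _), bitsVal_subM, bitsVal_subM, h2,
      h3]
    omega
  have hv1 : bitsVal [Letter.one] = 1 := rfl
  have hv2 : bitsVal [Letter.one, Letter.zero] = 2 := rfl
  rw [gridPrecStr, gridPrec, List.length_append, List.length_cons, List.length_cons]
  simp only [key, hv1, hv2, double, List.length_append, h1]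
  split_ifs <;> simp <;> omega

/-! ### Asking the oracle -/

/-- The beginning of the answer of the oracle that suffices to find the truncation of the
interval. -/
def fetch (φ : Baire) (p w : Str) : Str :=
  (φ w).take (double (p ++ double p) ++ List.replicate 6 Letter.zero).length

theorem length_fetch_arg (p : Str) :
    (double (p ++ double p) ++ List.replicate 6 Letter.zero).length = 3 * (2 * p.length + 2) := by
  simp [double]
  ring

theorem PT.fetch {f g : Baire → (ℕ → Str) → Str} (hf : PT f) (hg : PT g) :
    PT fun φ ρ => fetch φ (f φ ρ) (g φ ρ) :=
  PT.app2 (h := fun φ w n => (φ w).take n.length) PT.oracle hg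
    ((hf.append hf.double).double.append (PT.const _))

/-- The radius of the truncation. -/
def truncRadius (p s : Str) : Str := addM (posPart p.length (col 2 s)) [.one, .one]

/-- The truncation is a finite interval. -/
def Truncates (p s : Str) : Prop := Fits p.length (col 1 s) ∧ Fits p.length (col 2 s)

open Classical in
theorem PT.iteTruncates {f g h k : Baire → (ℕ → Str) → Str} (hf : PT f) (hg : PT g) (hh : PT h)
    (hk : PT k) : PT fun φ ρ => if Truncates (f φ ρ) (g φ ρ) then h φ ρ else k φ ρ := by
  refine (PT.iteFits hf (hg.col 1) (PT.iteFits hf (hg.col 2) hh hk) hk).congr fun φ ρ => ?_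
  by_cases hT : Truncates (f φ ρ) (g φ ρ)
  · rw [if_pos hT, if_pos hT.1, if_pos hT.2]
  · rw [if_neg hT]
    by_cases h1 : Fits (f φ ρ).length (IntervalComplexity.col 1 (g φ ρ))
    · rw [if_pos h1, if_neg fun h2 => hT ⟨h1, h2⟩]
    · rw [if_neg h1]

theorem PT.truncRadius {f g : Baire → (ℕ → Str) → Str} (hf : PT f) (hg : PT g) :
    PT fun φ ρ => truncRadius (f φ ρ) (g φ ρ) :=
  (hf.posPart (hg.col 2)).addM (PT.const _)

/-- The string determines the midpoint `r` and the radius `ε` of a truncated interval. -/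
structure Reads (p s : Str) (r ε : ℚ) : Prop where
  midpoint : r = (bitsVal (posPart p.length (col 1 s)) : ℚ) / 2 ^ p.length
    - (bitsVal (negPart p.length (col 1 s)) : ℚ) / 2 ^ p.length
  radius : ε = (bitsVal (truncRadius p s) : ℚ) / 2 ^ p.length

theorem Reads.abs_eq {p s : Str} {r ε : ℚ} (h : Reads p s r ε) :
    |r| = (bitsVal (scaled p.length (col 1 s)) : ℚ) / 2 ^ p.length := by
  rw [h.midpoint, posPart, negPart]
  split_ifs
  · rw [bitsVal_nil, Nat.cast_zero, zero_div, zero_sub, abs_neg, abs_of_nonneg (by positivity)]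
  · rw [bitsVal_nil, Nat.cast_zero, zero_div, sub_zero, abs_of_nonneg (by positivity)]

theorem trunc_spec {φ : Baire} {p w : Str} {K : DyadicInterval} (h : CodesInterval (φ w) K) :
    (¬ Truncates p (fetch φ p w) ∧ trunc p.length K = .whole) ∨
      (Truncates p (fetch φ p w) ∧ ∃ r ε hr hε pos, trunc p.length K = .finite r ε hr hε pos ∧
        Reads p (fetch φ p w) r ε) := by
  rw [fetch, length_fetch_arg]
  cases K with
  | whole =>
    refine Or.inl ⟨fun hT => ?_, rfl⟩
    have hw : φ w = [.point] := h
    rw [hw, List.take_of_length_le (by simp; omega)] at hT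
    exact absurd hT.1.1 (by simp [col, colStep])
  | finite r ε hr hε pos =>
    obtain ⟨a, b, hab, ha, hb⟩ := h
    obtain ⟨h1, h2⟩ := ha.col hb
    obtain ⟨h3, h4⟩ := col_take_pairStr a b (2 * p.length + 2)
    rw [hab, trunc]
    have hT : Truncates p ((pairStr a b).take (3 * (2 * p.length + 2))) ↔
        |r| < 2 ^ p.length ∧ |ε| < 2 ^ p.length := by
      rw [Truncates, h3, h4, (h1.fits_take _).1, (h2.fits_take _).1, h1.fits_iff, h2.fits_iff]
    by_cases hfit : |r| < 2 ^ p.length ∧ |ε| < 2 ^ p.length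
    · refine Or.inr ⟨hT.2 hfit, _, _, _, _, _, if_pos hfit, ?_⟩
      obtain ⟨h5, h6⟩ := (h1.fits_take _).2 ((h1.fits_iff _).2 hfit.1)
      obtain ⟨h7, -⟩ := (h2.fits_take _).2 ((h2.fits_iff _).2 hfit.2)
      constructor
      · rw [h3, h5, h6, h1.bitsVal_posPart, h1.bitsVal_negPart]
      · rw [truncRadius, h4, h7, bitsVal_addM, h2.bitsVal_posPart]
        rfl
    · exact Or.inl ⟨fun h => hfit (hT.1 h), if_neg hfit⟩

/-! ### String functions for the operations -/

open Classical in
/-- Apply a string function to the grid interval and its precision. -/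
def onGridStr (F : Baire → Str → Str → Str) (φ : Baire) (a : Str) : Str :=
  if Fits 1 (col 1 a) then
    if Fits 0 (col 2 a) then F φ (gridPrecStr a) (gridCode a) else [.point]
  else [.point]

theorem PT.onGridStr {F : Baire → Str → Str → Str} (hF : PT fun φ ρ => F φ (ρ 0) (ρ 1)) :
    PT fun φ ρ => onGridStr F φ (ρ 0) :=
  PT.iteFits (PT.const [.zero]) ((PT.var 0).col 1)
    (PT.iteFits PT.nil ((PT.var 0).col 2)
      (PT.app2 hF (PT.var 0).gridPrecStr (PT.var 0).gridCode) (PT.const _)) (PT.const _)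

theorem codesIntervalFun_onGridStr {F : Baire → Str → Str → Str} {φ : Baire}
    {Φ : DyadicInterval → ℕ → DyadicInterval}
    (hF : ∀ G p w, CodesInterval w G → CodesInterval (F φ p w) (Φ G p.length)) :
    CodesIntervalFun (onGridStr F φ) (onGrid Φ) := by
  intro J a h
  cases J with
  | whole =>
    have ha : a = [.point] := h
    rw [onGridStr, if_neg]
    · rfl
    · rw [ha]
      exact fun hT => absurd hT.1 (by simp [col, colStep])
  | finite r ε hr hε pos =>
    obtain ⟨h1, h2, -, -⟩ := h.cols
    rw [onGridStr, onGrid, h1.fits_iff, h2.fits_iff]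
    by_cases hf1 : |r| < 2 ^ 1
    · by_cases hf2 : |ε| < 2 ^ 0
      · rw [if_pos hf1, if_pos hf2, if_pos ⟨hf1, hf2⟩, ← length_gridPrecStr h hf2]
        exact hF _ _ _ (codesInterval_gridCode h hf2)
      · rw [if_pos hf1, if_neg hf2, if_neg fun hc => hf2 hc.2]
        rfl
    · rw [if_neg hf1, if_neg fun hc => hf1 hc.1]
      rfl

open Classical in
/-- Ask for the values of two interval functions and apply an operation to them. -/
def pointwiseStr (op : Str → Str → Str → Str) (φ : Baire) (p w : Str) : Str :=
  if Truncates p (fetch φ p (.zero :: w)) then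
    if Truncates p (fetch φ p (.one :: w)) then
      op p (fetch φ p (.zero :: w)) (fetch φ p (.one :: w))
    else [.point]
  else [.point]

theorem PT.pointwiseStr {op : Str → Str → Str → Str}
    (hop : PT fun _ ρ => op (ρ 0) (ρ 1) (ρ 2)) :
    PT fun φ ρ => pointwiseStr op φ (ρ 0) (ρ 1) :=
  have h0 := (PT.var 0).fetch ((PT.var 1).cons .zero)
  have h1 := (PT.var 0).fetch ((PT.var 1).cons .one)
  PT.iteTruncates (PT.var 0) h0 (PT.iteTruncates (PT.var 0) h1
    (PT.app3 (h := fun _ => op) hop (PT.var 0) h0 h1) (PT.const _)) (PT.const _)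

/-- The string function computes the operation on truncated intervals. -/
def CodesOperation (op : Str → Str → Str → Str)
    (T : DyadicInterval → DyadicInterval → DyadicInterval) : Prop :=
  ∀ p s t r ε hr hε pos r' ε' hr' hε' pos', Reads p s r ε → Reads p t r' ε' →
    CodesInterval (op p s t) (T (.finite r ε hr hε pos) (.finite r' ε' hr' hε' pos'))

theorem codesInterval_pointwiseStr {op : Str → Str → Str → Str}
    {T : DyadicInterval → DyadicInterval → DyadicInterval} (hop : CodesOperation op T)
    (hT : ∀ K L, K = .whole ∨ L = .whole → T K L = .whole) {ψ χ : Baire}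
    {Ψ Χ : DyadicInterval → DyadicInterval} (hψ : CodesIntervalFun ψ Ψ)
    (hχ : CodesIntervalFun χ Χ) (G : DyadicInterval) (p w : Str) (hw : CodesInterval w G) :
    CodesInterval (pointwiseStr op (pairFun ψ χ) p w)
      (T (trunc p.length (Ψ G)) (trunc p.length (Χ G))) := by
  have h1 := trunc_spec (φ := pairFun ψ χ) (p := p) (w := .zero :: w) (hψ G w hw)
  have h2 := trunc_spec (φ := pairFun ψ χ) (p := p) (w := .one :: w) (hχ G w hw)
  rw [pointwiseStr]
  rcases h1 with ⟨h1, h3⟩ | ⟨h1, r, ε, hr, hε, pos, h3, h4⟩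
  · rw [if_neg h1, hT _ _ (Or.inl h3)]
    rfl
  · rw [if_pos h1]
    rcases h2 with ⟨h2, h5⟩ | ⟨h2, r', ε', hr', hε', pos', h5, h6⟩
    · rw [if_neg h2, hT _ _ (Or.inr h5)]
      rfl
    · rw [if_pos h2, h3, h5]
      exact hop _ _ _ _ _ _ _ _ _ _ _ _ _ h4 h6

/-- The sum of two truncated intervals. -/
def addStr (p s t : Str) : Str :=
  encode (addM (posPart p.length (col 1 s)) (posPart p.length (col 1 t)))
    (addM (negPart p.length (col 1 s)) (negPart p.length (col 1 t)))
    (addM (truncRadius p s) (truncRadius p t)) p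

/-- The difference of two truncated intervals. -/
def subStr (p s t : Str) : Str :=
  encode (addM (posPart p.length (col 1 s)) (negPart p.length (col 1 t)))
    (addM (negPart p.length (col 1 s)) (posPart p.length (col 1 t)))
    (addM (truncRadius p s) (truncRadius p t)) p

/-- The product of two truncated intervals. -/
def mulStr (p s t : Str) : Str :=
  encode
    (addM (mulM (posPart p.length (col 1 s)) (posPart p.length (col 1 t)))
      (mulM (negPart p.length (col 1 s)) (negPart p.length (col 1 t))))
    (addM (mulM (posPart p.length (col 1 s)) (negPart p.length (col 1 t)))
      (mulM (negPart p.length (col 1 s)) (posPart p.length (col 1 t))))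
    (addM (mulM (scaled p.length (col 1 s)) (truncRadius p t))
      (mulM (truncRadius p s) (addM (scaled p.length (col 1 t)) (truncRadius p t))))
    (double p)

theorem PT.addStr : PT fun _ ρ => addStr (ρ 0) (ρ 1) (ρ 2) :=
  have h1 := (PT.var 1).col 1
  have h2 := (PT.var 2).col 1
  (((PT.var 0).posPart h1).addM ((PT.var 0).posPart h2)).encode
    (((PT.var 0).negPart h1).addM ((PT.var 0).negPart h2))
    (((PT.var 0).truncRadius (PT.var 1)).addM ((PT.var 0).truncRadius (PT.var 2))) (PT.var 0)

theorem PT.subStr : PT fun _ ρ => subStr (ρ 0) (ρ 1) (ρ 2) :=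
  have h1 := (PT.var 1).col 1
  have h2 := (PT.var 2).col 1
  (((PT.var 0).posPart h1).addM ((PT.var 0).negPart h2)).encode
    (((PT.var 0).negPart h1).addM ((PT.var 0).posPart h2))
    (((PT.var 0).truncRadius (PT.var 1)).addM ((PT.var 0).truncRadius (PT.var 2))) (PT.var 0)

theorem PT.mulStr : PT fun _ ρ => mulStr (ρ 0) (ρ 1) (ρ 2) :=
  have h1 := (PT.var 1).col 1
  have h2 := (PT.var 2).col 1
  have p1 := (PT.var 0).posPart h1
  have p2 := (PT.var 0).posPart h2
  have n1 := (PT.var 0).negPart h1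
  have n2 := (PT.var 0).negPart h2
  have e1 := (PT.var 0).truncRadius (PT.var 1)
  have e2 := (PT.var 0).truncRadius (PT.var 2)
  ((p1.mulM p2).addM (n1.mulM n2)).encode ((p1.mulM n2).addM (n1.mulM p2))
    ((((PT.var 0).scaled h1).mulM e2).addM (e1.mulM (((PT.var 0).scaled h2).addM e2)))
    (PT.var 0).double

theorem codesOperation_addStr : CodesOperation addStr addI := by
  intro p s t r ε hr hε pos r' ε' hr' hε' pos' h1 h2
  refine codesInterval_encode _ _ _ _ _ _ _ ?_ ?_
  · rw [bitsVal_addM, bitsVal_addM, h1.midpoint, h2.midpoint]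
    push_cast
    ring
  · rw [bitsVal_addM, h1.radius, h2.radius]
    push_cast
    ring

theorem codesOperation_subStr : CodesOperation subStr subI := by
  intro p s t r ε hr hε pos r' ε' hr' hε' pos' h1 h2
  refine codesInterval_encode _ _ _ _ _ _ _ ?_ ?_
  · rw [bitsVal_addM, bitsVal_addM, h1.midpoint, h2.midpoint]
    push_cast
    ring
  · rw [bitsVal_addM, h1.radius, h2.radius]
    push_cast
    ring

theorem codesOperation_mulStr : CodesOperation mulStr mulI := by
  intro p s t r ε hr hε pos r' ε' hr' hε' pos' h1 h2
  refine codesInterval_encode _ _ _ _ _ _ _ ?_ ?_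
  · rw [bitsVal_addM, bitsVal_addM, bitsVal_mulM, bitsVal_mulM, bitsVal_mulM, bitsVal_mulM,
      h1.midpoint, h2.midpoint, double, List.length_append, pow_add]
    push_cast
    field_simp
    ring
  · rw [bitsVal_addM, bitsVal_mulM, bitsVal_mulM, bitsVal_addM, h1.abs_eq, h2.abs_eq, h1.radius,
      h2.radius, double, List.length_append, pow_add]
    push_cast
    field_simp

open Classical in
/-- A code of a truncated interval. -/
def truncStr (p s : Str) : Str :=
  if Truncates p s then
    encode (posPart p.length (col 1 s)) (negPart p.length (col 1 s)) (truncRadius p s) p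
  else [.point]

theorem PT.truncStr {f g : Baire → (ℕ → Str) → Str} (hf : PT f) (hg : PT g) :
    PT fun φ ρ => truncStr (f φ ρ) (g φ ρ) :=
  PT.iteTruncates hf hg ((hf.posPart (hg.col 1)).encode (hf.negPart (hg.col 1))
    (hf.truncRadius hg) hf) (PT.const _)

theorem codesInterval_truncStr {φ : Baire} {p w : Str} {K : DyadicInterval}
    (h : CodesInterval (φ w) K) :
    CodesInterval (truncStr p (fetch φ p w)) (trunc p.length K) := by
  rw [truncStr]
  rcases trunc_spec (p := p) h with ⟨h1, h2⟩ | ⟨h1, r, ε, hr, hε, pos, h2, h3⟩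
  · rw [if_neg h1, h2]
    rfl
  · rw [if_pos h1, h2]
    exact codesInterval_encode _ _ _ _ _ _ _ (by rw [h3.midpoint, sub_div]) h3.radius

/-- Ask for the value of the second interval function, then for the value of the first one there. -/
def compStr (φ : Baire) (p w : Str) : Str :=
  truncStr p (fetch φ p (.zero :: truncStr p (fetch φ p (.one :: w))))

theorem PT.compStr : PT fun φ ρ => compStr φ (ρ 0) (ρ 1) :=
  (PT.var 0).truncStr ((PT.var 0).fetch
    (((PT.var 0).truncStr ((PT.var 0).fetch ((PT.var 1).cons .one))).cons .zero))

theorem codesInterval_compStr {ψ χ : Baire} {Ψ Χ : DyadicInterval → DyadicInterval}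
    (hψ : CodesIntervalFun ψ Ψ) (hχ : CodesIntervalFun χ Χ) (G : DyadicInterval) (p w : Str)
    (hw : CodesInterval w G) :
    CodesInterval (compStr (pairFun ψ χ) p w)
      (trunc p.length (Ψ (trunc p.length (Χ G)))) := by
  have h1 : CodesInterval (truncStr p (fetch (pairFun ψ χ) p (.one :: w)))
      (trunc p.length (Χ G)) :=
    codesInterval_truncStr (φ := pairFun ψ χ) (w := .one :: w) (hχ G w hw)
  exact codesInterval_truncStr (φ := pairFun ψ χ) (hψ _ _ h1)

/-! ### Polynomial time computability -/

theorem logb_ceil_le_iff {c : ℝ} (hc : 0 ≤ c) {n : ℕ} :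
    ⌈Real.logb 2 (c + 1)⌉₊ ≤ n ↔ c + 1 ≤ 2 ^ n := by
  rw [Nat.ceil_le, Real.logb_le_iff_le_rpow (by norm_num) (by linarith), Real.rpow_natCast]

theorem param_intervalFunctions {ψ : Baire} {f : C(unitInterval, ℝ)} (hf : IsFunName ψ f)
    (h : (intervalFunctions.rep ψ).Dom) (n : ℕ) :
    intervalFunctions.param ψ h n = ⌈Real.logb 2 (‖f‖ + 1)⌉₊ + sInf (moduli ψ n) := by
  have : Exists.choose h = f := isFunName_unique (Exists.choose_spec h) hf
  show ⌈Real.logb 2 (‖Exists.choose h‖ + 1)⌉₊ + sInf (moduli ψ n) = _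
  rw [this]

theorem exists_isControlled {ψ : Baire} {f : C(unitInterval, ℝ)} (hf : IsFunName ψ f)
    (h : (intervalFunctions.rep ψ).Dom) {l : ℕ → ℕ}
    (hl : ∀ n, intervalFunctions.param ψ h n ≤ l n) :
    ∃ Ψ, CodesIntervalFun ψ Ψ ∧ IsControlled Ψ f l := by
  obtain ⟨Ψ, h1, h2⟩ := id hf
  have hl' : ∀ n, ⌈Real.logb 2 (‖f‖ + 1)⌉₊ + sInf (moduli ψ n) ≤ l n := fun n => by
    rw [← param_intervalFunctions hf h]
    exact hl n
  refine ⟨Ψ, h1, h2, fun n => ?_, fun n => ?_⟩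
  · exact ((mem_moduli_iff h1).1 (Nat.sInf_mem (moduli_nonempty hf n))).mono
      (le_trans (Nat.le_add_left _ _) (hl' n))
  · exact (logb_ceil_le_iff (norm_nonneg _)).1 (le_trans (Nat.le_add_right _ _) (hl' n))

theorem IsSecondOrderPoly.param : IsSecondOrderPoly fun l n => l n := by
  simpa using IsSecondOrderPoly.app (.poly (.X))

theorem IsSecondOrderPoly.arg : IsSecondOrderPoly fun _ n => n := by
  simpa using IsSecondOrderPoly.poly (.X)

theorem IsSecondOrderPoly.const (c : ℕ) : IsSecondOrderPoly fun _ _ => c := by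
  simpa using IsSecondOrderPoly.poly (c : ℕ[X])

theorem polytimeComputable_of {X : Type} {𝕏 : PreparametrisedSpace X} {F : X → C(unitInterval, ℝ)}
    {S : Baire → Str → Str} (hS : PT fun φ ρ => S φ (ρ 0)) {Q : (ℕ → ℕ) → ℕ → ℕ}
    (hQ : IsSecondOrderPoly Q)
    (h : ∀ φ x, x ∈ 𝕏.rep φ → ∀ hφ : (𝕏.rep φ).Dom, ∃ (Θ : DyadicInterval → DyadicInterval)
      (A B : ℕ → ℕ), CodesIntervalFun (S φ) Θ ∧ IsIntervalExtension Θ (F x) ∧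
      (∀ n, ‖F x‖ + 1 ≤ 2 ^ A n) ∧ (∀ n, ModulusAt Θ n (B n)) ∧
      ∀ n, A n + B n ≤ Q (𝕏.param φ hφ) n) : PolytimeComputable 𝕏 intervalFunctions F := by
  obtain ⟨M, p, ht, hM⟩ := hS.exists_machine
  refine ⟨M, fun _ n => p.eval n, Q, ?_, .poly p, hQ, fun φ _ a => ht φ a, ?_⟩
  · intro φ x hx
    obtain ⟨Θ, A, B, h1, h2, -⟩ := h φ x hx hx.1
    exact ⟨S φ, hM φ, (mem_intervalFunctions_rep _ _).2 ⟨Θ, h1, h2⟩⟩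
  · intro φ hφ ψ hψ h' n
    obtain rfl := Part.mem_unique hψ (hM φ)
    obtain ⟨Θ, A, B, h1, h2, h3, h4, h5⟩ := h φ _ (Part.get_mem hφ) hφ
    rw [param_intervalFunctions ⟨Θ, h1, h2⟩]
    refine le_trans (add_le_add ?_ (Nat.sInf_le ((mem_moduli_iff h1).2 (h4 n)))) (h5 n)
    exact (logb_ceil_le_iff (norm_nonneg _)).2 (h3 n)

theorem exists_controlled_of_mem_prod {φ : Baire} {f g : C(unitInterval, ℝ)}
    (h : (f, g) ∈ (intervalFunctions.prod intervalFunctions).rep φ)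
    (hφ : ((intervalFunctions.prod intervalFunctions).rep φ).Dom) :
    ∃ ψ χ Ψ Χ, φ = pairFun ψ χ ∧ CodesIntervalFun ψ Ψ ∧ CodesIntervalFun χ Χ ∧
      IsControlled Ψ f ((intervalFunctions.prod intervalFunctions).param φ hφ) ∧
      IsControlled Χ g ((intervalFunctions.prod intervalFunctions).param φ hφ) := by
  obtain ⟨ψ, χ, rfl, h1, h2⟩ := (PreparametrisedSpace.mem_prod_rep _ _ _ _ _).1 h
  obtain ⟨Ψ, h3, h4⟩ := exists_isControlled ((mem_intervalFunctions_rep _ _).1 h1) hφ.2.1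
    (l := (intervalFunctions.prod intervalFunctions).param _ hφ) fun n => le_max_left _ _
  obtain ⟨Χ, h5, h6⟩ := exists_isControlled ((mem_intervalFunctions_rep _ _).1 h2) hφ.2.2
    (l := (intervalFunctions.prod intervalFunctions).param _ hφ) fun n => le_max_right _ _
  exact ⟨ψ, χ, Ψ, Χ, rfl, h3, h5, h4, h6⟩

theorem polytimeComputable_pointwise {T : DyadicInterval → DyadicInterval → DyadicInterval}
    {t : ℝ → ℝ → ℝ} {F : C(unitInterval, ℝ) × C(unitInterval, ℝ) → C(unitInterval, ℝ)}
    {op : Str → Str → Str → Str} {B : (ℕ → ℕ) → ℕ → ℕ} (hT : IsEnclosure T t)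
    (hw : ∀ K L, K = .whole ∨ L = .whole → T K L = .whole) (hF : ∀ f g x, F (f, g) x = t (f x) (g x))
    (hnorm : ∀ f g, ‖F (f, g)‖ + 1 ≤ (‖f‖ + 1) * (‖g‖ + 1))
    (hop : PT fun _ ρ => op (ρ 0) (ρ 1) (ρ 2)) (hcode : CodesOperation op T)
    (hB : IsSecondOrderPoly B)
    (hmod : ∀ {Ψ Χ f g l}, IsControlled Ψ f l → IsControlled Χ g l → ∀ n,
      ModulusAt (pointwiseI T Ψ Χ) n (B l n)) :
    PolytimeComputable (intervalFunctions.prod intervalFunctions) intervalFunctions F := by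
  refine polytimeComputable_of (PT.onGridStr (PT.pointwiseStr hop))
    ((IsSecondOrderPoly.param.add .param).add hB) ?_
  rintro φ ⟨f, g⟩ hfg hφ
  obtain ⟨ψ, χ, Ψ, Χ, rfl, h1, h2, h3, h4⟩ := exists_controlled_of_mem_prod hfg hφ
  refine ⟨pointwiseI T Ψ Χ, _, _,
    codesIntervalFun_onGridStr (codesInterval_pointwiseStr hcode hw h1 h2),
    isIntervalExtension_pointwiseI hT h3.extension h4.extension (hF f g)
      fun n => ⟨_, hmod h3 h4 n⟩, fun n => ?_, hmod h3 h4, fun n => le_rfl⟩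
  rw [pow_add]
  exact (hnorm f g).trans (mul_le_mul (h3.norm_le n) (h4.norm_le n) (by positivity) (by positivity))

end

end IntervalComplexity

open IntervalComplexity

/-- Pointwise addition, subtraction and multiplication `C([0,1]) × C([0,1]) → C([0,1])`, and
composition `C([0,1]) × C([0,1],[0,1]) → C([0,1])`, are polytime computable on the space of interval
functions. -/
theorem mainTheorem10 :
    PolytimeComputable (intervalFunctions.prod intervalFunctions) intervalFunctions
      (fun p : C(unitInterval, ℝ) × C(unitInterval, ℝ) => p.1 + p.2) ∧
    PolytimeComputable (intervalFunctions.prod intervalFunctions) intervalFunctions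
      (fun p : C(unitInterval, ℝ) × C(unitInterval, ℝ) => p.1 - p.2) ∧
    PolytimeComputable (intervalFunctions.prod intervalFunctions) intervalFunctions
      (fun p : C(unitInterval, ℝ) × C(unitInterval, ℝ) => p.1 * p.2) ∧
    PolytimeComputable (intervalFunctions.prod intervalSelfMaps) intervalFunctions
      (fun p : C(unitInterval, ℝ) × C(unitInterval, unitInterval) => p.1.comp p.2) := by
  have hadd : IsSecondOrderPoly fun l n => l (n + 1 + 1) + n + 7 :=
    ((((IsSecondOrderPoly.arg.add (.const 1)).add (.const 1)).app.add .arg).add (.const 7))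
  have hwhole : ∀ K L, K = .whole ∨ L = .whole →
      addI K L = .whole ∧ subI K L = .whole ∧ mulI K L = .whole := by
    rintro K L (rfl | rfl)
    · exact ⟨rfl, rfl, rfl⟩
    · cases K <;> exact ⟨rfl, rfl, rfl⟩
  refine ⟨?_, ?_, ?_, ?_⟩
  · refine polytimeComputable_pointwise isEnclosure_addI (fun K L h => (hwhole K L h).1)
      (fun f g x => rfl) (fun f g => ?_) PT.addStr codesOperation_addStr hadd
      fun h1 h2 n => (modulusAt_addI h1 h2 n).1
    have := norm_add_le f g
    nlinarith [norm_nonneg f, norm_nonneg g, mul_nonneg (norm_nonneg f) (norm_nonneg g)]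
  · refine polytimeComputable_pointwise isEnclosure_subI (fun K L h => (hwhole K L h).2.1)
      (fun f g x => rfl) (fun f g => ?_) PT.subStr codesOperation_subStr hadd
      fun h1 h2 n => (modulusAt_addI h1 h2 n).2
    have := norm_sub_le f g
    nlinarith [norm_nonneg f, norm_nonneg g, mul_nonneg (norm_nonneg f) (norm_nonneg g)]
  · refine polytimeComputable_pointwise isEnclosure_mulI (fun K L h => (hwhole K L h).2.2)
      (fun f g x => rfl) (fun f g => ?_) PT.mulStr codesOperation_mulStr
      (B := fun l n => l (n + l n + 2 + 1) + n + l n + 8)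
      (((((((IsSecondOrderPoly.arg.add .param).add (.const 2)).add (.const 1)).app).add .arg).add
        .param).add (.const 8))
      fun h1 h2 n => modulusAt_mulI h1 h2 n
    have := norm_mul_le f g
    nlinarith [norm_nonneg f, norm_nonneg g]
  · refine polytimeComputable_of (Q := fun l n => l n + (l (l (n + 1) + 1) + l (n + 1) + n + 6))
      (PT.onGridStr PT.compStr)
      (.add .param ((((((IsSecondOrderPoly.arg.add (.const 1)).app.add (.const 1)).app).add
        (IsSecondOrderPoly.arg.add (.const 1)).app).add .arg).add (.const 6))) ?_
    rintro φ ⟨f, g⟩ hfg hφ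
    obtain ⟨ψ, χ, rfl, h1, h2⟩ := (PreparametrisedSpace.mem_prod_rep _ _ _ _ _).1 hfg
    rw [intervalSelfMaps, PreparametrisedSpace.mem_subspace_rep] at h2
    obtain ⟨Ψ, h3, h4⟩ := exists_isControlled ((mem_intervalFunctions_rep _ _).1 h1) hφ.2.1
      (l := (intervalFunctions.prod intervalSelfMaps).param _ hφ) fun n => le_max_left _ _
    obtain ⟨Χ, h5, h6⟩ := exists_isControlled ((mem_intervalFunctions_rep _ _).1 h2)
      (Exists.choose hφ.2.2)
      (l := (intervalFunctions.prod intervalSelfMaps).param _ hφ) fun n => le_max_right _ _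
    refine ⟨compI Ψ Χ, _, _, codesIntervalFun_onGridStr (codesInterval_compStr h3 h5),
      isIntervalExtension_compI h4.extension h6.extension fun n => ⟨_, modulusAt_compI h4 h6 n⟩,
      fun n => (add_le_add_left ?_ 1).trans (h4.norm_le n), modulusAt_compI h4 h6, fun n => le_rfl⟩
    exact (ContinuousMap.norm_le _ (norm_nonneg _)).2 fun x => f.norm_coe_le_norm (g x)
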